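/- Theorem. Let $N \ge 3$ be odd. For a smooth potential $V:\mathbb{R}\to\mathbb{R}$ with Taylor expansion $V(x)=\frac12x^2+\frac{\alpha}{3!}x^3+\frac{\beta}{4!}x^4+\dots$ at $0$, where $\alpha,\beta\in\mathbb{R}$, consider the periodic FPU chain with Hamiltonian $$H_V(q,p)=\frac12\sum_{n=1}^N p_n^2+\sum_{n=1}^N V(q_{n+1}-q_n),\qquad q_{N+1}=q_1 ,$$ on $\mathbb{R}^{2N}$ with the symplectic form $\sum_n dq_n\wedge dp_n$. Write $Q=\frac1N\sum_n q_n$ and $P=\frac1N\sum_n p_n$, and let $E=\{(q,p): \sum_n q_n=\sum_n p_n=0\}$ be the reduced phase space, of dimension $2N-2$, with the restricted symplectic form; every state is uniquely the sum of the relative equilibrium $e_{Q,P}=((Q,\dots,Q),(P,\dots,P))$ and an element of $E$. For all $\alpha,\beta\in\mathbb{R}$ there are real analytic canonical coordinates $(x_k,y_k)_{1\le k\le N-1}$ on a neighbourhood of the origin in $E$, vanishing at the origin, which are the same for all potentials $V$ with these $\alpha,\beta$ and whose differential at the origin does not depend on $\alpha,\beta$ either, such that for every such $V$, in these coordinates,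 $$H_V=\frac{NP^2}{2}+H_{\alpha,\beta}(I)+O(|(x,y)|^5),\qquad I_k=\tfrac12(x_k^2+y_k^2),$$ as $(x,y)\to0$, uniformly in $Q,P\in\mathbb{R}$, where $$H_{\alpha,\beta}(I)=2\sum_{k=1}^{N-1}\sin\frac{k\pi}{N}\,I_k+\frac1{4N}\sum_{k=1}^{N-1}\Big(\alpha^2+(\beta-\alpha^2)\sin^2\frac{k\pi}{N}\Big)I_k^2+\frac{\beta-\alpha^2}{2N}\sum_{\substack{1\le l,m\le N-1\\ l\ne m}}\sin\frac{l\pi}{N}\sin\frac{m\pi}{N}\,I_lI_m .$$ In particular, for all $Q,P$, the chain is in these coordinates in Birkhoff normal form up to order $4$: up to an additive constant, $H_V=N_2+N_4+O(|(x,y)|^5)$ with $N_2,N_4$ homogeneous polynomials of order $2$ and $4$ in $(x,y)$ that are polynomials in the $x_k^2+y_k^2$. -/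

import Mathlib

open Topology Asymptotics

noncomputable section

/-- The phase space `ℝⁿ × ℝⁿ` of positions (first component) and momenta (second component).
The norm is the sup norm; it enters only through `O(·)` estimates at the origin. -/
abbrev Phase (n : ℕ) : Type := (Fin n → ℝ) × (Fin n → ℝ)

/-- The standard symplectic form `∑ dqᵢ ∧ dpᵢ`. -/
def symplecticForm {n : ℕ} (a b : Phase n) : ℝ :=
  ∑ i, (a.1 i * b.2 i - a.2 i * b.1 i)

/-- The Hamiltonian of the periodic FPU chain with `N` particles and potential `V`. The index
`finRotate N n` is the cyclic successor of `n`, so the boundary conditions are periodic. -/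
def fpuHamiltonian (N : ℕ) (V : ℝ → ℝ) (z : Phase N) : ℝ :=
  (1 / 2) * ∑ n, (z.2 n) ^ 2 + ∑ n, V (z.1 (finRotate N n) - z.1 n)

/-- `V` is an FPU potential with parameters `α`, `β`: a smooth function on `ℝ` with Taylor
expansion `x² / 2 + α x³ / 3! + β x⁴ / 4! + ⋯` at `0`. -/
structure IsFPUPotential (α β : ℝ) (V : ℝ → ℝ) : Prop where
  smooth : ContDiff ℝ (⊤ : ℕ∞) V
  coeff_zero : V 0 = 0
  coeff_one : iteratedDeriv 1 V 0 = 0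
  coeff_two : iteratedDeriv 2 V 0 = 1
  coeff_three : iteratedDeriv 3 V 0 = α
  coeff_four : iteratedDeriv 4 V 0 = β

/-- The relative equilibrium with centre of mass `Q` and mean momentum `P`. -/
def equilibrium (N : ℕ) (Q P : ℝ) : Phase N := (fun _ => Q, fun _ => P)

/-- The reduced phase space, of dimension `2N - 2`: the states with centre of mass `0` and total
momentum `0`. Every state `z` is uniquely `equilibrium N Q P + z'` with `z'` in this space, where
`Q` and `P` are the means of the positions and of the momenta; this splitting is orthogonal for
the symplectic form, whose restriction to the second summand is `dQ ∧ d(N P)`. -/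
def reducedPhase (N : ℕ) : Submodule ℝ (Phase N) where
  carrier := {z | ∑ i, z.1 i = 0 ∧ ∑ i, z.2 i = 0}
  zero_mem' := by simp
  add_mem' := by
    rintro a b ⟨ha, ha'⟩ ⟨hb, hb'⟩
    simp [Finset.sum_add_distrib, ha, ha', hb, hb']
  smul_mem' := by
    rintro c a ⟨ha, ha'⟩
    simp [← Finset.mul_sum, ha, ha']

/-- Real analytic canonical coordinates `(x, y)` on the reduced phase space near the equilibrium,
centred at it: a real analytic diffeomorphism `Φ` from an open neighbourhood of `0` onto an open
neighbourhood of `0` in `ℝ^(N-1) × ℝ^(N-1)` with `Φ^* (∑ dx_k ∧ dy_k) = ∑ dq_i ∧ dp_i`. -/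
structure IsCanonicalChart {N : ℕ} (Φ : OpenPartialHomeomorph (reducedPhase N) (Phase (N - 1))) :
    Prop where
  zero_mem_source : (0 : reducedPhase N) ∈ Φ.source
  map_zero : Φ 0 = 0
  analytic : AnalyticOnNhd ℝ Φ Φ.source
  analytic_symm : AnalyticOnNhd ℝ Φ.symm Φ.target
  symplectic : ∀ z ∈ Φ.source, ∀ a b : reducedPhase N,
    symplecticForm (fderiv ℝ Φ z a) (fderiv ℝ Φ z b) = symplecticForm (a : Phase N) (b : Phase N)

/-- The actions `I_k = (x_k² + y_k²) / 2`. -/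
def action {n : ℕ} (w : Phase n) (k : Fin n) : ℝ := ((w.1 k) ^ 2 + (w.2 k) ^ 2) / 2

/-- `sin (k π / N)` for `1 ≤ k ≤ N - 1`; the element `k : Fin (N - 1)` stands for the
index `k + 1`. -/
def sinFreq (N : ℕ) (k : Fin (N - 1)) : ℝ := Real.sin (((k : ℕ) + 1 : ℝ) * Real.pi / N)

/-- The polynomial `H_{α, β}(I)`. -/
def fpuNormalForm (N : ℕ) (α β : ℝ) (I : Fin (N - 1) → ℝ) : ℝ :=
  2 * ∑ k, sinFreq N k * I k
    + 1 / (4 * N) * ∑ k, (α ^ 2 + (β - α ^ 2) * sinFreq N k ^ 2) * I k ^ 2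
    + (β - α ^ 2) / (2 * N) *
        ∑ l, ∑ m, if l ≠ m then sinFreq N l * sinFreq N m * I l * I m else 0

/-- `H` is, up to an additive constant, in Birkhoff normal form up to order `m`:
`H = H(0) + N₂ + N₄ + ⋯ + O(|w|^(m+1))`, where `N_{2j}`, `2 ≤ 2j ≤ m`, is a homogeneous polynomial
of order `2j` in `w = (q, p)` which is a polynomial function of the `q_k² + p_k²`. -/
def InBirkhoffNormalForm {n : ℕ} (m : ℕ) (H : Phase n → ℝ) : Prop :=
  ∃ g : ℕ → MvPolynomial (Fin n) ℝ, (∀ j, (g j).IsHomogeneous j) ∧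
    (fun w : Phase n => H w - H 0 -
      ∑ j ∈ Finset.Icc 1 (m / 2), MvPolynomial.eval (fun k => (w.1 k) ^ 2 + (w.2 k) ^ 2) (g j))
    =O[𝓝 0] fun w => ‖w‖ ^ (m + 1)

end

/-! Splitting the lattice Fourier transform into travelling waves gives a linear canonical map
`modeMap` onto the reduced phase space that turns the quadratic part of the Hamiltonian into ∑ 2
sin(kπ/N) I_k. In the complex coordinates z_κ with momenta κ = ±k, the signed frequency of z_κ is 2
sin(κπ/N). Invariance under cyclic shifts makes a cubic or quartic coefficient vanish unless its
momenta add up to 0 modulo N. A Birkhoff step removes every monomial whose frequencies do not add up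
to 0, so the question is which monomials satisfy both conditions.

The modes k and N - k have equal frequencies, hence non-resonance cannot be generic; it is
arithmetic. With ζ = exp(iπ/N), 2i sin(κπ/N) = ζ^κ - ζ^(-κ). Reduce the algebraic integers modulo a
maximal ideal containing 2: the minus sign becomes a plus sign, and, N being odd, ζ becomes a root
of unity x of exact order N. Three numbers with product 1 and ∑ (y + y⁻¹) = 0 in characteristic 2
include 1; among four such numbers the inverse of each occurs. Hence no cubic monomial is resonant
(`sin_add_sin_add_sin_ne_zero`), and a resonant quartic monomial is a product of two pairs z_κ
z_(-κ) (`opposite_of_resonance`), that is, a product of actions.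

The transformations are not flows but finite compositions of the shears w ↦ w + c ω(u, w)^d u, which
are polynomial, symplectic and explicitly invertible. By polarization every real cubic or quartic
form is a sum of powers of the linear forms ω(u, ·), so compositions of shears realize any generator
as far as the orders in question see it (`exists_hasJet_cubic`, `exists_hasJet_quartic`). They are
tangent to the identity, so the differential of the chart is that of the linear normal modes.
`exists_normalization` leaves as quartic part the resonant terms of T + {U, S}/2, where U and T are
the cubic and quartic forms and S solves {H₂, S} = -U.

The bracket contributes a sum over one intermediate mode (`exchangeSum`), which has only two terms.
For k ≠ l the channels of momentum k + l and k - l give cos² of the half sum minus cos² of the half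
difference of the angles kπ/N and lπ/N, that is -sin(kπ/N) sin(lπ/N); this turns β into β - α². For
k = l only the first channel is present and gives 1 - sin², whence the extra α² on the diagonal. -/

noncomputable section

open MvPolynomial

/-! ### Functions of given order at the origin -/

/-- `f` vanishes to order `k` at the origin of the phase space. -/
def VanishesToOrder {n : ℕ} (k : ℕ) (f : Phase n → ℂ) : Prop :=
  f =O[𝓝 0] fun w => ‖w‖ ^ k

namespace VanishesToOrder

variable {n k l : ℕ} {f g : Phase n → ℂ}

theorem add (hf : VanishesToOrder k f) (hg : VanishesToOrder k g) :
    VanishesToOrder k (fun w => f w + g w) := IsBigO.add hf hg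

theorem mul (hf : VanishesToOrder k f) (hg : VanishesToOrder l g) :
    VanishesToOrder (k + l) (fun w => f w * g w) := by
  simpa only [VanishesToOrder, pow_add] using IsBigO.mul hf hg

theorem mono (h : l ≤ k) (hf : VanishesToOrder k f) : VanishesToOrder l f := by
  refine IsBigO.trans hf (IsBigO.of_bound 1 ?_)
  filter_upwards [Metric.ball_mem_nhds (0 : Phase n) one_pos] with w hw
  have hw' : ‖w‖ ≤ 1 := by simpa using (Metric.mem_ball.1 hw).le
  rw [one_mul, norm_pow, norm_pow, norm_norm]
  exact pow_le_pow_of_le_one (norm_nonneg _) hw' h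

theorem const_mul (c : ℂ) (hf : VanishesToOrder k f) :
    VanishesToOrder k (fun w => c * f w) := IsBigO.const_mul_left hf c

theorem congr (hf : VanishesToOrder k f) (h : ∀ w, g w = f w) : VanishesToOrder k g := by
  rwa [show g = f from funext h]

theorem zero : VanishesToOrder k (fun _ : Phase n => (0 : ℂ)) := isBigO_zero _ _

theorem sum {ι : Type*} {s : Finset ι} {F : ι → Phase n → ℂ}
    (h : ∀ i ∈ s, VanishesToOrder k (F i)) : VanishesToOrder k (fun w => ∑ i ∈ s, F i w) :=
  IsBigO.fun_sum h

theorem comp {Ψ : Phase n → Phase n} (hf : VanishesToOrder k f)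
    (hΨ : Ψ =O[𝓝 0] fun w => w) :
    VanishesToOrder k (fun w => f (Ψ w)) := by
  have ht : Filter.Tendsto Ψ (𝓝 0) (𝓝 0) := hΨ.trans_tendsto Filter.tendsto_id
  exact (hf.comp_tendsto ht).trans (hΨ.norm_norm.pow k)

end VanishesToOrder

/-! ### Complex mode coordinates -/

/-- Indices of the complex coordinates `(x_k ± i y_k) / √2`. -/
abbrev Mode (n : ℕ) : Type := Fin n × Bool

namespace Mode

variable {n : ℕ}

/-- The index of the complex conjugate coordinate. -/
def conj (j : Mode n) : Mode n := (j.1, !j.2)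

/-- The sign of a mode. -/
def sign (j : Mode n) : ℝ := if j.2 then 1 else -1

@[simp] theorem conj_conj (j : Mode n) : j.conj.conj = j := by simp [conj]

@[simp] theorem sign_conj (j : Mode n) : j.conj.sign = -j.sign := by
  rcases j with ⟨k, b⟩; cases b <;> simp [conj, sign]

theorem conj_ne (j : Mode n) : j.conj ≠ j := by
  rcases j with ⟨k, b⟩; cases b <;> simp [conj]

theorem sign_mul_self (j : Mode n) : j.sign * j.sign = 1 := by
  rcases j with ⟨k, b⟩; cases b <;> simp [sign]

/-- Complex conjugation as a permutation of the modes. -/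
def conjEquiv : Mode n ≃ Mode n := ⟨conj, conj, conj_conj, conj_conj⟩

theorem sum_conj {M : Type*} [AddCommMonoid M] (f : Mode n → M) :
    ∑ j, f (conj j) = ∑ j, f j := conjEquiv.sum_comp f

/-- The complex coordinates of a state. -/
def coord (w : Phase n) (j : Mode n) : ℂ :=
  ((w.1 j.1 : ℂ) + j.sign * w.2 j.1 * Complex.I) / (√2 : ℝ)

theorem coord_add (w v : Phase n) (j : Mode n) : coord (w + v) j = coord w j + coord v j := by
  simp [coord]; ring

theorem coord_smul (c : ℝ) (w : Phase n) (j : Mode n) : coord (c • w) j = c * coord w j := by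
  simp [coord]; ring

theorem sqrt_two_mul_self : ((√2 : ℝ) : ℂ) * ((√2 : ℝ) : ℂ) = 2 := by
  norm_cast; simp

/-- The factor 1/√2 in the coordinates is chosen so that no constant appears here; paired monomials
thus become monomials in the actions. -/
theorem coord_mul_conj (w : Phase n) (j : Mode n) :
    coord w j * coord w j.conj = (action w j.1 : ℂ) := by
  have h2 := sqrt_two_mul_self
  have hs : ((j.sign : ℝ) : ℂ) * j.sign = 1 := by exact_mod_cast j.sign_mul_self
  simp only [coord, sign_conj, div_mul_div_comm, h2, action]
  push_cast [conj]
  linear_combination (-(w.2 j.1 : ℂ) ^ 2 * j.sign * j.sign / 2) * Complex.I_sq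
    + (w.2 j.1 : ℂ) ^ 2 / 2 * hs

theorem vanishesToOrder_coord (j : Mode n) :
    VanishesToOrder 1 (fun w : Phase n => coord w j) := by
  refine IsBigO.of_bound 2 (Filter.Eventually.of_forall fun w => ?_)
  have h1 : ‖(w.1 j.1)‖ ≤ ‖w‖ := (norm_le_pi_norm w.1 j.1).trans (norm_fst_le w)
  have h2 : ‖(w.2 j.1)‖ ≤ ‖w‖ := (norm_le_pi_norm w.2 j.1).trans (norm_snd_le w)
  have hs : |j.sign| = 1 := by rcases j with ⟨k, b⟩; cases b <;> simp [sign]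
  have h3 : (1 : ℝ) ≤ |√2| := by rw [abs_of_nonneg (by positivity)]; simp
  rw [coord, norm_div]
  refine (div_le_self (norm_nonneg _) (by simpa using h3)).trans ((norm_add_le _ _).trans ?_)
  simp [hs] at h1 h2 ⊢
  linarith

end Mode

/-- The algebra of complex polynomials in the mode coordinates. -/
abbrev ModePoly (n : ℕ) : Type := MvPolynomial (Mode n) ℂ

/-- The value of a polynomial at a state. -/
def modeEval {n : ℕ} (w : Phase n) : ModePoly n →+* ℂ := eval (Mode.coord w)

section Eval
variable {n : ℕ}

@[simp] theorem modeEval_X (w : Phase n) (j : Mode n) : modeEval w (X j) = Mode.coord w j := by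
  simp [modeEval]

@[simp] theorem modeEval_C (w : Phase n) (c : ℂ) : modeEval w (C c) = c := by
  simp [modeEval]

theorem modeEval_smul (w : Phase n) (c : ℂ) (p : ModePoly n) :
    modeEval w (c • p) = c * modeEval w p := by
  simp [modeEval]

theorem vanishesToOrder_modeEval {a : ℕ} {p : ModePoly n} (hp : p.IsHomogeneous a) :
    VanishesToOrder a (fun w => modeEval w p) := by
  have key : ∀ m : Mode n →₀ ℕ, VanishesToOrder m.degree
      (fun w => modeEval w (monomial m (1 : ℂ))) := by
    intro m
    induction m using Finsupp.induction_linear with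
    | zero =>
      refine IsBigO.of_bound 1 (Filter.Eventually.of_forall fun w => ?_)
      simp [modeEval]
    | add f g hf hg =>
      rw [map_add]
      refine (hf.mul hg).congr fun w => ?_
      rw [← map_mul, monomial_mul, one_mul]
    | single j k =>
      have h := (Mode.vanishesToOrder_coord j).pow k
      simp only [pow_one] at h
      simpa [VanishesToOrder, modeEval, monomial_eq] using h
  have h := VanishesToOrder.sum (k := a) (s := p.support)
    (F := fun m w => p.coeff m * modeEval w (monomial m (1 : ℂ))) fun m hm => by
      have hd : m.degree = a :=
        (DFunLike.congr_fun (Finsupp.degree_eq_weight_one (R := ℕ)) m).trans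
          (hp (mem_support_iff.1 hm))
      exact (hd ▸ key m).const_mul _
  refine h.congr fun w => ?_
  conv_lhs => rw [p.as_sum]
  rw [map_sum]
  refine Finset.sum_congr rfl fun m _ => ?_
  rw [← modeEval_smul, smul_monomial, smul_eq_mul, mul_one]

end Eval

/-! ### Hamiltonian derivations -/

section HamDer
variable {n : ℕ}

/-- The derivation `f ↦ {f, s}`, for the Poisson bracket with `{x_k, y_k} = 1`. -/
def hamDer (s : ModePoly n) : Derivation ℂ (ModePoly n) (ModePoly n) :=
  -- For z = (x + iy)/√2 one has {z, z̄} = -i, and all other brackets of coordinates vanish.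
  ∑ j : Mode n, (C (-Complex.I * j.sign) * pderiv j.conj s) • pderiv j

theorem hamDer_apply (s p : ModePoly n) :
    hamDer s p = ∑ j : Mode n, C (-Complex.I * j.sign) * pderiv j.conj s * pderiv j p := by
  simp only [hamDer, ← Derivation.coeFnAddMonoidHom_apply, map_sum, Finset.sum_apply]
  simp

theorem hamDer_add (s t : ModePoly n) : hamDer (s + t) = hamDer s + hamDer t := by
  simp only [hamDer, map_add, mul_add, add_smul, Finset.sum_add_distrib]

theorem hamDer_antisymm (s t : ModePoly n) : hamDer s t = -hamDer t s := by
  rw [hamDer_apply, hamDer_apply, ← Mode.sum_conj, ← Finset.sum_neg_distrib]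
  refine Finset.sum_congr rfl fun j _ => ?_
  simp; ring

theorem isHomogeneous_hamDer {s p : ModePoly n} {d a : ℕ} (hs : s.IsHomogeneous (d + 2))
    (hp : p.IsHomogeneous a) : (hamDer s p).IsHomogeneous (a + d) := by
  rw [hamDer_apply]
  refine IsHomogeneous.sum _ _ _ fun j _ => ?_
  -- Constants are treated apart because the degree `a - 1` of the partial derivative truncates at
  -- `a = 0`.
  rcases Nat.eq_zero_or_pos a with rfl | ha
  · rw [← totalDegree_zero_iff_isHomogeneous, totalDegree_eq_zero_iff_eq_C] at hp
    rw [hp]; simp [isHomogeneous_zero]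
  · have h := ((hs.pderiv (i := j.conj)).C_mul (-Complex.I * j.sign)).mul (hp.pderiv (i := j))
    have e : d + 2 - 1 + (a - 1) = a + d := by omega
    rwa [e] at h

/-- The linear form `w ↦ ω(u, w)`. -/
def symplecticLin (u : Phase n) : ModePoly n :=
  ∑ j : Mode n, C (-Complex.I * j.sign * Mode.coord u j.conj) * X j

theorem modeEval_symplecticLin (u w : Phase n) :
    modeEval w (symplecticLin u) = (symplecticForm u w : ℂ) := by
  have h2 := Mode.sqrt_two_mul_self
  simp only [symplecticLin, map_sum, map_mul, modeEval_C, modeEval_X, symplecticForm]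
  rw [Fintype.sum_prod_type]
  push_cast
  refine Finset.sum_congr rfl fun k _ => ?_
  have h0 : ((√2 : ℝ) : ℂ) ≠ 0 := by intro h; simp [h] at h2
  simp [Mode.coord, Mode.sign, Mode.conj]
  field_simp
  rw [pow_two, h2]
  linear_combination (-2 * ((u.1 k : ℂ) * w.2 k - u.2 k * w.1 k)) * Complex.I_sq

theorem isHomogeneous_symplecticLin (u : Phase n) : (symplecticLin u).IsHomogeneous 1 :=
  IsHomogeneous.sum _ _ _ fun _ _ => isHomogeneous_C_mul_X _ _

theorem symplecticLin_add (u v : Phase n) :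
    symplecticLin (u + v) = symplecticLin u + symplecticLin v := by
  simp [symplecticLin, Mode.coord_add, mul_add, add_mul, Finset.sum_add_distrib]

theorem symplecticLin_smul (c : ℝ) (u : Phase n) :
    symplecticLin (c • u) = C (c : ℂ) * symplecticLin u := by
  rw [symplecticLin, symplecticLin, Finset.mul_sum]
  refine Finset.sum_congr rfl fun j _ => ?_
  simp only [Mode.coord_smul, map_mul]; ring

theorem pderiv_symplecticLin (u : Phase n) (j : Mode n) :
    pderiv j (symplecticLin u) = C (-Complex.I * j.sign * Mode.coord u j.conj) := by
  classical
  rw [symplecticLin, map_sum, Finset.sum_eq_single j]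
  · simp [pderiv_X]
  · intro b _ hb; simp [pderiv_X, hb]
  · simp

theorem hamDer_symplecticLin_X (u : Phase n) (j : Mode n) :
    hamDer (symplecticLin u) (X j) = C (Mode.coord u j) := by
  classical
  rw [hamDer_apply, Finset.sum_eq_single j]
  · rw [pderiv_symplecticLin, pderiv_X_self, mul_one, ← C_mul]
    congr 1
    have hs : ((j.sign : ℝ) : ℂ) * j.sign = 1 := by exact_mod_cast j.sign_mul_self
    simp only [Mode.sign_conj, Mode.conj_conj]
    push_cast
    linear_combination (-(j.sign : ℂ) * j.sign * Mode.coord u j) * Complex.I_sq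
      + Mode.coord u j * hs
  · intro b _ hb; simp [pderiv_X, Ne.symm hb]
  · simp

theorem hamDer_symplecticLin_self (u : Phase n) :
    hamDer (symplecticLin u) (symplecticLin u) = 0 := by
  have h := hamDer_antisymm (symplecticLin u) (symplecticLin u)
  have h2 : (2 : ℂ) • hamDer (symplecticLin u) (symplecticLin u) = 0 := by
    rw [two_smul]; nth_rewrite 1 [h]; simp
  simpa using h2

/-- The generator `c ω(u, ·)^(d + 1) / (d + 1)` of a symplectic shear. -/
def shearGenerator (c : ℝ) (d : ℕ) (u : Phase n) : ModePoly n :=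
  C ((c / (d + 1) : ℝ) : ℂ) * symplecticLin u ^ (d + 1)

theorem isHomogeneous_shearGenerator (c : ℝ) (d : ℕ) (u : Phase n) :
    (shearGenerator c d u).IsHomogeneous (d + 1) := by
  simpa [shearGenerator] using
    ((isHomogeneous_symplecticLin u).pow (d + 1)).C_mul ((c / (d + 1) : ℝ) : ℂ)

/-- This is the chain rule for a power of ω(u, ·). Antisymmetry first moves the power into the slot
where `hamDer` is a derivation. -/
theorem hamDer_shearGenerator (c : ℝ) (d : ℕ) (u : Phase n) (p : ModePoly n) :
    hamDer (shearGenerator c d u) p =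
      C (c : ℂ) * symplecticLin u ^ d * hamDer (symplecticLin u) p := by
  have h : ((c / (d + 1) : ℝ) : ℂ) * (d + 1) = c := by
    have : ((d : ℝ) + 1) ≠ 0 := by positivity
    rw [← Complex.ofReal_natCast, ← Complex.ofReal_one, ← Complex.ofReal_add,
      ← Complex.ofReal_mul, div_mul_cancel₀ _ this]
  rw [hamDer_antisymm, shearGenerator, Derivation.leibniz, Derivation.leibniz_pow,
    hamDer_antisymm (symplecticLin u) p]
  rw [← h]
  simp [smul_eq_mul, nsmul_eq_mul]
  ring

end HamDer

/-! ### Symplectic shears -/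

section Shear
variable {n : ℕ}

/-- `symplecticForm u` as a continuous linear form. -/
def symplecticCLM (u : Phase n) : Phase n →L[ℝ] ℝ :=
  LinearMap.toContinuousLinearMap
    { toFun := symplecticForm u
      map_add' := fun a b => by
        simp only [symplecticForm, ← Finset.sum_add_distrib]
        refine Finset.sum_congr rfl fun i _ => ?_
        simp; ring
      map_smul' := fun c a => by
        simp only [symplecticForm, smul_eq_mul, Finset.mul_sum, RingHom.id_apply]
        refine Finset.sum_congr rfl fun i _ => ?_
        simp; ring }

@[simp] theorem symplecticCLM_apply (u w : Phase n) : symplecticCLM u w = symplecticForm u w := rfl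

theorem symplecticForm_antisymm (u w : Phase n) : symplecticForm u w = -symplecticForm w u := by
  simp only [symplecticForm, ← Finset.sum_neg_distrib]
  exact Finset.sum_congr rfl fun i _ => by ring

theorem symplecticForm_self (u : Phase n) : symplecticForm u u = 0 := by
  have := symplecticForm_antisymm u u
  linarith

theorem symplecticForm_add_smul_right (u w v : Phase n) (c : ℝ) :
    symplecticForm u (w + c • v) = symplecticForm u w + c * symplecticForm u v := by
  simp only [← symplecticCLM_apply, map_add, map_smul, smul_eq_mul]

theorem symplecticForm_add_smul_left (u w v : Phase n) (c : ℝ) :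
    symplecticForm (w + c • v) u = symplecticForm w u + c * symplecticForm v u := by
  rw [symplecticForm_antisymm, symplecticForm_add_smul_right, symplecticForm_antisymm w,
    symplecticForm_antisymm v]; ring

/-- The time one map of the Hamiltonian `c ω(u, ·)^(d + 1) / (d + 1)`. -/
def shearMap (c : ℝ) (d : ℕ) (u w : Phase n) : Phase n := w + (c * symplecticForm u w ^ d) • u

/-- Since ω(u, u) = 0, moving along u does not change ω(u, ·). Hence the Hamiltonian flow is exactly
linear in time, and changing the sign of c inverts the shear. -/
theorem symplecticForm_shearMap (c : ℝ) (d : ℕ) (u w : Phase n) :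
    symplecticForm u (shearMap c d u w) = symplecticForm u w := by
  rw [shearMap, symplecticForm_add_smul_right, symplecticForm_self, mul_zero, add_zero]

theorem shearMap_neg_shearMap (c : ℝ) (d : ℕ) (u w : Phase n) :
    shearMap (-c) d u (shearMap c d u w) = w := by
  rw [shearMap, symplecticForm_shearMap, shearMap, add_assoc, ← add_smul]
  simp

theorem hasFDerivAt_shearMap (c : ℝ) (d : ℕ) (u w : Phase n) :
    HasFDerivAt (shearMap c d u) (ContinuousLinearMap.id ℝ (Phase n) +
      ((c * (d * symplecticForm u w ^ (d - 1))) • symplecticCLM u).smulRight u) w := by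
  have h : HasFDerivAt (fun w => symplecticForm u w) (symplecticCLM u) w :=
    (symplecticCLM u).hasFDerivAt
  have h2 := (hasFDerivAt_id w).add (((h.pow d).const_mul c).smul_const u)
  refine h2.congr_fderiv ?_
  ext <;> simp [smul_smul, mul_assoc]

theorem analyticOnNhd_shearMap (c : ℝ) (d : ℕ) (u : Phase n) :
    AnalyticOnNhd ℝ (shearMap c d u) Set.univ := by
  intro w _
  have h : AnalyticAt ℝ (fun w => symplecticForm u w) w := (symplecticCLM u).analyticAt w
  exact analyticAt_id.add ((analyticAt_const.mul (h.pow d)).smul analyticAt_const)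

/-- Real analytic symplectic automorphisms of the phase space that are tangent to the identity at
the origin. -/
structure IsSymplecticAut (Ψ : Phase n ≃ₜ Phase n) : Prop where
  map_zero : Ψ 0 = 0
  analytic : AnalyticOnNhd ℝ Ψ Set.univ
  analytic_symm : AnalyticOnNhd ℝ Ψ.symm Set.univ
  symplectic : ∀ w a b, symplecticForm (fderiv ℝ Ψ w a) (fderiv ℝ Ψ w b) = symplecticForm a b
  tangent : HasFDerivAt Ψ (ContinuousLinearMap.id ℝ (Phase n)) 0

theorem IsSymplecticAut.refl : IsSymplecticAut (Homeomorph.refl (Phase n)) where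
  map_zero := rfl
  analytic := analyticOnNhd_id
  analytic_symm := analyticOnNhd_id
  symplectic w a b := by
    have : fderiv ℝ (Homeomorph.refl (Phase n)) w = ContinuousLinearMap.id ℝ _ := fderiv_id
    rw [this]; rfl
  tangent := hasFDerivAt_id 0

theorem IsSymplecticAut.trans {Ψ Χ : Phase n ≃ₜ Phase n} (h : IsSymplecticAut Ψ)
    (h' : IsSymplecticAut Χ) : IsSymplecticAut (Ψ.trans Χ) where
  map_zero := by simp [h.map_zero, h'.map_zero]
  analytic := h'.analytic.comp h.analytic (Set.mapsTo_univ _ _)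
  analytic_symm := h.analytic_symm.comp h'.analytic_symm (Set.mapsTo_univ _ _)
  symplectic w a b := by
    have : fderiv ℝ (Ψ.trans Χ) w = (fderiv ℝ Χ (Ψ w)).comp (fderiv ℝ Ψ w) :=
      fderiv_comp w (h'.analytic _ (Set.mem_univ _)).differentiableAt
        (h.analytic _ (Set.mem_univ _)).differentiableAt
    rw [this]
    simp [h'.symplectic, h.symplectic]
  tangent := by
    have h2 := h'.tangent
    rw [← h.map_zero] at h2
    exact h2.comp 0 h.tangent

theorem IsSymplecticAut.symm_tangent {Ψ : Phase n ≃ₜ Phase n} (h : IsSymplecticAut Ψ) :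
    HasFDerivAt Ψ.symm (ContinuousLinearMap.id ℝ (Phase n)) 0 := by
  have h0 : Ψ.symm 0 = 0 := by rw [Homeomorph.symm_apply_eq, h.map_zero]
  refine HasFDerivAt.of_local_left_inverse (f' := ContinuousLinearEquiv.refl ℝ (Phase n))
    (f := Ψ) Ψ.symm.continuous.continuousAt ?_ (Filter.Eventually.of_forall fun w => by simp)
  rw [h0]; exact h.tangent

/-- A shear as a homeomorphism. -/
def shear (c : ℝ) (d : ℕ) (u : Phase n) : Phase n ≃ₜ Phase n where
  toFun := shearMap c d u
  invFun := shearMap (-c) d u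
  left_inv := shearMap_neg_shearMap c d u
  right_inv w := by simpa using shearMap_neg_shearMap (-c) d u w
  continuous_toFun := continuousOn_univ.1 (analyticOnNhd_shearMap c d u).continuousOn
  continuous_invFun := continuousOn_univ.1 (analyticOnNhd_shearMap (-c) d u).continuousOn

theorem coe_shear (c : ℝ) (d : ℕ) (u : Phase n) : ⇑(shear c d u) = shearMap c d u := rfl

/-- The derivative adds a multiple of the rank one map a ↦ ω(u, a) u; its cross terms in ω cancel by
antisymmetry and its square drops out because ω(u, u) = 0. The bound d ≥ 2 makes the derivative at 0
the identity. -/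
theorem isSymplecticAut_shear (c : ℝ) {d : ℕ} (hd : 2 ≤ d) (u : Phase n) :
    IsSymplecticAut (shear c d u) where
  map_zero := by
    have : symplecticForm u 0 = 0 := (symplecticCLM u).map_zero
    rw [coe_shear, shearMap, this, zero_pow (by omega)]; simp
  analytic := analyticOnNhd_shearMap c d u
  analytic_symm := analyticOnNhd_shearMap (-c) d u
  symplectic w a b := by
    rw [coe_shear, (hasFDerivAt_shearMap c d u w).fderiv]
    simp only [add_apply, ContinuousLinearMap.id_apply,
      ContinuousLinearMap.smulRight_apply, smul_apply, symplecticCLM_apply,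
      symplecticForm_add_smul_left, symplecticForm_add_smul_right, symplecticForm_self,
      symplecticForm_antisymm a u, smul_eq_mul]
    ring
  tangent := by
    have h := hasFDerivAt_shearMap c d u 0
    have : symplecticForm u 0 = 0 := (symplecticCLM u).map_zero
    rw [this, zero_pow (by omega)] at h
    rw [coe_shear]
    simpa using h

end Shear

/-! ### Second order jets of transformations acting on polynomials -/

section Jet
variable {n : ℕ}

/-- Composition with `Ψ` acts on homogeneous polynomials as `1 + U₁ + U₂`, up to terms whose degree
is higher by at least three; `Uᵢ` raises degrees by `i`. -/
structure HasJet (Ψ : Phase n → Phase n) (U₁ U₂ : ModePoly n →ₗ[ℂ] ModePoly n) : Prop where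
  isBigO : Ψ =O[𝓝 0] fun w => w
  homogeneous₁ : ∀ {a : ℕ} {p : ModePoly n}, p.IsHomogeneous a → (U₁ p).IsHomogeneous (a + 1)
  homogeneous₂ : ∀ {a : ℕ} {p : ModePoly n}, p.IsHomogeneous a → (U₂ p).IsHomogeneous (a + 2)
  remainder : ∀ {a : ℕ} {p : ModePoly n}, p.IsHomogeneous a →
    VanishesToOrder (a + 3) (fun w => modeEval (Ψ w) p - modeEval w (p + U₁ p + U₂ p))

theorem HasJet.id : HasJet (fun w : Phase n => w) 0 0 where
  isBigO := isBigO_refl _ _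
  homogeneous₁ _ := isHomogeneous_zero _ _ _
  homogeneous₂ _ := isHomogeneous_zero _ _ _
  remainder _ := VanishesToOrder.zero.congr fun w => by simp

/-- Pullbacks compose in the reverse order: p is first expanded by Ψ, then each term by Χ. Hence the
mixed term is V₁ ∘ U₁ and the other products are of too high a degree. -/
theorem HasJet.comp {Ψ Χ : Phase n → Phase n} {U₁ U₂ V₁ V₂ : ModePoly n →ₗ[ℂ] ModePoly n}
    (h : HasJet Ψ U₁ U₂) (h' : HasJet Χ V₁ V₂) :
    HasJet (fun w => Ψ (Χ w)) (U₁ + V₁) (U₂ + V₁ ∘ₗ U₁ + V₂) where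
  isBigO := (h.isBigO.comp_tendsto (h'.isBigO.trans_tendsto Filter.tendsto_id)).trans h'.isBigO
  homogeneous₁ hp := (h.homogeneous₁ hp).add (h'.homogeneous₁ hp)
  homogeneous₂ hp := ((h.homogeneous₂ hp).add (h'.homogeneous₁ (h.homogeneous₁ hp))).add
    (h'.homogeneous₂ hp)
  remainder {a p} hp := by
    have r0 := (h.remainder hp).comp h'.isBigO
    have r1 := h'.remainder hp
    have r2 := (h'.remainder (h.homogeneous₁ hp)).mono (show a + 3 ≤ a + 1 + 3 by omega)
    have r3 := (h'.remainder (h.homogeneous₂ hp)).mono (show a + 3 ≤ a + 2 + 3 by omega)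
    have s1 := (vanishesToOrder_modeEval (h'.homogeneous₂ (h.homogeneous₁ hp))).mono
      (show a + 3 ≤ a + 1 + 2 by omega)
    have s2 := (vanishesToOrder_modeEval (h'.homogeneous₁ (h.homogeneous₂ hp)))
    have s3 := (vanishesToOrder_modeEval (h'.homogeneous₂ (h.homogeneous₂ hp))).mono
      (show a + 3 ≤ a + 2 + 2 by omega)
    refine ((((r0.add r1).add r2).add r3).add ((s1.add s2).add s3)).congr fun w => ?_
    simp only [map_add, LinearMap.add_apply, LinearMap.comp_apply]
    ring

/-- The expansion of one polynomial of degree `a` under a shear with derivation `E`. -/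
theorem remainder_mul {f₀ f₁ f₂ f g₀ g₁ g₂ g : Phase n → ℂ} {a b : ℕ}
    (hf₀ : VanishesToOrder a f₀) (hf₁ : VanishesToOrder (a + 1) f₁)
    (hf₂ : VanishesToOrder (a + 2) f₂)
    (hf : VanishesToOrder (a + 3) fun w => f w - (f₀ w + f₁ w + f₂ w))
    (hg₀ : VanishesToOrder b g₀) (hg₁ : VanishesToOrder (b + 1) g₁)
    (hg₂ : VanishesToOrder (b + 2) g₂)
    (hg : VanishesToOrder (b + 3) fun w => g w - (g₀ w + g₁ w + g₂ w)) :
    VanishesToOrder (a + b + 3) fun w => f w * g w -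
      (f₀ w * g₀ w + (f₀ w * g₁ w + f₁ w * g₀ w) +
        (f₀ w * g₂ w + f₁ w * g₁ w + f₂ w * g₀ w)) := by
  have e2 : VanishesToOrder (b + 2) fun w => g w - (g₀ w + g₁ w) :=
    ((hg.mono (by omega)).add hg₂).congr fun w => by ring
  have e1 : VanishesToOrder (b + 1) fun w => g w - g₀ w :=
    ((e2.mono (by omega)).add hg₁).congr fun w => by ring
  have e0 : VanishesToOrder b g := ((e1.mono (by omega)).add hg₀).congr fun w => by ring
  -- The error is split telescopically: each graded part of f meets the truncation error of g of
  -- complementary order.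
  have t0 := (hf.mul e0).mono (show a + b + 3 ≤ a + 3 + b by omega)
  have t1 := (hf₀.mul hg).mono (show a + b + 3 ≤ a + (b + 3) by omega)
  have t2 := (hf₁.mul e2).mono (show a + b + 3 ≤ a + 1 + (b + 2) by omega)
  have t3 := (hf₂.mul e1).mono (show a + b + 3 ≤ a + 2 + (b + 1) by omega)
  exact (((t0.add t1).add t2).add t3).congr fun w => by ring

theorem hamDer_hamDer_mul (s p q : ModePoly n) :
    hamDer s (hamDer s (p * q)) = p * hamDer s (hamDer s q) + 2 * (hamDer s p * hamDer s q)
      + hamDer s (hamDer s p) * q := by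
  simp only [Derivation.leibniz, map_add, smul_eq_mul]; ring

/-- On coordinates the expansion 1 + E + E²/2, with E the bracket with s, is exact since E² kills
them. Pullback is multiplicative, and so is 1 + E + E²/2 up to third order by the Leibniz rule. The
expansion therefore passes to products, to monomials and to all homogeneous polynomials. -/
theorem remainder_of_X {Ψ : Phase n → Phase n} {s : ModePoly n} {d : ℕ}
    (hs : s.IsHomogeneous (d + 3))
    (hX : ∀ j w, modeEval (Ψ w) (X j) = modeEval w (X j + hamDer s (X j)))
    (hX2 : ∀ j, hamDer s (hamDer s (X j)) = 0) {a : ℕ} {p : ModePoly n} (hp : p.IsHomogeneous a) :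
    VanishesToOrder (a + 3) (fun w => modeEval (Ψ w) p -
      (modeEval w p + modeEval w (hamDer s p) + modeEval w (hamDer s (hamDer s p)) / 2)) := by
  have h1 : ∀ {a : ℕ} {p : ModePoly n}, p.IsHomogeneous a →
      VanishesToOrder (a + 1) fun w => modeEval w (hamDer s p) := fun hp =>
    (vanishesToOrder_modeEval (isHomogeneous_hamDer (d := d + 1) hs hp)).mono (by omega)
  have h2 : ∀ {a : ℕ} {p : ModePoly n}, p.IsHomogeneous a →
      VanishesToOrder (a + 2) fun w => modeEval w (hamDer s (hamDer s p)) / 2 := fun hp =>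
    (((vanishesToOrder_modeEval (isHomogeneous_hamDer (d := d + 1) hs
      (isHomogeneous_hamDer (d := d + 1) hs hp))).mono (by omega)).const_mul (1 / 2)).congr
        fun w => by ring
  have hmul : ∀ {a b : ℕ} {p q : ModePoly n}, p.IsHomogeneous a → q.IsHomogeneous b →
      VanishesToOrder (a + 3) (fun w => modeEval (Ψ w) p -
        (modeEval w p + modeEval w (hamDer s p) + modeEval w (hamDer s (hamDer s p)) / 2)) →
      VanishesToOrder (b + 3) (fun w => modeEval (Ψ w) q -
        (modeEval w q + modeEval w (hamDer s q) + modeEval w (hamDer s (hamDer s q)) / 2)) →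
      VanishesToOrder (a + b + 3) (fun w => modeEval (Ψ w) (p * q) -
        (modeEval w (p * q) + modeEval w (hamDer s (p * q)) +
          modeEval w (hamDer s (hamDer s (p * q))) / 2)) := by
    intro a b p q hp hq rp rq
    refine (remainder_mul (vanishesToOrder_modeEval hp) (h1 hp) (h2 hp) rp
      (vanishesToOrder_modeEval hq) (h1 hq) (h2 hq) rq).congr fun w => ?_
    rw [hamDer_hamDer_mul]
    simp only [Derivation.leibniz, map_add, map_mul, smul_eq_mul, map_ofNat]
    ring
  have hone : ∀ c : ℂ, ∀ k, VanishesToOrder k (fun w => modeEval (Ψ w) (C c) -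
        (modeEval w (C c) + modeEval w (hamDer s (C c)) +
          modeEval w (hamDer s (hamDer s (C c))) / 2)) := fun c k =>
    VanishesToOrder.zero.congr fun w => by
      have : hamDer s (C c) = 0 := Derivation.map_algebraMap _ c
      simp [this]
  have hXk : ∀ (j : Mode n) (k : ℕ), VanishesToOrder (k + 3) (fun w => modeEval (Ψ w) (X j ^ k) -
        (modeEval w (X j ^ k) + modeEval w (hamDer s (X j ^ k)) +
          modeEval w (hamDer s (hamDer s (X j ^ k))) / 2)) := by
    intro j k
    induction k with
    | zero => simpa using hone 1 3
    | succ k ih =>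
      rw [pow_succ]
      refine hmul (isHomogeneous_X_pow j k) (isHomogeneous_X ℂ j) ih ?_
      exact VanishesToOrder.zero.congr fun w => by rw [hX, hX2]; simp
  have key : ∀ m : Mode n →₀ ℕ, VanishesToOrder (m.degree + 3)
      (fun w => modeEval (Ψ w) (monomial m (1 : ℂ)) -
        (modeEval w (monomial m (1 : ℂ)) + modeEval w (hamDer s (monomial m (1 : ℂ))) +
          modeEval w (hamDer s (hamDer s (monomial m (1 : ℂ)))) / 2)) := by
    intro m
    induction m using Finsupp.induction_linear with
    | zero => simpa using hone 1 3
    | add f g hf hg =>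
      have := hmul (isHomogeneous_monomial (1 : ℂ) rfl) (isHomogeneous_monomial (1 : ℂ) rfl) hf hg
      rwa [monomial_mul, one_mul, ← map_add] at this
    | single j k => simpa [X_pow_eq_monomial] using hXk j k
  have h := VanishesToOrder.sum (k := a + 3) (s := p.support)
    (F := fun m w => p.coeff m * (modeEval (Ψ w) (monomial m (1 : ℂ)) -
        (modeEval w (monomial m (1 : ℂ)) + modeEval w (hamDer s (monomial m (1 : ℂ))) +
          modeEval w (hamDer s (hamDer s (monomial m (1 : ℂ)))) / 2))) fun m hm => by
      have hd : m.degree = a :=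
        (DFunLike.congr_fun (Finsupp.degree_eq_weight_one (R := ℕ)) m).trans
          (hp (mem_support_iff.1 hm))
      exact (hd ▸ key m).const_mul _
  refine h.congr fun w => ?_
  have hp' : p = ∑ m ∈ p.support, p.coeff m • monomial m (1 : ℂ) := by
    conv_lhs => rw [p.as_sum]
    simp [smul_monomial]
  conv_lhs => rw [hp']
  simp only [map_sum, Derivation.map_smul, modeEval_smul, Finset.sum_div,
    ← Finset.sum_add_distrib, ← Finset.sum_sub_distrib]
  exact Finset.sum_congr rfl fun m _ => by ring

theorem remainder_shear (c : ℝ) (d : ℕ) (u : Phase n) {a : ℕ} {p : ModePoly n}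
    (hp : p.IsHomogeneous a) :
    VanishesToOrder (a + 3) (fun w => modeEval (shearMap c (d + 2) u w) p -
      (modeEval w p + modeEval w (hamDer (shearGenerator c (d + 2) u) p) +
        modeEval w (hamDer (shearGenerator c (d + 2) u)
          (hamDer (shearGenerator c (d + 2) u) p)) / 2)) := by
  refine remainder_of_X (isHomogeneous_shearGenerator c (d + 2) u) (fun j w => ?_) (fun j => ?_) hp
  · rw [hamDer_shearGenerator, hamDer_symplecticLin_X]
    simp only [map_add, map_mul, map_pow, modeEval_X, modeEval_C, modeEval_symplecticLin,
      shearMap, Mode.coord_add, Mode.coord_smul]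
    push_cast; ring
  · rw [hamDer_shearGenerator, hamDer_shearGenerator, hamDer_symplecticLin_X]
    simp only [Derivation.leibniz, Derivation.leibniz_pow, hamDer_symplecticLin_self]
    simp

theorem isBigO_shearMap (c : ℝ) {d : ℕ} (hd : 2 ≤ d) (u : Phase n) :
    shearMap c d u =O[𝓝 0] fun w => w := by
  have h := (isSymplecticAut_shear c hd u).tangent.isBigO_sub
  simp only [(isSymplecticAut_shear c hd u).map_zero, sub_zero] at h
  exact h

theorem hasJet_shear_two (c : ℝ) (u : Phase n) :
    HasJet (shear c 2 u) (hamDer (shearGenerator c 2 u)).toLinearMap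
      ((1 / 2 : ℂ) • (hamDer (shearGenerator c 2 u)).toLinearMap ∘ₗ
        (hamDer (shearGenerator c 2 u)).toLinearMap) where
  isBigO := isBigO_shearMap c le_rfl u
  homogeneous₁ hp := isHomogeneous_hamDer (d := 1) (isHomogeneous_shearGenerator c 2 u) hp
  homogeneous₂ hp := by
    have := (isHomogeneous_hamDer (d := 1) (isHomogeneous_shearGenerator c 2 u)
      (isHomogeneous_hamDer (d := 1) (isHomogeneous_shearGenerator c 2 u) hp)).C_mul (1 / 2 : ℂ)
    simpa [smul_eq_C_mul] using this
  remainder hp := (remainder_shear c 0 u hp).congr fun w => by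
    simp [coe_shear, modeEval_smul]; ring

theorem hasJet_shear_three (c : ℝ) (u : Phase n) :
    HasJet (shear c 3 u) 0 (hamDer (shearGenerator c 3 u)).toLinearMap where
  isBigO := isBigO_shearMap c (by norm_num) u
  homogeneous₁ _ := isHomogeneous_zero _ _ _
  homogeneous₂ hp := isHomogeneous_hamDer (d := 2) (isHomogeneous_shearGenerator c 3 u) hp
  remainder {a p} hp := by
    have h2 := ((vanishesToOrder_modeEval
      (isHomogeneous_hamDer (d := 2) (isHomogeneous_shearGenerator c 3 u)
        (isHomogeneous_hamDer (d := 2) (isHomogeneous_shearGenerator c 3 u) hp))).const_mul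
          (1 / 2)).mono (show a + 3 ≤ a + 2 + 2 by omega)
    exact ((remainder_shear c 1 u hp).add h2).congr fun w => by simp [coe_shear]; ring

/-- The real span of the powers `ω(u, ·)^(d + 1)`. -/
def realPowers (n d : ℕ) : AddSubmonoid (ModePoly n) :=
  AddSubmonoid.closure {s | ∃ (c : ℝ) (u : Phase n), s = shearGenerator c d u}

/-- Shears with different directions need not commute, so an arbitrary composition has a commutator
in its second order term. Symmetric splitting, with half of each new shear on either side, makes
that term exactly half the square of the total derivation. -/
theorem exists_hasJet_cubic {S : ModePoly n} (hS : S ∈ realPowers n 2) :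
    ∃ Ψ : Phase n ≃ₜ Phase n, IsSymplecticAut Ψ ∧ HasJet Ψ (hamDer S).toLinearMap
      ((1 / 2 : ℂ) • (hamDer S).toLinearMap ∘ₗ (hamDer S).toLinearMap) := by
  induction hS using AddSubmonoid.closure_induction_left with
  | zero =>
    refine ⟨Homeomorph.refl _, IsSymplecticAut.refl, ?_⟩
    have : (hamDer (0 : ModePoly n)) = 0 := by simp [hamDer]
    rw [this]
    simpa using! HasJet.id
  | add_left s hs T hT ih =>
    obtain ⟨c, u, rfl⟩ := hs
    obtain ⟨Ψ, hΨ, hJ⟩ := ih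
    have hτ := isSymplecticAut_shear (c / 2) le_rfl u
    have hτJ := hasJet_shear_two (c / 2) u
    -- With e the derivation of the half shear and E that of T, the second order terms add up to (2e
    -- + E)²/2.
    refine ⟨((shear (c / 2) 2 u).trans Ψ).trans (shear (c / 2) 2 u), (hτ.trans hΨ).trans hτ, ?_⟩
    have h := hτJ.comp (hJ.comp hτJ)
    have hd : shearGenerator c 2 u = shearGenerator (c / 2) 2 u + shearGenerator (c / 2) 2 u := by
      rw [shearGenerator, shearGenerator, ← add_mul, ← C_add]
      push_cast; congr 2; ring
    rw [hd, hamDer_add, hamDer_add]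
    set e := hamDer (shearGenerator (c / 2) 2 u)
    set E := hamDer T
    convert h using 1
    · rfl
    · refine LinearMap.ext fun p => ?_
      simp only [LinearMap.add_apply, Derivation.coe_add_linearMap]
      abel
    · refine LinearMap.ext fun p => ?_
      simp only [LinearMap.comp_apply, LinearMap.smul_apply, LinearMap.add_apply,
        Derivation.coe_add_linearMap, map_add]
      module

/-- A quartic generator raises degrees by two, so commutators already lie beyond the jet and the
order of the shears is immaterial. -/
theorem exists_hasJet_quartic {S : ModePoly n} (hS : S ∈ realPowers n 3) :
    ∃ Ψ : Phase n ≃ₜ Phase n, IsSymplecticAut Ψ ∧ HasJet Ψ 0 (hamDer S).toLinearMap := by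
  induction hS using AddSubmonoid.closure_induction_left with
  | zero =>
    refine ⟨Homeomorph.refl _, IsSymplecticAut.refl, ?_⟩
    have : (hamDer (0 : ModePoly n)) = 0 := by simp [hamDer]
    rw [this]
    simpa using! HasJet.id
  | add_left s hs T hT ih =>
    obtain ⟨c, u, rfl⟩ := hs
    obtain ⟨Ψ, hΨ, hJ⟩ := ih
    refine ⟨(shear c 3 u).trans Ψ, (isSymplecticAut_shear c (by norm_num) u).trans hΨ, ?_⟩
    have h := hJ.comp (hasJet_shear_three c u)
    convert h using 1
    · rfl
    · exact (add_zero 0).symm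
    · rw [hamDer_add, LinearMap.comp_zero, add_zero, Derivation.coe_add_linearMap, add_comm]

end Jet

/-! ### Non-resonance of the FPU frequencies -/

section CharTwo
variable {F : Type*} [Field F] (h2 : (2 : F) = 0)
include h2

/-- Let e₁, e₂ be the first two elementary symmetric functions. As abc = 1, the sum of the inverses
is e₂, so e₁ + e₂ = 0 and (1 - a)(1 - b)(1 - c) = e₂ - e₁ = -2e₁ vanishes. -/
theorem eq_one_of_add_inv_three {a b c : F} (h : a * b * c = 1)
    (hs : a + a⁻¹ + (b + b⁻¹) + (c + c⁻¹) = 0) : a = 1 ∨ b = 1 ∨ c = 1 := by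
  have ha : a⁻¹ = b * c := inv_eq_of_mul_eq_one_right (by rw [← h]; ring)
  have hb : b⁻¹ = a * c := inv_eq_of_mul_eq_one_right (by rw [← h]; ring)
  have hc : c⁻¹ = a * b := inv_eq_of_mul_eq_one_right (by rw [← h]; ring)
  rw [ha, hb, hc] at hs
  have : (1 - a) * ((1 - b) * (1 - c)) = 0 := by
    linear_combination hs - h - (a + b + c) * h2
  simpa only [mul_eq_zero, sub_eq_zero, eq_comm (a := (1 : F))] using this

/-- The monic polynomial with roots a, b, c, d has constant term 1, and its coefficients of t and t³
agree in characteristic 2. It is palindromic, so a⁻¹ is again one of the roots. -/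
theorem mul_eq_one_of_add_inv_four {a b c d : F} (h : a * b * c * d = 1)
    (hs : a + a⁻¹ + (b + b⁻¹) + (c + c⁻¹) + (d + d⁻¹) = 0) :
    a * a = 1 ∨ a * b = 1 ∨ a * c = 1 ∨ a * d = 1 := by
  have ha : a⁻¹ = b * c * d := inv_eq_of_mul_eq_one_right (by rw [← h]; ring)
  have hb : b⁻¹ = a * c * d := inv_eq_of_mul_eq_one_right (by rw [← h]; ring)
  have hc : c⁻¹ = a * b * d := inv_eq_of_mul_eq_one_right (by rw [← h]; ring)
  have hd : d⁻¹ = a * b * c := inv_eq_of_mul_eq_one_right (by rw [← h]; ring)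
  rw [ha, hb, hc, hd] at hs
  have : (1 - a * a) * ((1 - a * b) * ((1 - a * c) * (1 - a * d))) = 0 := by
    linear_combination (a ^ 4 - 1) * h + (a ^ 3 - a) * hs
      - (a ^ 3 - a) * (b * c * d + a * c * d + a * b * d + a * b * c) * h2
  simpa only [mul_eq_zero, sub_eq_zero, eq_comm (a := (1 : F))] using this

end CharTwo

/-- As 1/2 is not an algebraic integer, 2 is not a unit and lies in a maximal ideal; the field is
the quotient by it. -/
theorem exists_field_hom_char_two :
    ∃ (F : Type) (_ : Field F), (2 : F) = 0 ∧ Nonempty (integralClosure ℤ ℂ →+* F) := by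
  have h : ¬ IsUnit (2 : integralClosure ℤ ℂ) := by
    intro hu
    obtain ⟨y, hy⟩ := hu.exists_right_inv
    have hy' : (2 : ℂ) * y = 1 := by
      have := congrArg (algebraMap (integralClosure ℤ ℂ) ℂ) hy
      simpa using! this
    have hyv : (y : ℂ) = algebraMap ℚ ℂ (1 / 2) := by
      have : (y : ℂ) = 1 / 2 := by linear_combination (1 / 2) * hy'
      rw [this]; simp
    have hi : IsIntegral ℤ (1 / 2 : ℚ) := by
      have := y.2
      rw [mem_integralClosure_iff, hyv] at this
      exact (isIntegral_algebraMap_iff (algebraMap ℚ ℂ).injective).1 this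
    obtain ⟨z, hz⟩ := IsIntegrallyClosed.isIntegral_iff.1 hi
    have h3 : (2 * z : ℚ) = 1 := by
      have : (z : ℚ) = 1 / 2 := by simpa using hz
      linarith
    have h4 : 2 * z = 1 := by exact_mod_cast h3
    omega
  obtain ⟨m, hm, h2m⟩ := exists_max_ideal_of_mem_nonunits h
  let _ := Ideal.Quotient.field m
  refine ⟨integralClosure ℤ ℂ ⧸ m, inferInstance, ?_, ⟨Ideal.Quotient.mk m⟩⟩
  rw [← map_ofNat (Ideal.Quotient.mk m) 2]
  exact Ideal.Quotient.eq_zero_iff_mem.2 h2m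

/-- The unit x is the reduction of ζ = exp(iπ/N). Multiplying a relation between sines by 2i makes
it a relation between the algebraic integers ζ^κ - ζ^(-κ), which can be reduced as well. -/
theorem exists_root_of_unity_char_two {N : ℕ} (hodd : Odd N) :
    ∃ (F : Type) (_ : Field F) (x : Fˣ), (2 : F) = 0 ∧ (∀ k : ℤ, x ^ k = 1 ↔ (N : ℤ) ∣ k) ∧
      ∀ {m : ℕ} (κ : Fin m → ℤ), ∑ i, Real.sin (κ i * Real.pi / N) = 0 →
        ∑ i, (((x ^ κ i : Fˣ) : F) + ((x ^ κ i : Fˣ) : F)⁻¹) = 0 := by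
  obtain ⟨F, hF, h2, ⟨φ⟩⟩ := exists_field_hom_char_two
  have hN : N ≠ 0 := by rintro rfl; simp at hodd
  have hNC : (N : ℂ) ≠ 0 := by exact_mod_cast hN
  set ζ : ℂ := Complex.exp (Real.pi * Complex.I / N) with hζ
  have hζN : ζ ^ (2 * N) = 1 := by
    rw [hζ, ← Complex.exp_nat_mul, Complex.exp_eq_one_iff]
    exact ⟨1, by push_cast; field_simp⟩
  have hint : IsIntegral ℤ ζ := IsIntegral.of_pow (n := 2 * N) (by omega)
    (by rw [hζN]; exact isIntegral_one)
  let z : integralClosure ℤ ℂ := ⟨ζ, hint⟩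
  have hz : z ^ (2 * N) = 1 := Subtype.ext (by simpa [z] using hζN)
  let u : (integralClosure ℤ ℂ)ˣ := Units.ofPowEqOne z (2 * N) hz (by omega)
  let x : Fˣ := Units.map φ u
  have hx2 : (x : F) ^ (2 * N) = 1 := by
    show φ z ^ (2 * N) = 1
    rw [← map_pow, hz, map_one]
  have hxN : x ^ N = 1 := by
    -- In characteristic 2, (x^N - 1)² = x^(2N) - 1, so the order of ζ, a divisor of 2N, reduces to
    -- a divisor of N.
    have : ((x : F) ^ N - 1) ^ 2 = 0 := by
      linear_combination hx2 + (1 - (x : F) ^ N) * h2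
    have := sub_eq_zero.1 (pow_eq_zero_iff (two_ne_zero)|>.1 this)
    exact Units.ext (by simpa using this)
  have hprim : IsPrimitiveRoot (z ^ 2) N := by
    refine IsPrimitiveRoot.of_map_of_injective (f := (algebraMap (integralClosure ℤ ℂ) ℂ)) ?_
      Subtype.val_injective
    have : algebraMap (integralClosure ℤ ℂ) ℂ (z ^ 2) =
        Complex.exp (2 * Real.pi * Complex.I / N) := by
      show ζ ^ 2 = _
      rw [hζ, ← Complex.exp_nat_mul]; congr 1; push_cast; ring
    rw [this]
    exact Complex.isPrimitiveRoot_exp N hN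
  -- The product of 1 - ζ^(2k) over 0 < k < N equals N, which is 1 in F because N is odd. No factor
  -- vanishes, so the order of x does not drop.
  have hprod : ∏ k ∈ Finset.range (N - 1), (1 - ((x : F) ^ 2) ^ (k + 1)) = 1 := by
    obtain ⟨M, rfl⟩ : ∃ M, N = M + 1 := ⟨N - 1, by omega⟩
    have h := congrArg φ hprim.prod_one_sub_pow_eq_order
    simp only [map_prod, map_sub, map_pow, map_one, map_add, map_natCast] at h
    obtain ⟨r, hr⟩ := hodd
    have hM : (M : F) = 0 := by
      have : M = 2 * r := by omega
      rw [this]; push_cast; rw [h2, zero_mul]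
    rw [hM, zero_add] at h
    exact h
  refine ⟨F, hF, x, h2, fun k => ⟨fun hk => ?_, ?_⟩, fun {m} κ hκ => ?_⟩
  · by_contra hnd
    have hpos : 0 < k % N := lt_of_le_of_ne (Int.emod_nonneg _ (by omega))
      fun h => hnd (Int.dvd_of_emod_eq_zero h.symm)
    have hlt : k % N < N := Int.emod_lt_of_pos _ (by omega)
    obtain ⟨r, hr⟩ : ∃ r : ℕ, k % N = r + 1 := ⟨(k % N - 1).toNat, by omega⟩
    have hxr : x ^ (r + 1) = 1 := by
      have h3 : k = (r + 1 : ℕ) + N * (k / N) := by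
        have := Int.emod_add_mul_ediv k N
        push_cast; omega
      rw [h3, zpow_add, zpow_mul, zpow_natCast, zpow_natCast, hxN, one_zpow, mul_one] at hk
      exact hk
    have : (1 - ((x : F) ^ 2) ^ (r + 1)) = 0 := by
      rw [← pow_mul, mul_comm, pow_mul, ← Units.val_pow_eq_pow_val, hxr]; simp
    rw [Finset.prod_eq_zero (i := r) (Finset.mem_range.2 (by omega)) this] at hprod
    exact zero_ne_one hprod
  · rintro ⟨l, rfl⟩
    rw [zpow_mul, zpow_natCast, hxN, one_zpow]
  · have hval : ∀ k : ℤ, (((u ^ k : (integralClosure ℤ ℂ)ˣ) : integralClosure ℤ ℂ) : ℂ) =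
        Complex.exp (k * Real.pi / N * Complex.I) := by
      intro k
      have h1 : ((Units.map (algebraMap (integralClosure ℤ ℂ) ℂ).toMonoidHom (u ^ k) : ℂˣ) : ℂ)
          = ζ ^ k := by
        rw [map_zpow, Units.val_zpow_eq_zpow_val]; rfl
      refine h1.trans ?_
      rw [hζ, ← Complex.exp_int_mul]; congr 1; ring
    have hR : ∑ i, (((u ^ κ i : (integralClosure ℤ ℂ)ˣ) : integralClosure ℤ ℂ) -
        ((u ^ (-κ i) : (integralClosure ℤ ℂ)ˣ) : integralClosure ℤ ℂ)) = 0 := by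
      refine Subtype.val_injective ?_
      have h3 := congrArg (fun r : ℝ => 2 * Complex.I * (r : ℂ)) hκ
      simp only [Complex.ofReal_sum, Finset.mul_sum, Complex.ofReal_zero, mul_zero] at h3
      rw [AddSubmonoidClass.coe_finsetSum]
      refine Eq.trans (Finset.sum_congr rfl fun i _ => ?_) h3
      rw [AddSubgroupClass.coe_sub, hval, hval]
      push_cast
      rw [Complex.sin]
      have : -(κ i : ℂ) * Real.pi / N * Complex.I = -((κ i : ℂ) * Real.pi / N) * Complex.I := by
        ring
      rw [this]
      linear_combination -(Complex.exp (-((κ i : ℂ) * Real.pi / N) * Complex.I) -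
        Complex.exp ((κ i : ℂ) * Real.pi / N * Complex.I)) * Complex.I_sq
    have h4 := congrArg φ hR
    rw [map_sum, map_zero] at h4
    rw [← h4]
    refine Finset.sum_congr rfl fun i _ => ?_
    have e1 : ∀ k : ℤ, ((x ^ k : Fˣ) : F) = φ ((u ^ k : (integralClosure ℤ ℂ)ˣ)) := fun k => by
      rw [← map_zpow]; rfl
    rw [← Units.val_inv_eq_inv_val, ← zpow_neg, map_sub, e1, e1]
    -- In characteristic 2 the difference x^κ - x^(-κ) is the sum x^κ + x^(-κ).
    linear_combination φ ((u ^ (-κ i) : (integralClosure ℤ ℂ)ˣ)) * h2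

/-! ### Three-wave and four-wave resonances with momentum conservation. -/

section Resonance
variable {N : ℕ} (hodd : Odd N)
include hodd

theorem sin_add_sin_add_sin_ne_zero {a b c : ℤ} (ha : ¬ (N : ℤ) ∣ a) (hb : ¬ (N : ℤ) ∣ b)
    (hc : ¬ (N : ℤ) ∣ c) (h : (N : ℤ) ∣ a + b + c) :
    Real.sin (a * Real.pi / N) + Real.sin (b * Real.pi / N) + Real.sin (c * Real.pi / N) ≠ 0 := by
  intro hs
  obtain ⟨F, _, x, h2, hx, hsum⟩ := exists_root_of_unity_char_two hodd
  have h3 := hsum ![a, b, c] (by simpa [Fin.sum_univ_three] using hs)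
  simp only [Fin.sum_univ_three, Matrix.cons_val] at h3
  have hm : ((x ^ a : Fˣ) : F) * ((x ^ b : Fˣ) : F) * ((x ^ c : Fˣ) : F) = 1 := by
    rw [← Units.val_mul, ← Units.val_mul, ← zpow_add, ← zpow_add, (hx _).2 h, Units.val_one]
  rcases eq_one_of_add_inv_three h2 hm h3 with h4 | h4 | h4
  · exact ha ((hx _).1 (Units.ext h4))
  · exact hb ((hx _).1 (Units.ext h4))
  · exact hc ((hx _).1 (Units.ext h4))

omit hodd in
theorem sin_mul_pi_div_ne_zero {a : ℤ} (hN : N ≠ 0) (ha : ¬ (N : ℤ) ∣ a) :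
    Real.sin (a * Real.pi / N) ≠ 0 := by
  intro h
  obtain ⟨k, hk⟩ := Real.sin_eq_zero_iff.1 h
  refine ha ⟨k, ?_⟩
  have hNR : (N : ℝ) ≠ 0 := by exact_mod_cast hN
  have hpi := Real.pi_ne_zero
  have : (a : ℝ) = N * k := by
    field_simp at hk
    linarith
  exact_mod_cast this

omit hodd in
/-- Pairs of modes with opposite momenta modulo `N` and vanishing total frequency. -/
theorem opposite_of_dvd_add {a b c d : ℤ} (ha : |a| < N) (hb : |b| < N) (hc : |c| < N)
    (hd : |d| < N) (ha0 : a ≠ 0) (hc0 : c ≠ 0) (hab : (N : ℤ) ∣ a + b) (hcd : (N : ℤ) ∣ c + d)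
    (hs : Real.sin (a * Real.pi / N) + Real.sin (b * Real.pi / N) + Real.sin (c * Real.pi / N)
      + Real.sin (d * Real.pi / N) = 0) :
    (a + b = 0 ∧ c + d = 0) ∨ (a + c = 0 ∧ b + d = 0) ∨ (a + d = 0 ∧ b + c = 0) := by
  have hN : N ≠ 0 := by rintro rfl; have := abs_nonneg a; simp at ha; omega
  have hNR : (N : ℝ) ≠ 0 := by exact_mod_cast hN
  rw [abs_lt] at ha hb hc hd
  have hndvd : ∀ {e : ℤ}, -(N : ℤ) < e ∧ e < N → e ≠ 0 → ¬ (N : ℤ) ∣ e := fun h h0 hdvd =>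
    h0 (Int.eq_zero_of_abs_lt_dvd hdvd (abs_lt.2 h))
  -- The sum of such a pair is 0 or ±N. In the first case the two sines cancel, in the second they
  -- are equal.
  have hcases : ∀ {e f : ℤ}, -(N : ℤ) < e ∧ e < N → -(N : ℤ) < f ∧ f < N → (N : ℤ) ∣ e + f →
      (e + f = 0 ∧ Real.sin (f * Real.pi / N) = -Real.sin (e * Real.pi / N)) ∨
      ((e + f = N ∨ e + f = -N) ∧ Real.sin (f * Real.pi / N) = Real.sin (e * Real.pi / N)) := by
    rintro e f he hf ⟨k, hk⟩
    have hk2 : k < 2 := by by_contra hh; push Not at hh; nlinarith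
    have hk3 : -2 < k := by by_contra hh; push Not at hh; nlinarith
    have hf' : f = N * k - e := by omega
    interval_cases k
    · refine Or.inr ⟨Or.inr (by omega), ?_⟩
      rw [hf']; push_cast
      rw [show ((N : ℝ) * (-1) - e) * Real.pi / N = -(e * Real.pi / N + Real.pi) by
        field_simp; ring, Real.sin_neg, Real.sin_add_pi, neg_neg]
    · refine Or.inl ⟨by omega, ?_⟩
      rw [hf']; push_cast
      rw [show ((N : ℝ) * 0 - e) * Real.pi / N = -(e * Real.pi / N) by ring, Real.sin_neg]
    · refine Or.inr ⟨Or.inl (by omega), ?_⟩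
      rw [hf']; push_cast
      rw [show ((N : ℝ) * 1 - e) * Real.pi / N = Real.pi - e * Real.pi / N by
        field_simp, Real.sin_pi_sub]
  rcases hcases ha hb hab with ⟨h1, s1⟩ | ⟨h1, s1⟩ <;>
    rcases hcases hc hd hcd with ⟨h2, s2⟩ | ⟨h2, s2⟩ <;> rw [s1, s2] at hs
  · exact Or.inl ⟨h1, h2⟩
  · exact absurd (by linarith) (sin_mul_pi_div_ne_zero hN (hndvd hc hc0))
  · exact absurd (by linarith) (sin_mul_pi_div_ne_zero hN (hndvd ha ha0))
  -- Both pairs add up to ±N, so the relation reads sin(aπ/N) = -sin(cπ/N). The size bounds leave a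
  -- + c = 0 or a - c = ±N, and the latter makes a opposite to d.
  · have hs' : Real.sin (a * Real.pi / N) = Real.sin (-(c * Real.pi / N)) := by
      rw [Real.sin_neg]; linarith
    have hpi := Real.pi_ne_zero
    obtain ⟨k, hk⟩ := Real.sin_eq_sin_iff.1 hs'
    have hk' : -c = 2 * k * N + a ∨ -c = (2 * k + 1) * N - a := by
      refine hk.imp (fun h => ?_) (fun h => ?_)
      · have : (-c : ℝ) = 2 * k * N + a := by field_simp at h; linarith
        exact_mod_cast this
      · have : (-c : ℝ) = (2 * k + 1) * N - a := by field_simp at h; linarith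
        exact_mod_cast this
    have hk2 : k < 2 := by by_contra hh; push Not at hh; rcases hk' with h | h <;> nlinarith
    have hk3 : -2 < k := by by_contra hh; push Not at hh; rcases hk' with h | h <;> nlinarith
    interval_cases k <;> omega

/-- The reduction modulo 2 yields opposite pairs only modulo N; `opposite_of_dvd_add` then uses the
real sines to obtain true opposites, possibly in another pairing. -/
theorem opposite_of_resonance {a b c d : ℤ} (ha : |a| < N) (hb : |b| < N) (hc : |c| < N)
    (hd : |d| < N) (ha0 : a ≠ 0) (hb0 : b ≠ 0) (hc0 : c ≠ 0)
    (h : (N : ℤ) ∣ a + b + c + d)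
    (hs : Real.sin (a * Real.pi / N) + Real.sin (b * Real.pi / N) + Real.sin (c * Real.pi / N)
      + Real.sin (d * Real.pi / N) = 0) :
    (a + b = 0 ∧ c + d = 0) ∨ (a + c = 0 ∧ b + d = 0) ∨ (a + d = 0 ∧ b + c = 0) := by
  obtain ⟨F, _, x, h2, hx, hsum⟩ := exists_root_of_unity_char_two hodd
  have h3 := hsum ![a, b, c, d] (by simpa [Fin.sum_univ_four] using hs)
  simp only [Fin.sum_univ_four, Matrix.cons_val] at h3
  have hm : ((x ^ a : Fˣ) : F) * ((x ^ b : Fˣ) : F) * ((x ^ c : Fˣ) : F) * ((x ^ d : Fˣ) : F)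
      = 1 := by
    rw [← Units.val_mul, ← Units.val_mul, ← Units.val_mul, ← zpow_add, ← zpow_add, ← zpow_add,
      (hx _).2 h, Units.val_one]
  have hdvd : ∀ e f : ℤ, ((x ^ e : Fˣ) : F) * ((x ^ f : Fˣ) : F) = 1 → (N : ℤ) ∣ e + f := by
    intro e f hef
    rw [← hx, zpow_add]
    exact Units.ext hef
  rcases mul_eq_one_of_add_inv_four h2 hm h3 with h4 | h4 | h4 | h4
  -- The alternative a·a = 1 would mean N ∣ 2a, impossible for odd N and 0 < |a| < N.
  · have h5 := hdvd _ _ h4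
    rw [← two_mul] at h5
    have hcop : IsCoprime (N : ℤ) 2 := by
      rw [Int.isCoprime_iff_gcd_eq_one]
      exact_mod_cast (Nat.coprime_two_right.2 hodd)
    exact absurd (Int.eq_zero_of_abs_lt_dvd (hcop.dvd_of_dvd_mul_left h5) ha) ha0
  · have h5 := hdvd _ _ h4
    have h6 : (N : ℤ) ∣ c + d := by
      have := dvd_sub h h5; rwa [show a + b + c + d - (a + b) = c + d by ring] at this
    exact opposite_of_dvd_add ha hb hc hd ha0 hc0 h5 h6 hs
  · have h5 := hdvd _ _ h4
    have h6 : (N : ℤ) ∣ b + d := by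
      have := dvd_sub h h5; rwa [show a + b + c + d - (a + c) = b + d by ring] at this
    have := opposite_of_dvd_add ha hc hb hd ha0 hb0 h5 h6 (by linarith)
    omega
  · have h5 := hdvd _ _ h4
    have h6 : (N : ℤ) ∣ b + c := by
      have := dvd_sub h h5; rwa [show a + b + c + d - (a + d) = b + c by ring] at this
    have := opposite_of_dvd_add ha hd hb hc ha0 hb0 h5 h6 (by linarith)
    omega

end Resonance

/-! ### Normal modes of the linearized chain -/

section ExpSum
variable {N : ℕ} (hN : N ≠ 0)
include hN

theorem sum_exp_mode (κ : ℤ) :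
    ∑ m : Fin N, Complex.exp (2 * Real.pi * Complex.I * κ * (m : ℕ) / N) =
      if (N : ℤ) ∣ κ then (N : ℂ) else 0 := by
  have hNC : (N : ℂ) ≠ 0 := by exact_mod_cast hN
  have hp := Complex.isPrimitiveRoot_exp N hN
  set ζ := Complex.exp (2 * Real.pi * Complex.I / N) with hζ
  have hterm : ∀ m : Fin N, Complex.exp (2 * Real.pi * Complex.I * κ * (m : ℕ) / N) =
      (ζ ^ κ) ^ (m : ℕ) := fun m => by
    rw [hζ, ← Complex.exp_int_mul, ← Complex.exp_nat_mul]; congr 1; ring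
  simp only [hterm]
  rw [Fin.sum_univ_eq_sum_range fun m => (ζ ^ κ) ^ m]
  split_ifs with h
  · rw [(hp.zpow_eq_one_iff_dvd κ).2 h]; simp
  · have h1 : ζ ^ κ ≠ 1 := fun h1 => h ((hp.zpow_eq_one_iff_dvd κ).1 h1)
    rw [geom_sum_eq h1, ← zpow_natCast, ← zpow_mul, mul_comm, zpow_mul, zpow_natCast, hp.pow_eq_one,
      one_zpow, sub_self, zero_div]

theorem sum_exp_mode_add (κ : ℤ) (φ : ℝ) :
    ∑ m : Fin N, Complex.exp (((2 * Real.pi * κ * (m : ℕ) / N + φ : ℝ) : ℂ) * Complex.I) =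
      if (N : ℤ) ∣ κ then (N : ℂ) * Complex.exp (φ * Complex.I) else 0 := by
  have h := congrArg (· * Complex.exp (φ * Complex.I)) (sum_exp_mode hN κ)
  simp only [Finset.sum_mul, ite_mul, zero_mul] at h
  rw [← h]
  refine Finset.sum_congr rfl fun m _ => ?_
  rw [← Complex.exp_add]; congr 1; push_cast; ring

theorem sum_cos_mode (κ : ℤ) (φ : ℝ) :
    ∑ m : Fin N, Real.cos (2 * Real.pi * κ * (m : ℕ) / N + φ) =
      if (N : ℤ) ∣ κ then N * Real.cos φ else 0 := by
  have h := congrArg Complex.re (sum_exp_mode_add hN κ φ)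
  simp only [Complex.re_sum, Complex.exp_ofReal_mul_I_re] at h
  rw [h]; split_ifs <;> simp [Complex.exp_ofReal_mul_I_re, Complex.exp_ofReal_mul_I_im]

theorem sum_sin_mode (κ : ℤ) (φ : ℝ) :
    ∑ m : Fin N, Real.sin (2 * Real.pi * κ * (m : ℕ) / N + φ) =
      if (N : ℤ) ∣ κ then N * Real.sin φ else 0 := by
  have h := congrArg Complex.im (sum_exp_mode_add hN κ φ)
  simp only [Complex.im_sum, Complex.exp_ofReal_mul_I_im] at h
  rw [h]; split_ifs <;> simp [Complex.exp_ofReal_mul_I_re, Complex.exp_ofReal_mul_I_im]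

end ExpSum

/-- The phase of mode `k` at the site `t`. -/
def modePhase (N : ℕ) (k : Fin (N - 1)) (t : ℝ) : ℝ := 2 * Real.pi * ((k : ℕ) + 1) * t / N

/-! ### Orthogonality relations for the modes, including the aliasing of k and N - k. -/

section Phase
variable {N : ℕ}

theorem modeIndex_not_dvd (k : Fin (N - 1)) : ¬ (N : ℤ) ∣ ((k : ℕ) + 1 : ℤ) := by
  have := k.2
  intro h
  have := Int.le_of_dvd (by omega) h
  omega

theorem modeIndex_dvd_sub_iff (k l : Fin (N - 1)) :
    (N : ℤ) ∣ ((k : ℕ) + 1 : ℤ) - ((l : ℕ) + 1) ↔ k = l := by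
  have := k.2
  have := l.2
  refine ⟨fun h => ?_, fun h => by simp [h]⟩
  have h0 := Int.eq_zero_of_abs_lt_dvd h (abs_lt.2 ⟨by omega, by omega⟩)
  ext; omega

theorem modeIndex_dvd_add_iff (k l : Fin (N - 1)) :
    (N : ℤ) ∣ ((k : ℕ) + 1 : ℤ) + ((l : ℕ) + 1) ↔ l = k.rev := by
  have := k.2
  have := l.2
  have hr := Fin.val_rev k
  refine ⟨fun h => ?_, fun h => ?_⟩
  · have h0 := Int.eq_zero_of_abs_lt_dvd (dvd_sub_self_right.2 h) (abs_lt.2 ⟨by omega, by omega⟩)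
    ext; omega
  · exact ⟨1, by rw [h, hr]; omega⟩

theorem sinFreq_pos (k : Fin (N - 1)) : 0 < sinFreq N k := by
  have hk : (k : ℕ) + 1 < N := by have := k.2; omega
  have hk' : ((k : ℕ) + 1 : ℝ) < N := by exact_mod_cast hk
  have hN : (0 : ℝ) < N := by linarith [(Nat.cast_nonneg (k : ℕ) : (0 : ℝ) ≤ _)]
  refine Real.sin_pos_of_pos_of_lt_pi (by positivity) ?_
  rw [div_lt_iff₀ hN, mul_comm]
  exact mul_lt_mul_of_pos_left hk' Real.pi_pos

theorem cast_val_rev (k : Fin (N - 1)) : ((k.rev : ℕ) : ℝ) = N - 2 - k := by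
  have h : (k.rev : ℕ) + 2 + k = N := by rw [Fin.val_rev]; have := k.2; omega
  have h' : ((k.rev : ℕ) : ℝ) + 2 + k = N := by exact_mod_cast h
  linarith

theorem sinFreq_rev (k : Fin (N - 1)) : sinFreq N k.rev = sinFreq N k := by
  have hk : (k : ℕ) + 1 < N := by have := k.2; omega
  have hN : (N : ℝ) ≠ 0 := by norm_cast; omega
  rw [sinFreq, sinFreq, cast_val_rev, ← Real.sin_pi_sub]
  congr 1; field_simp; ring

/-- The orthogonality relations for sines and cosines of the modes, at the sites `m + δ`. -/
theorem sum_cos_sub (δ : ℝ) (k l : Fin (N - 1)) :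
    ∑ m : Fin N, Real.cos (modePhase N k ((m : ℕ) + δ) - modePhase N l ((m : ℕ) + δ)) =
      if k = l then (N : ℝ) else 0 := by
  have hN : N ≠ 0 := by have := k.2; omega
  have h := sum_cos_mode hN (((k : ℕ) + 1 : ℤ) - ((l : ℕ) + 1))
    (modePhase N k δ - modePhase N l δ)
  simp only [modeIndex_dvd_sub_iff] at h
  have e : (if k = l then (N : ℝ) else 0) =
      if k = l then N * Real.cos (modePhase N k δ - modePhase N l δ) else 0 := by
    split_ifs with hkl
    · simp [hkl]
    · rfl
  rw [e, ← h]
  refine Finset.sum_congr rfl fun m _ => ?_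
  congr 1; simp only [modePhase]; push_cast; ring

theorem sum_sin_sub (δ : ℝ) (k l : Fin (N - 1)) :
    ∑ m : Fin N, Real.sin (modePhase N k ((m : ℕ) + δ) - modePhase N l ((m : ℕ) + δ)) = 0 := by
  have hN : N ≠ 0 := by have := k.2; omega
  have h := sum_sin_mode hN (((k : ℕ) + 1 : ℤ) - ((l : ℕ) + 1))
    (modePhase N k δ - modePhase N l δ)
  simp only [modeIndex_dvd_sub_iff] at h
  have e : (0 : ℝ) =
      if k = l then N * Real.sin (modePhase N k δ - modePhase N l δ) else 0 := by
    split_ifs with hkl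
    · simp [hkl]
    · rfl
  rw [e, ← h]
  refine Finset.sum_congr rfl fun m _ => ?_
  congr 1; simp only [modePhase]; push_cast; ring

/-- The reversed index stands for N - k. On integer sites the two modes alias, and at an offset δ
the aliasing costs the angle 2πδ. -/
theorem modePhase_add_rev (k : Fin (N - 1)) (t : ℝ) :
    modePhase N k t + modePhase N k.rev t = 2 * Real.pi * t := by
  have hk : (k : ℕ) + 1 < N := by have := k.2; omega
  have hN : (N : ℝ) ≠ 0 := by norm_cast; omega
  rw [modePhase, modePhase, cast_val_rev]; field_simp; ring

theorem sum_cos_add (δ : ℝ) (k l : Fin (N - 1)) :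
    ∑ m : Fin N, Real.cos (modePhase N k ((m : ℕ) + δ) + modePhase N l ((m : ℕ) + δ)) =
      if l = k.rev then N * Real.cos (2 * Real.pi * δ) else 0 := by
  have hN : N ≠ 0 := by have := k.2; omega
  have h := sum_cos_mode hN (((k : ℕ) + 1 : ℤ) + ((l : ℕ) + 1))
    (modePhase N k δ + modePhase N l δ)
  simp only [modeIndex_dvd_add_iff] at h
  have e : (if l = k.rev then N * Real.cos (2 * Real.pi * δ) else 0) =
      if l = k.rev then N * Real.cos (modePhase N k δ + modePhase N l δ) else 0 := by
    split_ifs with hkl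
    · rw [hkl, modePhase_add_rev]
    · rfl
  rw [e, ← h]
  refine Finset.sum_congr rfl fun m _ => ?_
  congr 1; simp only [modePhase]; push_cast; ring

theorem sum_sin_add (δ : ℝ) (k l : Fin (N - 1)) :
    ∑ m : Fin N, Real.sin (modePhase N k ((m : ℕ) + δ) + modePhase N l ((m : ℕ) + δ)) =
      if l = k.rev then N * Real.sin (2 * Real.pi * δ) else 0 := by
  have hN : N ≠ 0 := by have := k.2; omega
  have h := sum_sin_mode hN (((k : ℕ) + 1 : ℤ) + ((l : ℕ) + 1))
    (modePhase N k δ + modePhase N l δ)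
  simp only [modeIndex_dvd_add_iff] at h
  have e : (if l = k.rev then N * Real.sin (2 * Real.pi * δ) else 0) =
      if l = k.rev then N * Real.sin (modePhase N k δ + modePhase N l δ) else 0 := by
    split_ifs with hkl
    · rw [hkl, modePhase_add_rev]
    · rfl
  rw [e, ← h]
  refine Finset.sum_congr rfl fun m _ => ?_
  congr 1; simp only [modePhase]; push_cast; ring

/-- Parseval's identity for superpositions of modes, sampled at the sites `m + δ`. -/
theorem sum_mul_superposition {δ : ℝ} (hδ : Real.sin (2 * Real.pi * δ) = 0)
    (a b a' b' : Fin (N - 1) → ℝ) :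
    ∑ m : Fin N, (∑ k, (a k * Real.sin (modePhase N k ((m : ℕ) + δ))
        + b k * Real.cos (modePhase N k ((m : ℕ) + δ)))) *
      (∑ l, (a' l * Real.sin (modePhase N l ((m : ℕ) + δ))
        + b' l * Real.cos (modePhase N l ((m : ℕ) + δ)))) =
    N / 2 * ∑ k, (a k * a' k + b k * b' k)
      - N / 2 * Real.cos (2 * Real.pi * δ) * ∑ k, (a k * a' k.rev - b k * b' k.rev) := by
  have hpt : ∀ m : Fin N, ∀ k l : Fin (N - 1),
      (a k * Real.sin (modePhase N k ((m : ℕ) + δ)) + b k * Real.cos (modePhase N k ((m : ℕ) + δ)))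
      * (a' l * Real.sin (modePhase N l ((m : ℕ) + δ))
        + b' l * Real.cos (modePhase N l ((m : ℕ) + δ))) =
      (a k * a' l + b k * b' l) / 2 *
        Real.cos (modePhase N k ((m : ℕ) + δ) - modePhase N l ((m : ℕ) + δ))
      - (a k * a' l - b k * b' l) / 2 *
        Real.cos (modePhase N k ((m : ℕ) + δ) + modePhase N l ((m : ℕ) + δ))
      + (a k * b' l + b k * a' l) / 2 *
        Real.sin (modePhase N k ((m : ℕ) + δ) + modePhase N l ((m : ℕ) + δ))
      + (a k * b' l - b k * a' l) / 2 *
        Real.sin (modePhase N k ((m : ℕ) + δ) - modePhase N l ((m : ℕ) + δ)) := by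
    intro m k l
    rw [Real.cos_sub, Real.cos_add, Real.sin_add, Real.sin_sub]; ring
  simp only [Finset.sum_mul_sum, hpt]
  rw [Finset.sum_comm, Finset.mul_sum, Finset.mul_sum, ← Finset.sum_sub_distrib]
  refine Finset.sum_congr rfl fun k _ => ?_
  rw [Finset.sum_comm]
  simp only [Finset.sum_add_distrib, Finset.sum_sub_distrib, ← Finset.mul_sum, sum_cos_sub,
    sum_cos_add, sum_sin_add, sum_sin_sub, hδ]
  simp
  ring

theorem sum_superposition (δ : ℝ) (a b : Fin (N - 1) → ℝ) :
    ∑ m : Fin N, ∑ k, (a k * Real.sin (modePhase N k ((m : ℕ) + δ))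
        + b k * Real.cos (modePhase N k ((m : ℕ) + δ))) = 0 := by
  rw [Finset.sum_comm]
  refine Finset.sum_eq_zero fun k _ => ?_
  have hN : N ≠ 0 := by have := k.2; omega
  have h : ∀ m : Fin N, modePhase N k ((m : ℕ) + δ) =
      2 * Real.pi * (((k : ℕ) + 1 : ℤ) : ℝ) * (m : ℕ) / N + modePhase N k δ := fun m => by
    simp only [modePhase]; push_cast; ring
  simp only [h, Finset.sum_add_distrib, ← Finset.mul_sum]
  rw [sum_sin_mode hN, sum_cos_mode hN, if_neg (modeIndex_not_dvd k), if_neg (modeIndex_not_dvd k)]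
  simp

end Phase

/-! ### The linear canonical map to normal modes. -/

section ModeMap
variable {N : ℕ}

/-- The amplitude of mode `k` in the momenta and in the relative displacements. -/
def modeAmp (N : ℕ) (k : Fin (N - 1)) : ℝ := √2 * √(sinFreq N k / N)

theorem modeAmp_mul_self (k : Fin (N - 1)) : modeAmp N k * modeAmp N k = 2 * sinFreq N k / N := by
  have h : 0 ≤ sinFreq N k / N := div_nonneg (sinFreq_pos k).le (Nat.cast_nonneg N)
  rw [modeAmp, mul_mul_mul_comm, Real.mul_self_sqrt (by norm_num), Real.mul_self_sqrt h]; ring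

theorem modeAmp_rev (k : Fin (N - 1)) : modeAmp N k.rev = modeAmp N k := by
  rw [modeAmp, modeAmp, sinFreq_rev]

/-- The canonical linear map from normal mode coordinates to the phase space of the chain. -/
def modeMap (N : ℕ) : Phase (N - 1) →ₗ[ℝ] Phase N where
  toFun w :=
    (fun m => ∑ k, (modeAmp N k / (2 * sinFreq N k) * w.1 k *
        Real.sin (modePhase N k ((m : ℕ) + (-1 / 2)))
      + modeAmp N k / (2 * sinFreq N k) * w.2 k *
        Real.cos (modePhase N k ((m : ℕ) + (-1 / 2)))),
     fun m => ∑ k, (modeAmp N k * w.2 k * Real.sin (modePhase N k ((m : ℕ) + (-1 / 2)))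
      + -(modeAmp N k * w.1 k) * Real.cos (modePhase N k ((m : ℕ) + (-1 / 2)))))
  map_add' v w := by
    ext m <;> simp only [Prod.fst_add, Prod.snd_add, Pi.add_apply, ← Finset.sum_add_distrib] <;>
      exact Finset.sum_congr rfl fun k _ => by ring
  map_smul' c w := by
    ext m <;> simp only [Prod.smul_fst, Prod.smul_snd, Pi.smul_apply, smul_eq_mul, Finset.mul_sum,
      RingHom.id_apply] <;> exact Finset.sum_congr rfl fun k _ => by ring

theorem modeMap_mem (w : Phase (N - 1)) : modeMap N w ∈ reducedPhase N :=
  ⟨sum_superposition _ _ _, sum_superposition _ _ _⟩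

theorem sin_two_pi_mul_neg_half : Real.sin (2 * Real.pi * (-1 / 2)) = 0 := by
  rw [show 2 * Real.pi * (-1 / 2) = -Real.pi by ring]; simp

theorem cos_two_pi_mul_neg_half : Real.cos (2 * Real.pi * (-1 / 2)) = -1 := by
  rw [show 2 * Real.pi * (-1 / 2) = -Real.pi by ring]; simp

theorem sum_fst_mul_snd_modeMap (v w : Phase (N - 1)) :
    ∑ m, (modeMap N v).1 m * (modeMap N w).2 m =
      1 / 2 * ∑ k, (v.1 k * w.2 k - v.2 k * w.1 k)
        + 1 / 2 * ∑ k, (v.1 k * w.2 k.rev + v.2 k * w.1 k.rev) := by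
  refine (sum_mul_superposition sin_two_pi_mul_neg_half _ _ _ _).trans ?_
  rw [cos_two_pi_mul_neg_half]
  simp only [Finset.mul_sum, ← Finset.sum_add_distrib, ← Finset.sum_sub_distrib]
  refine Finset.sum_congr rfl fun k _ => ?_
  have hs := (sinFreq_pos k).ne'
  have hN : (N : ℝ) ≠ 0 := by have := k.2; norm_cast; omega
  have h : N * (modeAmp N k / (2 * sinFreq N k) * modeAmp N k) = 1 := by
    rw [div_mul_eq_mul_div, modeAmp_mul_self]; field_simp
  rw [modeAmp_rev]
  linear_combination (1 / 2) * (v.1 k * w.2 k - v.2 k * w.1 k + v.1 k * w.2 k.rev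
    + v.2 k * w.1 k.rev) * h

/-- The aliasing term that pairs k with N - k is symmetric in v and w, so it disappears on
antisymmetrization. -/
theorem symplecticForm_modeMap (v w : Phase (N - 1)) :
    symplecticForm (modeMap N v) (modeMap N w) = symplecticForm v w := by
  have h1 := sum_fst_mul_snd_modeMap v w
  have h2 := sum_fst_mul_snd_modeMap w v
  have h3 : ∑ k : Fin (N - 1), (w.1 k * v.2 k.rev + w.2 k * v.1 k.rev) =
      ∑ k : Fin (N - 1), (v.1 k * w.2 k.rev + v.2 k * w.1 k.rev) := by
    rw [← Equiv.sum_comp Fin.revPerm]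
    refine Finset.sum_congr rfl fun k _ => ?_
    simp; ring
  have h4 : ∑ k, (w.1 k * v.2 k - w.2 k * v.1 k) = -∑ k, (v.1 k * w.2 k - v.2 k * w.1 k) := by
    rw [← Finset.sum_neg_distrib]
    exact Finset.sum_congr rfl fun k _ => by ring
  have h5 : ∑ m, (modeMap N v).2 m * (modeMap N w).1 m =
      ∑ m, (modeMap N w).1 m * (modeMap N v).2 m :=
    Finset.sum_congr rfl fun m _ => mul_comm _ _
  rw [symplecticForm, symplecticForm, Finset.sum_sub_distrib, h5, h1, h2, h3, h4]
  ring

theorem modePhase_finRotate (k : Fin (N - 1)) (m : Fin N) (δ : ℝ) :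
    ∃ j : ℤ, modePhase N k ((finRotate N m : ℕ) + δ) =
      modePhase N k ((m : ℕ) + 1 + δ) - j * (2 * Real.pi) := by
  obtain ⟨M, rfl⟩ : ∃ M, N = M + 1 := ⟨N - 1, by have := k.2; omega⟩
  -- Wrapping around from the last site lowers the phase by k + 1 full turns, the index `k` standing
  -- for mode k + 1.
  by_cases h : m = Fin.last M
  · refine ⟨(k : ℕ) + 1, ?_⟩
    rw [h, finRotate_last]
    have : ((M : ℝ) + 1) ≠ 0 := by positivity
    simp only [modePhase, Fin.val_zero, Fin.val_last]; push_cast; field_simp; ring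
  · refine ⟨0, ?_⟩
    rw [coe_finRotate_of_ne_last h]; push_cast; ring_nf

/-- Positions are sampled at m - 1/2, so neighbouring positions have phases symmetric about that of
m. Their difference brings out the factor 2 sin(kπ/N) with no residual phase shift. -/
theorem modeMap_fst_sub (w : Phase (N - 1)) (m : Fin N) :
    (modeMap N w).1 (finRotate N m) - (modeMap N w).1 m =
      ∑ k, (-(modeAmp N k * w.2 k) * Real.sin (modePhase N k ((m : ℕ) + 0))
        + modeAmp N k * w.1 k * Real.cos (modePhase N k ((m : ℕ) + 0))) := by
  simp only [modeMap, LinearMap.coe_mk, AddHom.coe_mk]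
  rw [← Finset.sum_sub_distrib]
  refine Finset.sum_congr rfl fun k _ => ?_
  have hs := (sinFreq_pos k).ne'
  obtain ⟨j, hj⟩ := modePhase_finRotate k m (-1 / 2)
  rw [hj, Real.sin_sub_int_mul_two_pi, Real.cos_sub_int_mul_two_pi]
  have e1 : modePhase N k ((m : ℕ) + 1 + -1 / 2) = modePhase N k ((m : ℕ) + 0)
      + ((k : ℕ) + 1) * Real.pi / N := by simp only [modePhase]; ring
  have e2 : modePhase N k ((m : ℕ) + -1 / 2) = modePhase N k ((m : ℕ) + 0)
      - ((k : ℕ) + 1) * Real.pi / N := by simp only [modePhase]; ring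
  have e3 : modeAmp N k / (2 * sinFreq N k) * (2 * sinFreq N k) = modeAmp N k := by
    field_simp
  rw [e1, e2, Real.sin_add, Real.sin_sub, Real.cos_add, Real.cos_sub]
  rw [show Real.sin (((k : ℕ) + 1) * Real.pi / N) = sinFreq N k from rfl]
  linear_combination (w.1 k * Real.cos (modePhase N k ((m : ℕ) + 0))
    - w.2 k * Real.sin (modePhase N k ((m : ℕ) + 0))) * e3

/-- The momenta are sampled with offset -1/2 and the relative displacements with offset 0, where
cos(2πδ) is -1 and 1. The aliasing terms of kinetic and potential energy therefore cancel. -/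
theorem quadratic_modeMap (w : Phase (N - 1)) :
    1 / 2 * ∑ m, (modeMap N w).2 m ^ 2
      + 1 / 2 * ∑ m, ((modeMap N w).1 (finRotate N m) - (modeMap N w).1 m) ^ 2 =
      2 * ∑ k, sinFreq N k * action w k := by
  have h1 := sum_mul_superposition (N := N) sin_two_pi_mul_neg_half
    (fun k => modeAmp N k * w.2 k) (fun k => -(modeAmp N k * w.1 k))
    (fun k => modeAmp N k * w.2 k) (fun k => -(modeAmp N k * w.1 k))
  have h2 := sum_mul_superposition (N := N) (δ := 0) (by simp)
    (fun k => -(modeAmp N k * w.2 k)) (fun k => modeAmp N k * w.1 k)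
    (fun k => -(modeAmp N k * w.2 k)) (fun k => modeAmp N k * w.1 k)
  have h1' : ∑ m, (modeMap N w).2 m ^ 2 = _ :=
    (Finset.sum_congr rfl fun m _ => pow_two _).trans h1
  have h2' : ∑ m, ((modeMap N w).1 (finRotate N m) - (modeMap N w).1 m) ^ 2 = _ :=
    (Finset.sum_congr rfl fun m _ => by rw [modeMap_fst_sub, pow_two]).trans h2
  rw [h1', h2', cos_two_pi_mul_neg_half, mul_zero, Real.cos_zero]
  simp only [Finset.mul_sum, ← Finset.sum_add_distrib, ← Finset.sum_sub_distrib]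
  refine Finset.sum_congr rfl fun k _ => ?_
  have hN : (N : ℝ) ≠ 0 := by have := k.2; norm_cast; omega
  have h : N * (modeAmp N k * modeAmp N k) = 2 * sinFreq N k := by
    rw [modeAmp_mul_self]; field_simp
  rw [action]
  linear_combination (1 / 2) * (w.1 k ^ 2 + w.2 k ^ 2) * h

theorem finrank_reducedPhase (hN : N ≠ 0) :
    Module.finrank ℝ (reducedPhase N) = Module.finrank ℝ (Phase (N - 1)) := by
  let T : Phase N →ₗ[ℝ] ℝ × ℝ :=
    { toFun := fun z => (∑ i, z.1 i, ∑ i, z.2 i)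
      map_add' := fun a b => by simp [Finset.sum_add_distrib]
      map_smul' := fun c a => by simp [Finset.mul_sum] }
  have hNR : (N : ℝ) ≠ 0 := by exact_mod_cast hN
  have hT : Function.Surjective T := fun y => by
    refine ⟨equilibrium N (y.1 / N) (y.2 / N), ?_⟩
    ext <;> simp [T, equilibrium] <;> field_simp
  have hker : LinearMap.ker T = reducedPhase N := by
    ext z; simp [T, reducedPhase]
  have h := T.finrank_range_add_finrank_ker
  rw [LinearMap.range_eq_top.2 hT, finrank_top, hker] at h
  simp only [Module.finrank_prod, Module.finrank_self, Module.finrank_fin_fun] at h ⊢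
  omega

theorem modeMap_injective : Function.Injective (modeMap N) := by
  refine (injective_iff_map_eq_zero _).2 fun w hw => ?_
  -- Rotating w by a quarter turn makes the symplectic pairing equal to the sum of squares ∑ (x_k² +
  -- y_k²).
  have h := symplecticForm_modeMap w (-w.2, w.1)
  rw [hw] at h
  have h0 : symplecticForm (0 : Phase N) (modeMap N (-w.2, w.1)) = 0 := by simp [symplecticForm]
  rw [h0] at h
  have h1 : ∑ k, (w.1 k * w.1 k + w.2 k * w.2 k) = 0 := by
    rw [h]; exact Finset.sum_congr rfl fun k _ => by simp
  have h2 := (Finset.sum_eq_zero_iff_of_nonneg fun k _ => add_nonneg (mul_self_nonneg (w.1 k))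
    (mul_self_nonneg (w.2 k))).1 h1
  ext k
  · have := h2 k (Finset.mem_univ k)
    simpa using (mul_self_add_mul_self_eq_zero.1 this).1
  · have := h2 k (Finset.mem_univ k)
    simpa using (mul_self_add_mul_self_eq_zero.1 this).2

/-- Normal mode coordinates on the reduced phase space. -/
def modeEquiv (hN : N ≠ 0) : Phase (N - 1) ≃L[ℝ] reducedPhase N :=
  (LinearEquiv.ofInjectiveOfFinrankEq ((modeMap N).codRestrict (reducedPhase N) modeMap_mem)
    (fun _ _ h => modeMap_injective (congrArg Subtype.val h))
    (finrank_reducedPhase hN).symm).toContinuousLinearEquiv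

theorem coe_modeEquiv (hN : N ≠ 0) (w : Phase (N - 1)) :
    (modeEquiv hN w : Phase N) = modeMap N w := rfl

end ModeMap

/-! ### Cubic and quartic forms given by tensors -/

section Tensor
variable {n : ℕ}

/-- The cubic form with coefficients `U`. -/
def cubicForm (U : Mode n → Mode n → Mode n → ℂ) : ModePoly n :=
  ∑ a, ∑ b, ∑ c, C (U a b c) * (X a * X b * X c)

/-- The quartic form with coefficients `T`. -/
def quarticForm (T : Mode n → Mode n → Mode n → Mode n → ℂ) : ModePoly n :=
  ∑ a, ∑ b, ∑ c, ∑ d, C (T a b c d) * (X a * X b * X c * X d)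

theorem isHomogeneous_cubicForm (U : Mode n → Mode n → Mode n → ℂ) :
    (cubicForm U).IsHomogeneous 3 :=
  IsHomogeneous.sum _ _ _ fun a _ => IsHomogeneous.sum _ _ _ fun b _ => IsHomogeneous.sum _ _ _
    fun c _ => (((isHomogeneous_X ℂ a).mul (isHomogeneous_X ℂ b)).mul
      (isHomogeneous_X ℂ c)).C_mul _

theorem isHomogeneous_quarticForm (T : Mode n → Mode n → Mode n → Mode n → ℂ) :
    (quarticForm T).IsHomogeneous 4 :=
  IsHomogeneous.sum _ _ _ fun a _ => IsHomogeneous.sum _ _ _ fun b _ => IsHomogeneous.sum _ _ _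
    fun c _ => IsHomogeneous.sum _ _ _ fun d _ => ((((isHomogeneous_X ℂ a).mul
      (isHomogeneous_X ℂ b)).mul (isHomogeneous_X ℂ c)).mul (isHomogeneous_X ℂ d)).C_mul _

theorem modeEval_cubicForm (w : Phase n) (U : Mode n → Mode n → Mode n → ℂ) :
    modeEval w (cubicForm U) = ∑ a, ∑ b, ∑ c,
      U a b c * (Mode.coord w a * Mode.coord w b * Mode.coord w c) := by
  simp only [cubicForm, map_sum, map_mul, modeEval_C, modeEval_X]

theorem modeEval_quarticForm (w : Phase n) (T : Mode n → Mode n → Mode n → Mode n → ℂ) :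
    modeEval w (quarticForm T) = ∑ a, ∑ b, ∑ c, ∑ d,
      T a b c d * (Mode.coord w a * Mode.coord w b * Mode.coord w c * Mode.coord w d) := by
  simp only [quarticForm, map_sum, map_mul, modeEval_C, modeEval_X]

theorem quarticForm_add (T T' : Mode n → Mode n → Mode n → Mode n → ℂ) :
    quarticForm (fun a b c d => T a b c d + T' a b c d) = quarticForm T + quarticForm T' := by
  simp only [quarticForm, C_add, add_mul, Finset.sum_add_distrib]

theorem quarticForm_smul (r : ℂ) (T : Mode n → Mode n → Mode n → Mode n → ℂ) :
    quarticForm (fun a b c d => r * T a b c d) = C r * quarticForm T := by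
  simp only [quarticForm, C_mul, mul_assoc, Finset.mul_sum]

theorem derivation_C (D : Derivation ℂ (ModePoly n) (ModePoly n)) (c : ℂ) : D (C c) = 0 :=
  D.map_algebraMap c

theorem derivation_cubicForm {D : Derivation ℂ (ModePoly n) (ModePoly n)} {l : Mode n → ℂ}
    (hD : ∀ j, D (X j) = C (l j) * X j) (U : Mode n → Mode n → Mode n → ℂ) :
    D (cubicForm U) = cubicForm fun a b c => (l a + l b + l c) * U a b c := by
  simp only [cubicForm, map_sum, Derivation.leibniz, derivation_C, hD, smul_eq_mul, C_mul, C_add,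
    mul_zero, add_zero]
  exact Finset.sum_congr rfl fun a _ => Finset.sum_congr rfl fun b _ =>
    Finset.sum_congr rfl fun c _ => by ring

theorem derivation_quarticForm {D : Derivation ℂ (ModePoly n) (ModePoly n)} {l : Mode n → ℂ}
    (hD : ∀ j, D (X j) = C (l j) * X j) (T : Mode n → Mode n → Mode n → Mode n → ℂ) :
    D (quarticForm T) = quarticForm fun a b c d => (l a + l b + l c + l d) * T a b c d := by
  simp only [quarticForm, map_sum, Derivation.leibniz, derivation_C, hD, smul_eq_mul, C_mul, C_add,
    mul_zero, add_zero]
  exact Finset.sum_congr rfl fun a _ => Finset.sum_congr rfl fun b _ =>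
    Finset.sum_congr rfl fun c _ => Finset.sum_congr rfl fun d _ => by ring

/-- Symmetry of the coefficients of a cubic form. -/
def SymmetricTensor (U : Mode n → Mode n → Mode n → ℂ) : Prop :=
  ∀ a b c, U a b c = U b a c ∧ U a b c = U a c b

theorem pderiv_cubicForm {U : Mode n → Mode n → Mode n → ℂ} (hU : SymmetricTensor U) (j : Mode n) :
    pderiv j (cubicForm U) = ∑ b, ∑ c, C (3 * U j b c) * (X b * X c) := by
  classical
  have h1 : pderiv j (cubicForm U) = ∑ a, ∑ b, ∑ c,
      ((if a = j then C (U a b c) * (X b * X c) else 0)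
        + (if b = j then C (U a b c) * (X a * X c) else 0)
        + (if c = j then C (U a b c) * (X a * X b) else 0)) := by
    simp only [cubicForm, map_sum, Derivation.leibniz, derivation_C, smul_eq_mul, pderiv_X,
      Pi.single_apply]
    refine Finset.sum_congr rfl fun a _ => Finset.sum_congr rfl fun b _ =>
      Finset.sum_congr rfl fun c _ => ?_
    split_ifs <;> ring
  rw [h1]
  simp only [Finset.sum_add_distrib]
  have e1 : ∑ a, ∑ b, ∑ c, (if a = j then C (U a b c) * (X b * X c) else (0 : ModePoly n)) =
      ∑ b, ∑ c, C (U j b c) * (X b * X c) := by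
    rw [Finset.sum_eq_single j (fun a _ h => by simp [h]) (by simp)]; simp
  have e2 : ∑ a, ∑ b, ∑ c, (if b = j then C (U a b c) * (X a * X c) else (0 : ModePoly n)) =
      ∑ b, ∑ c, C (U j b c) * (X b * X c) := by
    refine Finset.sum_congr rfl fun a _ => ?_
    rw [Finset.sum_eq_single j (fun a _ h => by simp [h]) (by simp)]
    simp [(hU a j _).1]
  have e3 : ∑ a, ∑ b, ∑ c, (if c = j then C (U a b c) * (X a * X b) else (0 : ModePoly n)) =
      ∑ b, ∑ c, C (U j b c) * (X b * X c) := by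
    refine Finset.sum_congr rfl fun a _ => Finset.sum_congr rfl fun b _ => ?_
    rw [Finset.sum_eq_single j (fun a _ h => by simp [h]) (by simp), if_pos rfl,
      (hU a b j).2, (hU a j b).1]
  rw [e1, e2, e3]
  simp only [← Finset.sum_add_distrib]
  refine Finset.sum_congr rfl fun b _ => Finset.sum_congr rfl fun c _ => ?_
  rw [C_mul, map_ofNat]; ring

/-- The coefficients of the Poisson bracket of two cubic forms. -/
def bracketTensor (S U : Mode n → Mode n → Mode n → ℂ) (b c d e : Mode n) : ℂ :=
  ∑ j : Mode n, -Complex.I * j.sign * (3 * S j.conj d e) * (3 * U j b c)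

theorem hamDer_cubicForm {S U : Mode n → Mode n → Mode n → ℂ} (hS : SymmetricTensor S)
    (hU : SymmetricTensor U) :
    hamDer (cubicForm S) (cubicForm U) = quarticForm (bracketTensor S U) := by
  have hprod : ∀ (k : ModePoly n) (f g : Mode n → Mode n → ModePoly n),
      k * (∑ d, ∑ e, g d e) * (∑ b, ∑ c, f b c) =
        ∑ b, ∑ c, ∑ d, ∑ e, k * g d e * f b c := by
    intro k f g
    rw [mul_comm, Finset.sum_mul]
    refine Finset.sum_congr rfl fun b _ => ?_
    rw [Finset.sum_mul]
    refine Finset.sum_congr rfl fun c _ => ?_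
    simp only [Finset.mul_sum]
    exact Finset.sum_congr rfl fun d _ => Finset.sum_congr rfl fun e _ => mul_comm _ _
  have comm4 : ∀ f : Mode n → Mode n → Mode n → Mode n → Mode n → ModePoly n,
      ∑ b, ∑ c, ∑ d, ∑ e, ∑ j, f j b c d e = ∑ j, ∑ b, ∑ c, ∑ d, ∑ e, f j b c d e := by
    intro f
    simp only [fun b c d => Finset.sum_comm (s := (Finset.univ : Finset (Mode n)))
      (t := Finset.univ) (f := fun e j => f j b c d e)]
    simp only [fun b c => Finset.sum_comm (s := (Finset.univ : Finset (Mode n)))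
      (t := Finset.univ) (f := fun d j => ∑ e, f j b c d e)]
    simp only [fun b => Finset.sum_comm (s := (Finset.univ : Finset (Mode n)))
      (t := Finset.univ) (f := fun c j => ∑ d, ∑ e, f j b c d e)]
    exact Finset.sum_comm
  rw [hamDer_apply]
  simp only [pderiv_cubicForm hS, pderiv_cubicForm hU, hprod, quarticForm, bracketTensor, map_sum,
    Finset.sum_mul]
  refine Eq.trans ?_ (comm4 _).symm
  refine Finset.sum_congr rfl fun j _ => Finset.sum_congr rfl fun b _ =>
    Finset.sum_congr rfl fun c _ => Finset.sum_congr rfl fun d _ =>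
      Finset.sum_congr rfl fun e _ => ?_
  rw [C_mul (a := -Complex.I * j.sign * (3 * S j.conj d e)),
    C_mul (a := -Complex.I * (j.sign : ℂ))]
  ring

/-! ### Real forms -/

theorem symplecticLin_sub (u v : Phase n) :
    symplecticLin (u - v) = symplecticLin u - symplecticLin v := by
  rw [sub_eq_add_neg, ← neg_one_smul ℝ, symplecticLin_add, symplecticLin_smul]
  simp [sub_eq_add_neg]

theorem shearGenerator_mem_realPowers (c : ℝ) (d : ℕ) (u : Phase n) :
    shearGenerator c d u ∈ realPowers n d := AddSubmonoid.subset_closure ⟨c, u, rfl⟩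

/-- This is polarization: 24 xyz = (x + y + z)³ - (x + y - z)³ - (x - y + z)³ + (x - y - z)³. -/
theorem mul_three_mem_realPowers (r : ℝ) (u v w : Phase n) :
    C (r : ℂ) * (symplecticLin u * symplecticLin v * symplecticLin w) ∈ realPowers n 2 := by
  have h : C (r : ℂ) * (symplecticLin u * symplecticLin v * symplecticLin w) =
      shearGenerator (r / 8) 2 (u + v + w) + shearGenerator (-(r / 8)) 2 (u + v - w)
        + shearGenerator (-(r / 8)) 2 (u - v + w) + shearGenerator (r / 8) 2 (u - v - w) := by
    have hr : (C (r : ℂ) : ModePoly n) = 24 * C ((r / 8 / ((2 : ℕ) + 1) : ℝ) : ℂ) := by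
      rw [← map_ofNat C 24, ← C_mul]; congr 1; push_cast; ring
    simp only [shearGenerator, symplecticLin_add, symplecticLin_sub, neg_div, Complex.ofReal_neg,
      C_neg]
    rw [hr]; ring
  rw [h]
  exact add_mem (add_mem (add_mem (shearGenerator_mem_realPowers _ _ _)
    (shearGenerator_mem_realPowers _ _ _)) (shearGenerator_mem_realPowers _ _ _))
    (shearGenerator_mem_realPowers _ _ _)

/-- Polarization again: 192 times the product is a signed sum of eight fourth powers. -/
theorem mul_four_mem_realPowers (r : ℝ) (u v w z : Phase n) :
    C (r : ℂ) * (symplecticLin u * symplecticLin v * symplecticLin w * symplecticLin z) ∈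
      realPowers n 3 := by
  have h : C (r : ℂ) * (symplecticLin u * symplecticLin v * symplecticLin w * symplecticLin z) =
      shearGenerator (r / 48) 3 (u + v + w + z) + shearGenerator (-(r / 48)) 3 (u + v + w - z)
      + (shearGenerator (-(r / 48)) 3 (u + v - w + z) + shearGenerator (r / 48) 3 (u + v - w - z))
      + (shearGenerator (-(r / 48)) 3 (u - v + w + z) + shearGenerator (r / 48) 3 (u - v + w - z)
      + (shearGenerator (r / 48) 3 (u - v - w + z)
        + shearGenerator (-(r / 48)) 3 (u - v - w - z))) := by
    have hr : (C (r : ℂ) : ModePoly n) = 192 * C ((r / 48 / ((3 : ℕ) + 1) : ℝ) : ℂ) := by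
      rw [← map_ofNat C 192, ← C_mul]; congr 1; push_cast; ring
    simp only [shearGenerator, symplecticLin_add, symplecticLin_sub, neg_div, Complex.ofReal_neg,
      C_neg]
    rw [hr]; ring
  rw [h]
  repeat' refine add_mem ?_ ?_
  all_goals exact shearGenerator_mem_realPowers _ _ _

/-- The real and imaginary parts of a coordinate are real linear forms, and these are ω(u, ·) for
suitable u since ω is nondegenerate. -/
theorem exists_X_eq (j : Mode n) : ∃ u v : Phase n,
    X j = symplecticLin u + C Complex.I * symplecticLin v ∧
    X j.conj = symplecticLin u - C Complex.I * symplecticLin v := by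
  classical
  have h2 := Mode.sqrt_two_mul_self
  have h0 : ((√2 : ℝ) : ℂ) ≠ 0 := by intro h; simp [h] at h2
  have hform : ∀ u : Phase n, (∀ i : Mode n, i.1 ≠ j.1 → Mode.coord u i = 0) →
      symplecticLin u = C (-Complex.I * j.sign * Mode.coord u j.conj) * X j
        + C (Complex.I * j.sign * Mode.coord u j) * X j.conj := by
    intro u hu
    rw [symplecticLin, Finset.sum_eq_add j j.conj j.conj_ne.symm]
    · congr 2; simp
    · rintro ⟨i, b⟩ _ ⟨h1, h2⟩
      have : i ≠ j.1 := by
        rintro rfl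
        rcases j with ⟨k, c⟩
        cases b <;> cases c <;> simp [Mode.conj] at h1 h2
      rw [hu _ (by simpa [Mode.conj] using this)]; simp
    · simp
    · simp
  have hs : ((j.sign : ℝ) : ℂ) * j.sign = 1 := by exact_mod_cast j.sign_mul_self
  have c1 : ∀ r : ℝ, Mode.coord ((0, Pi.single j.1 r) : Phase n) j =
      j.sign * r * Complex.I / (√2 : ℝ) := fun r => by simp [Mode.coord]
  have c1' : ∀ r : ℝ, Mode.coord ((0, Pi.single j.1 r) : Phase n) j.conj =
      -j.sign * r * Complex.I / (√2 : ℝ) := fun r => by simp [Mode.coord]; simp [Mode.conj]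
  have c2 : ∀ r : ℝ, Mode.coord ((Pi.single j.1 r, 0) : Phase n) j = r / (√2 : ℝ) :=
    fun r => by simp [Mode.coord]
  have c2' : ∀ r : ℝ, Mode.coord ((Pi.single j.1 r, 0) : Phase n) j.conj = r / (√2 : ℝ) :=
    fun r => by simp [Mode.coord]; simp [Mode.conj]
  have hu := hform (0, Pi.single j.1 (-√2 / 2)) (fun i hi => by simp [Mode.coord, hi])
  have hv := hform (Pi.single j.1 (j.sign * √2 / 2), 0) (fun i hi => by simp [Mode.coord, hi])
  have k1 : -Complex.I * j.sign * (-j.sign * ((-√2 / 2 : ℝ) : ℂ) * Complex.I / (√2 : ℝ))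
      = 1 / 2 := by
    push_cast; field_simp
    linear_combination (-(j.sign : ℂ) ^ 2) * Complex.I_sq + hs
  have k2 : Complex.I * j.sign * (j.sign * ((-√2 / 2 : ℝ) : ℂ) * Complex.I / (√2 : ℝ))
      = 1 / 2 := by
    push_cast; field_simp
    linear_combination (-(j.sign : ℂ) ^ 2) * Complex.I_sq + hs
  have k3 : -Complex.I * j.sign * (((j.sign * √2 / 2 : ℝ) : ℂ) / (√2 : ℝ)) = -Complex.I / 2 := by
    push_cast; field_simp
    linear_combination (-1 : ℂ) * hs
  have k4 : Complex.I * j.sign * (((j.sign * √2 / 2 : ℝ) : ℂ) / (√2 : ℝ)) = Complex.I / 2 := by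
    push_cast; field_simp
    linear_combination (1 : ℂ) * hs
  rw [c1, c1', k1, k2] at hu
  rw [c2, c2', k3, k4] at hv
  have hI : (C Complex.I * C (-Complex.I / 2) : ModePoly n) = C (1 / 2) := by
    rw [← C_mul]; congr 1; linear_combination (-1 / 2 : ℂ) * Complex.I_sq
  have hI' : (C Complex.I * C (Complex.I / 2) : ModePoly n) = -C (1 / 2) := by
    rw [← C_mul, ← C_neg]; congr 1; linear_combination (1 / 2 : ℂ) * Complex.I_sq
  have hh : (C (1 / 2) + C (1 / 2) : ModePoly n) = 1 := by
    rw [← C_add]; norm_num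
  refine ⟨(0, Pi.single j.1 (-√2 / 2)), (Pi.single j.1 (j.sign * √2 / 2), 0), ?_, ?_⟩
  · rw [hu, hv]; linear_combination (-X j) * hI - X j.conj * hI' - X j * hh
  · rw [hu, hv]; linear_combination (X j) * hI + X j.conj * hI' - X j.conj * hh

/-- Multiplying a product and its conjugate in parallel shows that their imaginary parts cancel in
the sum. -/
theorem mul_of_sq_eq_neg_one {R : Type*} [CommRing R] {i : R} (hi : i * i = -1) (a b c d : R) :
    (a + i * b) * (c + i * d) = (a * c - b * d) + i * (a * d + b * c) ∧
    (a - i * b) * (c - i * d) = (a * c - b * d) - i * (a * d + b * c) :=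
  ⟨by linear_combination (b * d) * hi, by linear_combination (b * d) * hi⟩

theorem C_eq_re_add_im (z : ℂ) : (C z : ModePoly n) = C (z.re : ℂ) + C Complex.I * C (z.im : ℂ) ∧
    (C ((starRingEnd ℂ) z) : ModePoly n) = C (z.re : ℂ) - C Complex.I * C (z.im : ℂ) := by
  constructor
  · rw [← C_mul, ← C_add]; congr 1; rw [mul_comm]; exact (Complex.re_add_im z).symm
  · rw [← C_mul, ← C_sub]; congr 1
    apply Complex.ext <;> simp

theorem C_I_mul_C_I : (C Complex.I * C Complex.I : ModePoly n) = -1 := by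
  rw [← C_mul, Complex.I_mul_I, C_neg, C_1]

theorem cubic_add_conj_mem_realPowers (z : ℂ) (a b c : Mode n) :
    C z * (X a * X b * X c) + C ((starRingEnd ℂ) z) * (X a.conj * X b.conj * X c.conj) ∈
      realPowers n 2 := by
  obtain ⟨p₁, q₁, h₁, h₁'⟩ := exists_X_eq a
  obtain ⟨p₂, q₂, h₂, h₂'⟩ := exists_X_eq b
  obtain ⟨p₃, q₃, h₃, h₃'⟩ := exists_X_eq c
  have hi := C_I_mul_C_I (n := n)
  have h : C z * (X a * X b * X c) + C ((starRingEnd ℂ) z) * (X a.conj * X b.conj * X c.conj) =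
      C ((2 * z.re : ℝ) : ℂ) * (symplecticLin p₁ * symplecticLin p₂ * symplecticLin p₃)
      + C ((-(2 * z.re) : ℝ) : ℂ) * (symplecticLin p₁ * symplecticLin q₂ * symplecticLin q₃)
      + C ((-(2 * z.re) : ℝ) : ℂ) * (symplecticLin q₁ * symplecticLin p₂ * symplecticLin q₃)
      + C ((-(2 * z.re) : ℝ) : ℂ) * (symplecticLin q₁ * symplecticLin q₂ * symplecticLin p₃)
      + C ((-(2 * z.im) : ℝ) : ℂ) * (symplecticLin p₁ * symplecticLin p₂ * symplecticLin q₃)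
      + C ((-(2 * z.im) : ℝ) : ℂ) * (symplecticLin p₁ * symplecticLin q₂ * symplecticLin p₃)
      + C ((-(2 * z.im) : ℝ) : ℂ) * (symplecticLin q₁ * symplecticLin p₂ * symplecticLin p₃)
      + C ((2 * z.im : ℝ) : ℂ) * (symplecticLin q₁ * symplecticLin q₂ * symplecticLin q₃) := by
    rw [h₁, h₂, h₃, h₁', h₂', h₃', (C_eq_re_add_im z).1, (C_eq_re_add_im z).2]
    simp only [(mul_of_sq_eq_neg_one hi _ _ _ _).1, (mul_of_sq_eq_neg_one hi _ _ _ _).2]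
    push_cast [C_mul, C_neg, map_ofNat]
    ring
  rw [h]
  repeat' refine add_mem ?_ ?_
  all_goals exact mul_three_mem_realPowers _ _ _ _

theorem quartic_add_conj_mem_realPowers (z : ℂ) (a b c d : Mode n) :
    C z * (X a * X b * X c * X d)
      + C ((starRingEnd ℂ) z) * (X a.conj * X b.conj * X c.conj * X d.conj) ∈ realPowers n 3 := by
  obtain ⟨p₁, q₁, h₁, h₁'⟩ := exists_X_eq a
  obtain ⟨p₂, q₂, h₂, h₂'⟩ := exists_X_eq b
  obtain ⟨p₃, q₃, h₃, h₃'⟩ := exists_X_eq c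
  obtain ⟨p₄, q₄, h₄, h₄'⟩ := exists_X_eq d
  have hi := C_I_mul_C_I (n := n)
  let M : ℝ → Phase n → Phase n → Phase n → Phase n → ModePoly n := fun r u v w z =>
    C (r : ℂ) * (symplecticLin u * symplecticLin v * symplecticLin w * symplecticLin z)
  have h : C z * (X a * X b * X c * X d)
      + C ((starRingEnd ℂ) z) * (X a.conj * X b.conj * X c.conj * X d.conj) =
      M (2 * z.re) p₁ p₂ p₃ p₄ + M (-(2 * z.re)) p₁ p₂ q₃ q₄ + M (-(2 * z.re)) p₁ q₂ p₃ q₄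
      + M (-(2 * z.re)) p₁ q₂ q₃ p₄ + M (-(2 * z.re)) q₁ p₂ p₃ q₄ + M (-(2 * z.re)) q₁ p₂ q₃ p₄
      + M (-(2 * z.re)) q₁ q₂ p₃ p₄ + M (2 * z.re) q₁ q₂ q₃ q₄
      + M (-(2 * z.im)) q₁ p₂ p₃ p₄ + M (-(2 * z.im)) p₁ q₂ p₃ p₄ + M (-(2 * z.im)) p₁ p₂ q₃ p₄
      + M (-(2 * z.im)) p₁ p₂ p₃ q₄ + M (2 * z.im) p₁ q₂ q₃ q₄ + M (2 * z.im) q₁ p₂ q₃ q₄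
      + M (2 * z.im) q₁ q₂ p₃ q₄ + M (2 * z.im) q₁ q₂ q₃ p₄ := by
    rw [h₁, h₂, h₃, h₄, h₁', h₂', h₃', h₄', (C_eq_re_add_im z).1, (C_eq_re_add_im z).2]
    simp only [(mul_of_sq_eq_neg_one hi _ _ _ _).1, (mul_of_sq_eq_neg_one hi _ _ _ _).2]
    push_cast [M, C_mul, C_neg, map_ofNat]
    ring
  rw [h]
  repeat' refine add_mem ?_ ?_
  all_goals exact mul_four_mem_realPowers _ _ _ _ _

/-- The reality condition on the coefficients lets half of each monomial be paired with half of its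
conjugate. -/
theorem cubicForm_mem_realPowers {U : Mode n → Mode n → Mode n → ℂ}
    (hU : ∀ a b c, U a.conj b.conj c.conj = (starRingEnd ℂ) (U a b c)) :
    cubicForm U ∈ realPowers n 2 := by
  have h : cubicForm U = ∑ a, ∑ b, ∑ c, (C (U a b c / 2) * (X a * X b * X c)
      + C ((starRingEnd ℂ) (U a b c / 2)) * (X a.conj * X b.conj * X c.conj)) := by
    simp only [Finset.sum_add_distrib]
    have e : ∑ a : Mode n, ∑ b : Mode n, ∑ c : Mode n,
        C ((starRingEnd ℂ) (U a b c / 2)) * (X a.conj * X b.conj * X c.conj) =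
        ∑ a : Mode n, ∑ b : Mode n, ∑ c : Mode n, C (U a b c / 2) * (X a * X b * X c) := by
      rw [← Mode.sum_conj (fun a => ∑ b : Mode n, ∑ c : Mode n,
        C (U a b c / 2) * (X a * X b * X c))]
      refine Finset.sum_congr rfl fun a _ => ?_
      rw [← Mode.sum_conj (fun b => ∑ c : Mode n, C (U a.conj b c / 2) * (X a.conj * X b * X c))]
      refine Finset.sum_congr rfl fun b _ => ?_
      rw [← Mode.sum_conj (fun c => C (U a.conj b.conj c / 2) * (X a.conj * X b.conj * X c))]
      refine Finset.sum_congr rfl fun c _ => ?_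
      rw [hU, map_div₀, Complex.conj_ofNat]
    rw [e]
    simp only [← Finset.sum_add_distrib, ← add_mul, ← C_add, add_halves, cubicForm]
  rw [h]
  exact sum_mem fun a _ => sum_mem fun b _ => sum_mem fun c _ =>
    cubic_add_conj_mem_realPowers _ _ _ _

theorem quarticForm_mem_realPowers {T : Mode n → Mode n → Mode n → Mode n → ℂ}
    (hT : ∀ a b c d, T a.conj b.conj c.conj d.conj = (starRingEnd ℂ) (T a b c d)) :
    quarticForm T ∈ realPowers n 3 := by
  have h : quarticForm T = ∑ a, ∑ b, ∑ c, ∑ d, (C (T a b c d / 2) * (X a * X b * X c * X d)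
      + C ((starRingEnd ℂ) (T a b c d / 2)) * (X a.conj * X b.conj * X c.conj * X d.conj)) := by
    simp only [Finset.sum_add_distrib]
    have e : ∑ a : Mode n, ∑ b : Mode n, ∑ c : Mode n, ∑ d : Mode n,
        C ((starRingEnd ℂ) (T a b c d / 2)) * (X a.conj * X b.conj * X c.conj * X d.conj) =
        ∑ a : Mode n, ∑ b : Mode n, ∑ c : Mode n, ∑ d : Mode n,
          C (T a b c d / 2) * (X a * X b * X c * X d) := by
      rw [← Mode.sum_conj (fun a => ∑ b : Mode n, ∑ c : Mode n, ∑ d : Mode n,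
        C (T a b c d / 2) * (X a * X b * X c * X d))]
      refine Finset.sum_congr rfl fun a _ => ?_
      rw [← Mode.sum_conj (fun b => ∑ c : Mode n, ∑ d : Mode n,
        C (T a.conj b c d / 2) * (X a.conj * X b * X c * X d))]
      refine Finset.sum_congr rfl fun b _ => ?_
      rw [← Mode.sum_conj (fun c => ∑ d : Mode n,
        C (T a.conj b.conj c d / 2) * (X a.conj * X b.conj * X c * X d))]
      refine Finset.sum_congr rfl fun c _ => ?_
      rw [← Mode.sum_conj (fun d =>
        C (T a.conj b.conj c.conj d / 2) * (X a.conj * X b.conj * X c.conj * X d))]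
      refine Finset.sum_congr rfl fun d _ => ?_
      rw [hT, map_div₀, Complex.conj_ofNat]
    rw [e]
    simp only [← Finset.sum_add_distrib, ← add_mul, ← C_add, add_halves, quarticForm]
  rw [h]
  exact sum_mem fun a _ => sum_mem fun b _ => sum_mem fun c _ => sum_mem fun d _ =>
    quartic_add_conj_mem_realPowers _ _ _ _ _

end Tensor

/-! ### Birkhoff normalization to order four -/

section Normalization
variable {n : ℕ}

/-- The Hamiltonian `∑ ω_k I_k`. -/
def harmonicForm (ω : Fin n → ℝ) : ModePoly n :=
  ∑ j : Mode n, C ((ω j.1 / 2 : ℝ) : ℂ) * (X j * X j.conj)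

theorem isHomogeneous_harmonicForm (ω : Fin n → ℝ) : (harmonicForm ω).IsHomogeneous 2 :=
  IsHomogeneous.sum _ _ _ fun j _ =>
    ((isHomogeneous_X ℂ j).mul (isHomogeneous_X ℂ j.conj)).C_mul _

theorem modeEval_harmonicForm (ω : Fin n → ℝ) (w : Phase n) :
    modeEval w (harmonicForm ω) = ((∑ k, ω k * action w k : ℝ) : ℂ) := by
  simp only [harmonicForm, map_sum, map_mul, modeEval_C, modeEval_X, Mode.coord_mul_conj]
  rw [Fintype.sum_prod_type]
  push_cast
  refine Finset.sum_congr rfl fun k _ => ?_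
  simp; ring

/-- The signed frequency of a mode. -/
def Mode.freq (ω : Fin n → ℝ) (j : Mode n) : ℝ := j.sign * ω j.1

theorem Mode.freq_conj (ω : Fin n → ℝ) (j : Mode n) : j.conj.freq ω = -j.freq ω := by
  rw [Mode.freq, Mode.freq, Mode.sign_conj]; simp [Mode.conj]

theorem hamDer_harmonicForm_X (ω : Fin n → ℝ) (j : Mode n) :
    hamDer (harmonicForm ω) (X j) = C (-Complex.I * j.freq ω) * X j := by
  classical
  have hp : ∀ i : Mode n, pderiv i (harmonicForm ω) = C (ω i.1 : ℂ) * X i.conj := by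
    intro i
    have h1 : pderiv i (harmonicForm ω) = ∑ j : Mode n,
        ((if j = i then C ((ω j.1 / 2 : ℝ) : ℂ) * X j.conj else 0)
          + if j.conj = i then C ((ω j.1 / 2 : ℝ) : ℂ) * X j else 0) := by
      simp only [harmonicForm, map_sum, Derivation.leibniz, derivation_C, smul_eq_mul, pderiv_X,
        Pi.single_apply]
      refine Finset.sum_congr rfl fun a _ => ?_
      split_ifs <;> ring
    rw [h1, Finset.sum_add_distrib, Finset.sum_ite_eq' Finset.univ i,
      Finset.sum_eq_single i.conj (fun a _ h => if_neg fun h' => h (by rw [← h', Mode.conj_conj]))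
        (by simp)]
    simp only [Finset.mem_univ, if_true, Mode.conj_conj]
    rw [← add_mul, show i.conj.1 = i.1 from rfl, ← C_add]
    congr 2; push_cast; ring
  rw [hamDer_apply, Finset.sum_eq_single j]
  · rw [hp, pderiv_X_self, Mode.conj_conj, mul_one, ← mul_assoc, ← C_mul]
    congr 2
    rw [Mode.freq, show j.conj.1 = j.1 from rfl]; push_cast; ring
  · intro b _ hb; simp [pderiv_X, Ne.symm hb]
  · simp

/-- The coefficients of the generator that removes the cubic form with coefficients `U`. -/
def cubicGenerator (ω : Fin n → ℝ) (U : Mode n → Mode n → Mode n → ℂ) (a b c : Mode n) : ℂ :=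
  U a b c * (Complex.I / ((a.freq ω + b.freq ω + c.freq ω : ℝ) : ℂ))

/-- The quartic coefficients after removal of the cubic form. -/
def transformedQuartic (ω : Fin n → ℝ) (U : Mode n → Mode n → Mode n → ℂ)
    (T : Mode n → Mode n → Mode n → Mode n → ℂ) (a b c d : Mode n) : ℂ :=
  T a b c d + 1 / 2 * bracketTensor (cubicGenerator ω U) U a b c d

/-- Bracketing with the harmonic part multiplies a monomial by ∓i times its total frequency, so the
homological equations are solved by dividing by it. The cubic generator S removes U and the quartic
generator R removes the non-resonant part of what is left; both are real because conjugation changes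
the sign of i and of the frequency alike. -/
theorem exists_normalization (ω : Fin n → ℝ) {U : Mode n → Mode n → Mode n → ℂ}
    {T : Mode n → Mode n → Mode n → Mode n → ℂ} (hU : SymmetricTensor U)
    (hUc : ∀ a b c, U a.conj b.conj c.conj = (starRingEnd ℂ) (U a b c))
    (hTc : ∀ a b c d, T a.conj b.conj c.conj d.conj = (starRingEnd ℂ) (T a b c d))
    (hres : ∀ a b c, a.freq ω + b.freq ω + c.freq ω = 0 → U a b c = 0) :
    ∃ Ψ : Phase n ≃ₜ Phase n, IsSymplecticAut Ψ ∧ VanishesToOrder 5 fun w =>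
      modeEval (Ψ w) (harmonicForm ω + cubicForm U + quarticForm T) -
      modeEval w (harmonicForm ω + quarticForm fun a b c d =>
        if a.freq ω + b.freq ω + c.freq ω + d.freq ω = 0
          then transformedQuartic ω U T a b c d else 0) := by
  classical
  set S := cubicGenerator ω U with hSdef
  set K := transformedQuartic ω U T with hKdef
  have hS : SymmetricTensor S := fun a b c => by
    simp only [hSdef, cubicGenerator]
    refine ⟨?_, ?_⟩
    · rw [(hU a b c).1, add_comm (a.freq ω)]
    · rw [(hU a b c).2, add_right_comm]
  have hSc : ∀ a b c, S a.conj b.conj c.conj = (starRingEnd ℂ) (S a b c) := fun a b c => by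
    simp only [hSdef, cubicGenerator, hUc, Mode.freq_conj, map_mul, map_div₀, Complex.conj_I,
      Complex.conj_ofReal]
    congr 1
    rw [show -a.freq ω + -b.freq ω + -c.freq ω = -(a.freq ω + b.freq ω + c.freq ω) by ring,
      Complex.ofReal_neg, div_neg, neg_div]
  have hKc : ∀ a b c d, K a.conj b.conj c.conj d.conj = (starRingEnd ℂ) (K a b c d) := by
    intro a b c d
    simp only [hKdef, transformedQuartic, hTc, map_add, map_mul, bracketTensor, map_sum]
    congr 2
    · rw [map_div₀, map_one, Complex.conj_ofNat]
    · rw [← Mode.sum_conj]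
      refine Finset.sum_congr rfl fun j _ => ?_
      have hSc' := hSc j.conj c d
      rw [Mode.conj_conj] at hSc'
      simp only [← hSdef, hSc', hUc, Mode.sign_conj, map_neg, Complex.conj_I, Complex.conj_ofReal,
        Complex.conj_ofNat, Mode.conj_conj]
      push_cast; ring
  set R : Mode n → Mode n → Mode n → Mode n → ℂ := fun a b c d =>
    K a b c d * (Complex.I / ((a.freq ω + b.freq ω + c.freq ω + d.freq ω : ℝ) : ℂ)) with hRdef
  have hRc : ∀ a b c d, R a.conj b.conj c.conj d.conj = (starRingEnd ℂ) (R a b c d) := by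
    intro a b c d
    simp only [hRdef, hKc, Mode.freq_conj, map_mul, map_div₀, Complex.conj_I,
      Complex.conj_ofReal]
    congr 1
    rw [show -a.freq ω + -b.freq ω + -c.freq ω + -d.freq ω =
      -(a.freq ω + b.freq ω + c.freq ω + d.freq ω) by ring,
      Complex.ofReal_neg, div_neg, neg_div]
  set Z : Mode n → Mode n → Mode n → Mode n → ℂ := fun a b c d =>
    if a.freq ω + b.freq ω + c.freq ω + d.freq ω = 0 then K a b c d else 0 with hZdef
  have hD := hamDer_harmonicForm_X ω
  have d1 : hamDer (cubicForm S) (harmonicForm ω) = -cubicForm U := by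
    rw [hamDer_antisymm, derivation_cubicForm hD]
    congr 2
    funext a b c
    by_cases h : a.freq ω + b.freq ω + c.freq ω = 0
    · simp [hSdef, cubicGenerator, hres a b c h]
    · have h' : ((a.freq ω + b.freq ω + c.freq ω : ℝ) : ℂ) ≠ 0 := by exact_mod_cast h
      simp only [hSdef, cubicGenerator]
      push_cast at h' ⊢
      field_simp
      linear_combination (-U a b c * (a.freq ω + b.freq ω + c.freq ω)) * Complex.I_sq
  have d2 : hamDer (quarticForm R) (harmonicForm ω) = quarticForm Z - quarticForm K := by
    rw [hamDer_antisymm, derivation_quarticForm hD, neg_eq_iff_eq_neg, neg_sub, eq_sub_iff_add_eq,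
      ← quarticForm_add]
    congr 1
    funext a b c d
    -- At a resonance the division by 0 makes the coefficient of R equal to 0, which leaves that
    -- term of K untouched in Z.
    by_cases h : a.freq ω + b.freq ω + c.freq ω + d.freq ω = 0
    · simp only [hRdef, hZdef, h, if_true]; simp
    · have h' : ((a.freq ω + b.freq ω + c.freq ω + d.freq ω : ℝ) : ℂ) ≠ 0 := by exact_mod_cast h
      simp only [hRdef, hZdef, h, if_false]
      push_cast at h' ⊢
      field_simp
      linear_combination (-K a b c d * (a.freq ω + b.freq ω + c.freq ω + d.freq ω)) *
        Complex.I_sq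
  have d3 : quarticForm K = quarticForm T + C (1 / 2) * hamDer (cubicForm S) (cubicForm U) := by
    rw [hamDer_cubicForm hS hU, ← quarticForm_smul, ← quarticForm_add]
    rfl
  obtain ⟨Ψ₁, hΨ₁, hJ₁⟩ := exists_hasJet_cubic (cubicForm_mem_realPowers hSc)
  obtain ⟨Ψ₂, hΨ₂, hJ₂⟩ := exists_hasJet_quartic (quarticForm_mem_realPowers hRc)
  refine ⟨Ψ₂.trans Ψ₁, hΨ₂.trans hΨ₁, ?_⟩
  have hJ := hJ₁.comp hJ₂
  have r2 := hJ.remainder (isHomogeneous_harmonicForm ω)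
  have r3 := ((hJ.remainder (isHomogeneous_cubicForm U)).mono (show 5 ≤ 3 + 3 by norm_num)).add
    (vanishesToOrder_modeEval (hJ.homogeneous₂ (isHomogeneous_cubicForm U)))
  have r4 := (((hJ.remainder (isHomogeneous_quarticForm T)).mono (show 5 ≤ 4 + 3 by norm_num)).add
    (vanishesToOrder_modeEval (hJ.homogeneous₁ (isHomogeneous_quarticForm T)))).add
      ((vanishesToOrder_modeEval (hJ.homogeneous₂ (isHomogeneous_quarticForm T))).mono
        (show 5 ≤ 4 + 2 by norm_num))
  refine ((r2.add r3).add r4).congr fun w => ?_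
  -- Since {H₂, S} = -U, the term {{H₂, S}, S}/2 is -{U, S}/2; together with {U, S} from the cubic
  -- part it leaves +{U, S}/2, and {H₂, R} = Z - K turns K into Z.
  have hfinal : harmonicForm ω + quarticForm Z = harmonicForm ω
      + (((hamDer (cubicForm S)).toLinearMap + 0 : ModePoly n →ₗ[ℂ] ModePoly n) (harmonicForm ω))
      + (((1 / 2 : ℂ) • (hamDer (cubicForm S)).toLinearMap ∘ₗ (hamDer (cubicForm S)).toLinearMap
        + 0 ∘ₗ (hamDer (cubicForm S)).toLinearMap + (hamDer (quarticForm R)).toLinearMap :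
          ModePoly n →ₗ[ℂ] ModePoly n) (harmonicForm ω))
      + cubicForm U
      + (((hamDer (cubicForm S)).toLinearMap + 0 : ModePoly n →ₗ[ℂ] ModePoly n) (cubicForm U))
      + quarticForm T := by
    simp only [LinearMap.add_apply, LinearMap.comp_apply, LinearMap.smul_apply,
      LinearMap.zero_apply, Derivation.coeFn_coe, d1, d2, d3, map_neg, add_zero, smul_eq_C_mul]
    have hh : (C (1 / 2) + C (1 / 2) : ModePoly n) = 1 := by
      rw [← C_add]; norm_num
    linear_combination hamDer (cubicForm S) (cubicForm U) * hh
  rw [hfinal]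
  simp only [map_add, Homeomorph.trans_apply]
  ring

end Normalization

/-! ### The cubic and quartic forms of the chain -/

section FPU
variable {N : ℕ}

/-- The momentum of a mode. -/
def Mode.momentum (j : Mode (N - 1)) : ℤ := if j.2 then (j.1 : ℕ) + 1 else -((j.1 : ℕ) + 1)

theorem Mode.momentum_conj (j : Mode (N - 1)) : j.conj.momentum = -j.momentum := by
  rcases j with ⟨k, b⟩; cases b <;> simp [Mode.conj, Mode.momentum]

theorem Mode.momentum_injective : Function.Injective (Mode.momentum (N := N)) := by
  rintro ⟨k, b⟩ ⟨l, c⟩ h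
  have : k = l ∧ b = c := by
    cases b <;> cases c <;> simp [Mode.momentum] at h ⊢ <;> first | (ext; omega) | omega
  rw [this.1, this.2]

theorem Mode.momentum_add_eq_zero_iff (a b : Mode (N - 1)) :
    a.momentum + b.momentum = 0 ↔ b = a.conj := by
  rw [← Mode.momentum_injective.eq_iff, Mode.momentum_conj]; omega

theorem Mode.momentum_ne_zero (j : Mode (N - 1)) : j.momentum ≠ 0 := by
  rcases j with ⟨k, b⟩; cases b <;> simp [Mode.momentum] <;> omega

theorem Mode.abs_momentum_lt (j : Mode (N - 1)) : |j.momentum| < N := by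
  rcases j with ⟨k, b⟩
  have := k.2
  rw [abs_lt]
  cases b <;> simp [Mode.momentum] <;> omega

theorem Mode.momentum_not_dvd (j : Mode (N - 1)) : ¬ (N : ℤ) ∣ j.momentum := fun h =>
  j.momentum_ne_zero (Int.eq_zero_of_abs_lt_dvd h j.abs_momentum_lt)

/-- The frequencies of the linearized chain. -/
def fpuFreq (N : ℕ) (k : Fin (N - 1)) : ℝ := 2 * sinFreq N k

theorem freq_fpuFreq (j : Mode (N - 1)) :
    j.freq (fpuFreq N) = 2 * Real.sin (j.momentum * Real.pi / N) := by
  rcases j with ⟨k, b⟩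
  cases b
  · simp only [Mode.freq, Mode.sign, fpuFreq, sinFreq, Mode.momentum]
    push_cast
    rw [show -(((k : ℕ) : ℝ) + 1) * Real.pi / N = -((((k : ℕ) : ℝ) + 1) * Real.pi / N) by ring,
      Real.sin_neg]
    simp
  · simp [Mode.freq, Mode.sign, fpuFreq, sinFreq, Mode.momentum]

/-- The amplitude of a mode in the relative displacements. -/
def Mode.amp (j : Mode (N - 1)) : ℝ := √(sinFreq N j.1 / N)

theorem Mode.amp_conj (j : Mode (N - 1)) : j.conj.amp = j.amp := rfl

theorem Mode.amp_mul_self (j : Mode (N - 1)) : j.amp * j.amp = sinFreq N j.1 / N :=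
  Real.mul_self_sqrt (div_nonneg (sinFreq_pos _).le (Nat.cast_nonneg N))

/-- The indicator of the integers divisible by `N`. -/
def dvdIndicator (N : ℕ) (κ : ℤ) : ℝ := if (N : ℤ) ∣ κ then 1 else 0

theorem dvdIndicator_neg (κ : ℤ) : dvdIndicator N (-κ) = dvdIndicator N κ := by
  simp [dvdIndicator]

/-- The coefficients of `α / 6 ∑ r_m³`. -/
def fpuCubic (N : ℕ) (α : ℝ) (a b c : Mode (N - 1)) : ℝ :=
  α * N / 6 * (a.amp * b.amp * c.amp) * dvdIndicator N (a.momentum + b.momentum + c.momentum)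

/-- The coefficients of `β / 24 ∑ r_m⁴`. -/
def fpuQuartic (N : ℕ) (β : ℝ) (a b c d : Mode (N - 1)) : ℝ :=
  β * N / 24 * (a.amp * b.amp * c.amp * d.amp) *
    dvdIndicator N (a.momentum + b.momentum + c.momentum + d.momentum)

theorem fpuCubic_conj (α : ℝ) (a b c : Mode (N - 1)) :
    fpuCubic N α a.conj b.conj c.conj = fpuCubic N α a b c := by
  rw [fpuCubic, fpuCubic, Mode.momentum_conj, Mode.momentum_conj, Mode.momentum_conj,
    ← neg_add, ← neg_add, dvdIndicator_neg]; rfl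

theorem fpuQuartic_conj (β : ℝ) (a b c d : Mode (N - 1)) :
    fpuQuartic N β a.conj b.conj c.conj d.conj = fpuQuartic N β a b c d := by
  rw [fpuQuartic, fpuQuartic, Mode.momentum_conj, Mode.momentum_conj, Mode.momentum_conj,
    Mode.momentum_conj, ← neg_add, ← neg_add, ← neg_add, dvdIndicator_neg]; rfl

theorem fpuCubic_symm (α : ℝ) : SymmetricTensor fun a b c : Mode (N - 1) =>
    (fpuCubic N α a b c : ℂ) := by
  intro a b c
  constructor
  · simp only [fpuCubic]; rw [mul_comm a.amp, add_comm a.momentum]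
  · simp only [fpuCubic]; rw [mul_right_comm a.amp, add_right_comm a.momentum]

/-- If the momenta do not add up to 0 modulo N the coefficient is zero anyway; if they do, the
frequencies cannot add up to 0. -/
theorem fpuCubic_eq_zero (hodd : Odd N) (α : ℝ) (a b c : Mode (N - 1))
    (h : a.freq (fpuFreq N) + b.freq (fpuFreq N) + c.freq (fpuFreq N) = 0) :
    fpuCubic N α a b c = 0 := by
  rw [freq_fpuFreq, freq_fpuFreq, freq_fpuFreq] at h
  rw [fpuCubic, dvdIndicator, if_neg, mul_zero]
  intro hd
  exact sin_add_sin_add_sin_ne_zero hodd a.momentum_not_dvd b.momentum_not_dvd c.momentum_not_dvd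
    hd (by linarith)

/-- The contribution of mode `j` to the relative displacement at the site `m`. -/
def modeWave (w : Phase (N - 1)) (m : Fin N) (j : Mode (N - 1)) : ℂ :=
  j.amp * Complex.exp (2 * Real.pi * Complex.I * j.momentum * (m : ℕ) / N) * Mode.coord w j

/-- The relative displacement is a Fourier sum in the complex coordinates. Summing its powers over
the sites yields the momentum conservation built into `fpuCubic` and `fpuQuartic`. -/
theorem sum_modeWave (w : Phase (N - 1)) (m : Fin N) :
    ∑ j, modeWave w m j =
      (((modeMap N w).1 (finRotate N m) - (modeMap N w).1 m : ℝ) : ℂ) := by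
  rw [modeMap_fst_sub, Fintype.sum_prod_type]
  push_cast
  refine Finset.sum_congr rfl fun k _ => ?_
  have h2 := Mode.sqrt_two_mul_self
  have h0 : ((√2 : ℝ) : ℂ) ≠ 0 := by intro h; simp [h] at h2
  have e1 : Complex.exp (2 * Real.pi * Complex.I * ((k : ℕ) + 1) * (m : ℕ) / N) =
      Complex.cos (modePhase N k ((m : ℕ) + 0)) +
        Complex.sin (modePhase N k ((m : ℕ) + 0)) * Complex.I := by
    rw [← Complex.exp_mul_I]; congr 1; rw [modePhase]; push_cast; ring
  have e2 : Complex.exp (2 * Real.pi * Complex.I * -((k : ℕ) + 1) * (m : ℕ) / N) =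
      Complex.cos (modePhase N k ((m : ℕ) + 0)) -
        Complex.sin (modePhase N k ((m : ℕ) + 0)) * Complex.I := by
    rw [sub_eq_add_neg, ← neg_mul, ← Complex.sin_neg, ← Complex.cos_neg, ← Complex.exp_mul_I]
    congr 1; rw [modePhase]; push_cast; ring
  have ha : ((modeAmp N k : ℝ) : ℂ) = (√2 : ℝ) * ((√(sinFreq N k / N) : ℝ) : ℂ) := by
    rw [modeAmp]; push_cast; ring
  simp only [Fintype.sum_bool, modeWave, Mode.momentum, Mode.amp, Mode.coord, Mode.sign, if_true,
    Bool.false_eq_true, if_false]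
  push_cast
  rw [e1, e2, ha]
  generalize ((√2 : ℝ) : ℂ) = t at *
  field_simp
  linear_combination (2 * ((√(sinFreq N k / N) : ℝ) : ℂ) *
    Complex.sin (modePhase N k ((m : ℕ) + 0)) * w.2 k) * Complex.I_sq
    - ((√(sinFreq N k / N) : ℝ) : ℂ) * (w.1 k * Complex.cos (modePhase N k ((m : ℕ) + 0))
      - w.2 k * Complex.sin (modePhase N k ((m : ℕ) + 0))) * h2

theorem sum_exp_eq_dvdIndicator (hN : N ≠ 0) (κ : ℤ) :
    ∑ m : Fin N, Complex.exp (2 * Real.pi * Complex.I * κ * (m : ℕ) / N) =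
      N * dvdIndicator N κ := by
  rw [sum_exp_mode hN, dvdIndicator]; split_ifs <;> simp

theorem sum_comm_three {ι κ M : Type*} [Fintype ι] [Fintype κ] [AddCommMonoid M]
    (f : ι → κ → κ → κ → M) :
    ∑ m, ∑ a, ∑ b, ∑ c, f m a b c = ∑ a, ∑ b, ∑ c, ∑ m, f m a b c := by
  rw [Finset.sum_comm]
  refine Finset.sum_congr rfl fun a _ => ?_
  rw [Finset.sum_comm]
  refine Finset.sum_congr rfl fun b _ => ?_
  rw [Finset.sum_comm]

theorem sum_comm_four {ι κ M : Type*} [Fintype ι] [Fintype κ] [AddCommMonoid M]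
    (f : ι → κ → κ → κ → κ → M) :
    ∑ m, ∑ a, ∑ b, ∑ c, ∑ d, f m a b c d = ∑ a, ∑ b, ∑ c, ∑ d, ∑ m, f m a b c d := by
  rw [Finset.sum_comm]
  exact Finset.sum_congr rfl fun a _ => sum_comm_three fun m => f m a

theorem modeEval_fpuCubic (hN : N ≠ 0) (α : ℝ) (w : Phase (N - 1)) :
    modeEval w (cubicForm fun a b c => (fpuCubic N α a b c : ℂ)) =
      ((α / 6 * ∑ m, ((modeMap N w).1 (finRotate N m) - (modeMap N w).1 m) ^ 3 : ℝ) : ℂ) := by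
  rw [modeEval_cubicForm]
  push_cast
  simp only [← Complex.ofReal_sub, ← sum_modeWave]
  have h : ∀ m : Fin N, (∑ j, modeWave w m j) ^ 3 =
      ∑ a, ∑ b, ∑ c, modeWave w m a * modeWave w m b * modeWave w m c := fun m => by
    simp only [pow_succ, pow_zero, one_mul, Finset.sum_mul, Finset.mul_sum]
    exact Finset.sum_congr rfl fun a _ => Finset.sum_congr rfl fun b _ =>
      Finset.sum_congr rfl fun c _ => by ring
  simp only [h]
  rw [sum_comm_three, Finset.mul_sum]
  refine Finset.sum_congr rfl fun a _ => ?_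
  rw [Finset.mul_sum]
  refine Finset.sum_congr rfl fun b _ => ?_
  rw [Finset.mul_sum]
  refine Finset.sum_congr rfl fun c _ => ?_
  have h2 : ∀ m : Fin N, modeWave w m a * modeWave w m b * modeWave w m c =
      (a.amp * b.amp * c.amp * (Mode.coord w a * Mode.coord w b * Mode.coord w c)) *
        Complex.exp (2 * Real.pi * Complex.I * ((a.momentum + b.momentum + c.momentum : ℤ) : ℂ) *
          (m : ℕ) / N) := fun m => by
    have : 2 * Real.pi * Complex.I * ((a.momentum + b.momentum + c.momentum : ℤ) : ℂ) *
        (m : ℕ) / N = 2 * Real.pi * Complex.I * a.momentum * (m : ℕ) / N +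
        2 * Real.pi * Complex.I * b.momentum * (m : ℕ) / N +
        2 * Real.pi * Complex.I * c.momentum * (m : ℕ) / N := by push_cast; ring
    rw [this, Complex.exp_add, Complex.exp_add]
    simp only [modeWave]; ring
  simp only [h2]
  rw [← Finset.mul_sum, sum_exp_eq_dvdIndicator hN, fpuCubic]
  push_cast; ring

theorem modeEval_fpuQuartic (hN : N ≠ 0) (β : ℝ) (w : Phase (N - 1)) :
    modeEval w (quarticForm fun a b c d => (fpuQuartic N β a b c d : ℂ)) =
      ((β / 24 * ∑ m, ((modeMap N w).1 (finRotate N m) - (modeMap N w).1 m) ^ 4 : ℝ) : ℂ) := by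
  rw [modeEval_quarticForm]
  push_cast
  simp only [← Complex.ofReal_sub, ← sum_modeWave]
  have h : ∀ m : Fin N, (∑ j, modeWave w m j) ^ 4 =
      ∑ a, ∑ b, ∑ c, ∑ d, modeWave w m a * modeWave w m b * modeWave w m c * modeWave w m d :=
    fun m => by
      simp only [pow_succ, pow_zero, one_mul, Finset.sum_mul, Finset.mul_sum]
      exact Finset.sum_congr rfl fun a _ => Finset.sum_congr rfl fun b _ =>
        Finset.sum_congr rfl fun c _ => Finset.sum_congr rfl fun d _ => by ring
  simp only [h]
  rw [sum_comm_four, Finset.mul_sum]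
  refine Finset.sum_congr rfl fun a _ => ?_
  rw [Finset.mul_sum]
  refine Finset.sum_congr rfl fun b _ => ?_
  rw [Finset.mul_sum]
  refine Finset.sum_congr rfl fun c _ => ?_
  rw [Finset.mul_sum]
  refine Finset.sum_congr rfl fun d _ => ?_
  have h2 : ∀ m : Fin N, modeWave w m a * modeWave w m b * modeWave w m c * modeWave w m d =
      (a.amp * b.amp * c.amp * d.amp *
        (Mode.coord w a * Mode.coord w b * Mode.coord w c * Mode.coord w d)) *
        Complex.exp (2 * Real.pi * Complex.I *
          ((a.momentum + b.momentum + c.momentum + d.momentum : ℤ) : ℂ) * (m : ℕ) / N) :=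
    fun m => by
      have : 2 * Real.pi * Complex.I *
          ((a.momentum + b.momentum + c.momentum + d.momentum : ℤ) : ℂ) *
          (m : ℕ) / N = 2 * Real.pi * Complex.I * a.momentum * (m : ℕ) / N +
          2 * Real.pi * Complex.I * b.momentum * (m : ℕ) / N +
          2 * Real.pi * Complex.I * c.momentum * (m : ℕ) / N +
          2 * Real.pi * Complex.I * d.momentum * (m : ℕ) / N := by push_cast; ring
      rw [this, Complex.exp_add, Complex.exp_add, Complex.exp_add]
      simp only [modeWave]; ring
  simp only [h2]
  rw [← Finset.mul_sum, sum_exp_eq_dvdIndicator hN, fpuQuartic]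
  push_cast; ring

/-! ### The resonant quartic terms -/

/-- The sum over the intermediate modes of momentum `κ` in the second order perturbation term with
total frequency `Ω`. -/
def exchangeSum (N : ℕ) (κ : ℤ) (Ω : ℝ) : ℝ :=
  ∑ j : Mode (N - 1), j.sign * (j.amp * j.amp) * dvdIndicator N (κ - j.momentum) /
    (Ω - j.freq (fpuFreq N))

theorem exchangeSum_neg (κ : ℤ) (Ω : ℝ) : exchangeSum N (-κ) (-Ω) = exchangeSum N κ Ω := by
  rw [exchangeSum, ← Mode.sum_conj]
  refine Finset.sum_congr rfl fun j _ => ?_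
  rw [Mode.sign_conj, Mode.amp_conj, Mode.momentum_conj, Mode.freq_conj, ← dvdIndicator_neg,
    show -(-κ - -j.momentum) = κ - j.momentum by ring,
    show -Ω - -j.freq (fpuFreq N) = -(Ω - j.freq (fpuFreq N)) by ring, div_neg]
  ring

/-- There is no mode of momentum 0 modulo N, the centre of mass having been split off. -/
theorem exchangeSum_of_dvd {κ : ℤ} (h : (N : ℤ) ∣ κ) (Ω : ℝ) : exchangeSum N κ Ω = 0 := by
  refine Finset.sum_eq_zero fun j _ => ?_
  rw [dvdIndicator, if_neg, mul_zero, zero_div]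
  rw [dvd_sub_right h]
  exact j.momentum_not_dvd

/-- If k is the residue of κ, exactly the modes of momentum k and -(N - k) contribute. They have
frequencies ±2 sin(kπ/N) and opposite signs, and their two fractions combine into one. -/
theorem exchangeSum_of_not_dvd (hN : N ≠ 0) {κ : ℤ} (h : ¬ (N : ℤ) ∣ κ) {Ω : ℝ}
    (hΩ : Ω ^ 2 - 4 * Real.sin (κ * Real.pi / N) ^ 2 ≠ 0) :
    N * exchangeSum N κ Ω * (Ω ^ 2 - 4 * Real.sin (κ * Real.pi / N) ^ 2) =
      4 * Real.sin (κ * Real.pi / N) ^ 2 := by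
  have hNR : (N : ℝ) ≠ 0 := by exact_mod_cast hN
  have hpos : 0 < κ % N := lt_of_le_of_ne (Int.emod_nonneg _ (by omega))
    fun h0 => h (Int.dvd_of_emod_eq_zero h0.symm)
  have hlt : κ % N < N := Int.emod_lt_of_pos _ (by omega)
  obtain ⟨r, hr⟩ : ∃ r : ℕ, κ % N = r + 1 := ⟨(κ % N - 1).toNat, by omega⟩
  let k : Fin (N - 1) := ⟨r, by omega⟩
  have hκ : κ = ((k : ℕ) + 1) + N * (κ / N) := by
    have := Int.emod_add_mul_ediv κ N
    show κ = ((r : ℕ) + 1) + N * (κ / N)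
    omega
  have hsin : Real.sin (κ * Real.pi / N) ^ 2 = sinFreq N k ^ 2 := by
    have e : (κ : ℝ) * Real.pi / N = ((k : ℕ) + 1) * Real.pi / N + (κ / N : ℤ) * Real.pi := by
      have : (κ : ℝ) = ((k : ℕ) + 1) + N * (κ / N : ℤ) := by exact_mod_cast hκ
      rw [this]; field_simp
    rw [e, Real.sin_add_int_mul_pi, mul_pow, ← zpow_natCast, ← zpow_mul, mul_comm (κ / N : ℤ),
      zpow_mul]
    simp [sinFreq]
  have hsum : exchangeSum N κ Ω = sinFreq N k / N / (Ω - 2 * sinFreq N k)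
      - sinFreq N k / N / (Ω + 2 * sinFreq N k) := by
    rw [exchangeSum, Fintype.sum_prod_type]
    simp only [Fintype.sum_bool, Finset.sum_add_distrib]
    have i1 : ∀ l : Fin (N - 1), dvdIndicator N (κ - Mode.momentum (N := N) (l, true)) =
        if l = k then 1 else 0 := by
      intro l
      have e : κ - Mode.momentum (N := N) (l, true) =
          (((k : ℕ) + 1 : ℤ) - ((l : ℕ) + 1)) + N * (κ / N) := by
        simp only [Mode.momentum, if_true]; omega
      simp only [dvdIndicator, e, dvd_add_left (dvd_mul_right (N : ℤ) (κ / N)),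
        modeIndex_dvd_sub_iff, eq_comm]
    have i2 : ∀ l : Fin (N - 1), dvdIndicator N (κ - Mode.momentum (N := N) (l, false)) =
        if l = k.rev then 1 else 0 := by
      intro l
      have e : κ - Mode.momentum (N := N) (l, false) =
          (((k : ℕ) + 1 : ℤ) + ((l : ℕ) + 1)) + N * (κ / N) := by
        simp only [Mode.momentum, Bool.false_eq_true, if_false]; omega
      simp only [dvdIndicator, e, dvd_add_left (dvd_mul_right (N : ℤ) (κ / N)),
        modeIndex_dvd_add_iff]
    simp only [i1, i2, mul_ite, mul_one, mul_zero, ite_div, zero_div, Finset.sum_ite_eq',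
      Finset.mem_univ, if_true, Mode.amp_mul_self, Mode.freq, Mode.sign, fpuFreq, sinFreq_rev,
      Bool.false_eq_true, if_false]
    ring
  rw [hsin] at hΩ ⊢
  have hf : Ω ^ 2 - 4 * sinFreq N k ^ 2 = (Ω - 2 * sinFreq N k) * (Ω + 2 * sinFreq N k) := by ring
  rw [hf] at hΩ ⊢
  obtain ⟨h1, h2⟩ := mul_ne_zero_iff.1 hΩ
  have hfrac : ∀ {s u v : ℝ}, u ≠ 0 → v ≠ 0 →
      N * (s / N / u - s / N / v) * (u * v) = s * (v - u) := fun hu hv => by field_simp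
  rw [hsum, hfrac h1 h2]
  ring

/-- The angle `k π / N` of a mode. -/
def modeAngle (N : ℕ) (k : Fin (N - 1)) : ℝ := ((k : ℕ) + 1) * Real.pi / N

theorem sin_modeAngle (k : Fin (N - 1)) : Real.sin (modeAngle N k) = sinFreq N k := rfl

theorem modeAngle_pos (k : Fin (N - 1)) : 0 < modeAngle N k := by
  have hN : (0 : ℝ) < N := by have := k.2; norm_cast; omega
  have := Real.pi_pos
  rw [modeAngle]; positivity

theorem modeAngle_lt (k : Fin (N - 1)) : modeAngle N k < Real.pi := by
  have hN : (0 : ℝ) < N := by have := k.2; norm_cast; omega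
  have hk : ((k : ℕ) + 1 : ℝ) < N := by have := k.2; norm_cast; omega
  rw [modeAngle, div_lt_iff₀ hN, mul_comm]
  exact mul_lt_mul_of_pos_left hk Real.pi_pos

theorem sq_add_sub_sq_sin_add (a b : ℝ) :
    (2 * Real.sin a + 2 * Real.sin b) ^ 2 - 4 * Real.sin (a + b) ^ 2 =
      16 * (Real.sin a * Real.sin b) * Real.sin ((a + b) / 2) ^ 2 := by
  have h3 : Real.sin ((a + b) / 2) ^ 2 =
      (1 - (Real.cos a * Real.cos b - Real.sin a * Real.sin b)) / 2 := by
    rw [Real.sin_sq_eq_half_sub, show 2 * ((a + b) / 2) = a + b by ring, Real.cos_add]; ring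
  rw [h3, Real.sin_add]
  linear_combination (-4 * Real.sin a ^ 2) * Real.sin_sq_add_cos_sq b
    - 4 * Real.sin b ^ 2 * Real.sin_sq_add_cos_sq a

/-- By `sq_add_sub_sq_sin_add` the denominator is 16 sin a sin b sin²((a + b)/2), and the numerator
4 sin²(a + b) contains the same sin² of the half angle. When k + l = N the channel is empty and the
cosine vanishes too. -/
theorem exchangeSum_add (k l : Fin (N - 1)) :
    N * (sinFreq N k * sinFreq N l) *
      exchangeSum N (((k : ℕ) + 1) + ((l : ℕ) + 1)) (2 * sinFreq N k + 2 * sinFreq N l) =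
      Real.cos ((modeAngle N k + modeAngle N l) / 2) ^ 2 := by
  have hN : N ≠ 0 := by have := k.2; omega
  have hNR : (N : ℝ) ≠ 0 := by exact_mod_cast hN
  by_cases h : (N : ℤ) ∣ ((k : ℕ) + 1 : ℤ) + ((l : ℕ) + 1)
  · rw [exchangeSum_of_dvd h, mul_zero]
    rw [modeIndex_dvd_add_iff] at h
    rw [h, modeAngle, modeAngle, cast_val_rev]
    have : (((k : ℕ) + 1) * Real.pi / N + (N - 2 - (k : ℕ) + 1) * Real.pi / N) / 2 =
        Real.pi / 2 := by field_simp; ring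
    rw [this]; simp
  · have e : (((k : ℕ) + 1 + ((l : ℕ) + 1) : ℤ) : ℝ) * Real.pi / N =
        modeAngle N k + modeAngle N l := by
      rw [modeAngle, modeAngle]; push_cast; ring
    have hq := sq_add_sub_sq_sin_add (modeAngle N k) (modeAngle N l)
    have hs : 0 < Real.sin ((modeAngle N k + modeAngle N l) / 2) :=
      Real.sin_pos_of_pos_of_lt_pi (by linarith [modeAngle_pos k, modeAngle_pos l])
        (by linarith [modeAngle_lt k, modeAngle_lt l])
    have hk := sinFreq_pos k
    have hl := sinFreq_pos l
    simp only [sin_modeAngle] at hq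
    have hmain := exchangeSum_of_not_dvd hN h (Ω := 2 * sinFreq N k + 2 * sinFreq N l)
      (by rw [e, hq]; positivity)
    rw [e, hq] at hmain
    have hd : Real.sin (modeAngle N k + modeAngle N l) =
        2 * Real.sin ((modeAngle N k + modeAngle N l) / 2) *
          Real.cos ((modeAngle N k + modeAngle N l) / 2) := by
      rw [← Real.sin_two_mul]; congr 1; ring
    rw [hd] at hmain
    refine mul_right_cancel₀ (pow_ne_zero 2 hs.ne') ?_
    linear_combination (1 / 16) * hmain

theorem exchangeSum_sub {k l : Fin (N - 1)} (hkl : k ≠ l) :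
    N * (sinFreq N k * sinFreq N l) *
      exchangeSum N (((k : ℕ) + 1) - ((l : ℕ) + 1)) (2 * sinFreq N k - 2 * sinFreq N l) =
      -Real.cos ((modeAngle N k - modeAngle N l) / 2) ^ 2 := by
  have hN : N ≠ 0 := by have := k.2; omega
  have hNR : (N : ℝ) ≠ 0 := by exact_mod_cast hN
  have h : ¬ (N : ℤ) ∣ ((k : ℕ) + 1 : ℤ) - ((l : ℕ) + 1) := by rwa [modeIndex_dvd_sub_iff]
  have e : (((k : ℕ) + 1 - ((l : ℕ) + 1) : ℤ) : ℝ) * Real.pi / N =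
      modeAngle N k - modeAngle N l := by
    rw [modeAngle, modeAngle]; push_cast; ring
  have hq := sq_add_sub_sq_sin_add (modeAngle N k) (-modeAngle N l)
  have hne : (modeAngle N k - modeAngle N l) / 2 ≠ 0 := by
    intro h0
    have h1 : modeAngle N k = modeAngle N l := by linarith
    rw [modeAngle, modeAngle, div_left_inj' hNR, mul_left_inj' Real.pi_ne_zero] at h1
    exact hkl (Fin.ext (by exact_mod_cast add_right_cancel h1))
  have hs : Real.sin ((modeAngle N k - modeAngle N l) / 2) ≠ 0 := by
    rw [Ne, Real.sin_eq_zero_iff_of_lt_of_lt]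
    · exact hne
    · linarith [modeAngle_pos k, modeAngle_pos l, modeAngle_lt k, modeAngle_lt l]
    · linarith [modeAngle_pos k, modeAngle_pos l, modeAngle_lt k, modeAngle_lt l]
  have hk := sinFreq_pos k
  have hl := sinFreq_pos l
  simp only [Real.sin_neg, sin_modeAngle, ← sub_eq_add_neg, mul_neg] at hq
  have hmain := exchangeSum_of_not_dvd hN h (Ω := 2 * sinFreq N k - 2 * sinFreq N l)
    (by rw [e, hq]; simp [hs, hk.ne', hl.ne'])
  rw [e, hq] at hmain
  have hd : Real.sin (modeAngle N k - modeAngle N l) =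
      2 * Real.sin ((modeAngle N k - modeAngle N l) / 2) *
        Real.cos ((modeAngle N k - modeAngle N l) / 2) := by
    rw [← Real.sin_two_mul]; congr 1; ring
  rw [hd] at hmain
  refine mul_right_cancel₀ (pow_ne_zero 2 hs) ?_
  linear_combination (-1 / 16) * hmain

/-- With half sum x and half difference y of the angles, cos² x - cos² y = -sin(x + y) sin(x - y).
The two channels together thus give the constant -1/N, whatever k and l are. -/
theorem exchangeSum_add_exchangeSum_sub {k l : Fin (N - 1)} (hkl : k ≠ l) :
    N * (sinFreq N k * sinFreq N l) *
      (exchangeSum N (((k : ℕ) + 1) + ((l : ℕ) + 1)) (2 * sinFreq N k + 2 * sinFreq N l) +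
        exchangeSum N (((k : ℕ) + 1) - ((l : ℕ) + 1)) (2 * sinFreq N k - 2 * sinFreq N l)) =
      -(sinFreq N k * sinFreq N l) := by
  rw [mul_add, exchangeSum_add, exchangeSum_sub hkl, ← sin_modeAngle, ← sin_modeAngle]
  have h1 : modeAngle N k = (modeAngle N k + modeAngle N l) / 2 +
    (modeAngle N k - modeAngle N l) / 2 := by ring
  have h2 : modeAngle N l = (modeAngle N k + modeAngle N l) / 2 -
    (modeAngle N k - modeAngle N l) / 2 := by ring
  have e1 := congrArg Real.sin h1
  have e2 := congrArg Real.sin h2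
  rw [Real.sin_add] at e1
  rw [Real.sin_sub] at e2
  rw [e1, e2]
  generalize (modeAngle N k + modeAngle N l) / 2 = x
  generalize (modeAngle N k - modeAngle N l) / 2 = y
  linear_combination (-Real.cos x ^ 2) * Real.sin_sq_add_cos_sq y
    + Real.cos y ^ 2 * Real.sin_sq_add_cos_sq x

theorem exchangeSum_self (k : Fin (N - 1)) :
    N * sinFreq N k ^ 2 *
      exchangeSum N (((k : ℕ) + 1) + ((k : ℕ) + 1)) (2 * sinFreq N k + 2 * sinFreq N k) =
      1 - sinFreq N k ^ 2 := by
  rw [pow_two, exchangeSum_add, ← sin_modeAngle, add_self_div_two]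
  linear_combination Real.sin_sq_add_cos_sq (modeAngle N k)

end FPU

/-! ### The normal form of the chain -/

section Resonant
variable {N : ℕ}

theorem bracketTensor_fpuCubic (α : ℝ) (a b c d : Mode (N - 1)) :
    bracketTensor (cubicGenerator (fpuFreq N) fun a b c => (fpuCubic N α a b c : ℂ))
      (fun a b c => (fpuCubic N α a b c : ℂ)) a b c d =
    ((∑ j : Mode (N - 1), j.sign * 9 * fpuCubic N α j a b * fpuCubic N α j.conj c d /
      (c.freq (fpuFreq N) + d.freq (fpuFreq N) - j.freq (fpuFreq N)) : ℝ) : ℂ) := by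
  rw [bracketTensor]
  push_cast
  refine Finset.sum_congr rfl fun j _ => ?_
  rw [cubicGenerator, Mode.freq_conj]
  push_cast
  rw [show -(j.freq (fpuFreq N) : ℂ) + c.freq (fpuFreq N) + d.freq (fpuFreq N) =
    c.freq (fpuFreq N) + d.freq (fpuFreq N) - j.freq (fpuFreq N) by ring]
  simp only [div_eq_mul_inv]
  linear_combination (-9 * (j.sign : ℂ) * fpuCubic N α j a b * fpuCubic N α j.conj c d *
    ((c.freq (fpuFreq N) : ℂ) + d.freq (fpuFreq N) - j.freq (fpuFreq N))⁻¹) * Complex.I_sq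

/-- The quartic coefficients after removal of the cubic terms. -/
abbrev resonantCoeff (N : ℕ) (α β : ℝ) : Mode (N - 1) → Mode (N - 1) → Mode (N - 1) →
    Mode (N - 1) → ℂ :=
  transformedQuartic (fpuFreq N) (fun a b c => (fpuCubic N α a b c : ℂ))
    (fun a b c d => (fpuQuartic N β a b c d : ℂ))

/-- The bracket inherits momentum conservation, the intermediate mode entering once with momentum j
and once with -j. This excludes monomials that are resonant only because k and N - k have the same
frequency. -/
theorem resonantCoeff_of_not_dvd (α β : ℝ) {a b c d : Mode (N - 1)}
    (h : ¬ (N : ℤ) ∣ a.momentum + b.momentum + c.momentum + d.momentum) :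
    resonantCoeff N α β a b c d = 0 := by
  rw [resonantCoeff, transformedQuartic, bracketTensor_fpuCubic]
  have h1 : fpuQuartic N β a b c d = 0 := by simp [fpuQuartic, dvdIndicator, h]
  have h2 : ∀ j : Mode (N - 1), fpuCubic N α j a b * fpuCubic N α j.conj c d = 0 := by
    intro j
    by_contra hne
    obtain ⟨n1, n2⟩ := mul_ne_zero_iff.1 hne
    have d1 : (N : ℤ) ∣ j.momentum + a.momentum + b.momentum := by
      by_contra hd; exact n1 (by simp [fpuCubic, dvdIndicator, hd])
    have d2 : (N : ℤ) ∣ j.conj.momentum + c.momentum + d.momentum := by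
      by_contra hd; exact n2 (by simp [fpuCubic, dvdIndicator, hd])
    rw [Mode.momentum_conj] at d2
    have := dvd_add d1 d2
    rw [show j.momentum + a.momentum + b.momentum + (-j.momentum + c.momentum + d.momentum) =
      a.momentum + b.momentum + c.momentum + d.momentum by ring] at this
    exact h this
  simp only [mul_assoc, mul_div_assoc, h1]
  simp only [← mul_assoc, ← mul_div_assoc]
  simp [mul_assoc, h2]

theorem resonantCoeff_of_eq_zero (α β : ℝ) {a b c d : Mode (N - 1)}
    (h : a.momentum + b.momentum + c.momentum + d.momentum = 0) :
    resonantCoeff N α β a b c d = ((a.amp * b.amp * c.amp * d.amp * (β * N / 24 +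
      α ^ 2 * N ^ 2 / 8 * exchangeSum N (c.momentum + d.momentum)
        (c.freq (fpuFreq N) + d.freq (fpuFreq N))) : ℝ) : ℂ) := by
  rw [resonantCoeff, transformedQuartic, bracketTensor_fpuCubic]
  have h1 : fpuQuartic N β a b c d = β * N / 24 * (a.amp * b.amp * c.amp * d.amp) := by
    simp [fpuQuartic, dvdIndicator, h]
  -- When the total momentum is 0 both vertices impose the same condition on j, so the two
  -- indicators merge into one. The constant is 9 · (1/6)² = 1/4.
  have h2 : ∑ j : Mode (N - 1), j.sign * 9 * fpuCubic N α j a b * fpuCubic N α j.conj c d /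
      (c.freq (fpuFreq N) + d.freq (fpuFreq N) - j.freq (fpuFreq N)) =
      α ^ 2 * N ^ 2 / 4 * (a.amp * b.amp * c.amp * d.amp) *
        exchangeSum N (c.momentum + d.momentum) (c.freq (fpuFreq N) + d.freq (fpuFreq N)) := by
    rw [exchangeSum, Finset.mul_sum]
    refine Finset.sum_congr rfl fun j _ => ?_
    have e1 : j.momentum + a.momentum + b.momentum =
      -(c.momentum + d.momentum - j.momentum) := by omega
    have e2 : j.conj.momentum + c.momentum + d.momentum =
      c.momentum + d.momentum - j.momentum := by rw [Mode.momentum_conj]; ring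
    have e3 : dvdIndicator N (c.momentum + d.momentum - j.momentum) ^ 2 =
        dvdIndicator N (c.momentum + d.momentum - j.momentum) := by
      rw [dvdIndicator]; split_ifs <;> simp
    rw [fpuCubic, fpuCubic, e1, e2, dvdIndicator_neg, Mode.amp_conj, ← e3]
    have e4 : dvdIndicator N (c.momentum + d.momentum - j.momentum) ^ 4 =
        dvdIndicator N (c.momentum + d.momentum - j.momentum) ^ 2 := by
      rw [show 4 = 2 * 2 from rfl, pow_mul, e3, e3]
    simp only [div_eq_mul_inv]
    linear_combination (j.sign * 9 * (α * N * 6⁻¹) ^ 2 * j.amp * j.amp *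
      (a.amp * b.amp * c.amp * d.amp) *
      (c.freq (fpuFreq N) + d.freq (fpuFreq N) - j.freq (fpuFreq N))⁻¹) * e4
  rw [h1, h2]
  push_cast; ring

/-- Inclusion and exclusion over the three pairings. Two of them can hold at once, but never all
three, because no mode is its own conjugate. -/
theorem sum_pairings {n : ℕ} (F : Mode n → Mode n → Mode n → Mode n → ℂ) :
    (∑ a, ∑ b, ∑ c, ∑ d, if (b = a.conj ∧ d = c.conj) ∨ (c = a.conj ∧ d = b.conj) ∨
      (d = a.conj ∧ c = b.conj) then F a b c d else 0) =
    ∑ a, ∑ b, (F a a.conj b b.conj + F a b a.conj b.conj + F a b b.conj a.conj)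
      - ∑ a, (F a a.conj a.conj a + F a a.conj a a.conj + F a a a.conj a.conj) := by
  have key : ∀ a b c d : Mode n, (if (b = a.conj ∧ d = c.conj) ∨ (c = a.conj ∧ d = b.conj) ∨
      (d = a.conj ∧ c = b.conj) then F a b c d else 0) =
      (if d = c.conj then (if b = a.conj then F a b c d else 0) else 0)
      + (if d = b.conj then (if c = a.conj then F a b c d else 0) else 0)
      + (if d = a.conj then (if c = b.conj then F a b c d else 0) else 0)
      - (if d = a then (if c = a.conj then (if b = a.conj then F a b c d else 0) else 0) else 0)
      - (if d = a.conj then (if c = a then (if b = a.conj then F a b c d else 0) else 0) else 0)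
      - (if d = a.conj then (if c = a.conj then (if b = a then F a b c d else 0) else 0)
          else 0) := by
    intro a b c d
    have hne := a.conj_ne
    have hne' := a.conj_ne.symm
    by_cases hb : b = a.conj
    · subst hb
      by_cases hd : d = c.conj
      · subst hd
        by_cases hc : c = a.conj
        · subst hc; simp [hne, hne']
        · by_cases hc' : c = a
          · subst hc'; simp [hne, hne']
          · have h1 : c.conj ≠ a := fun h => hc (by rw [← h, Mode.conj_conj])
            have h2 : c.conj ≠ a.conj := fun h => hc' (by
              rw [← Mode.conj_conj c, h, Mode.conj_conj])
            simp [hc, hc', h1, h2]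
      · by_cases hc : c = a.conj
        · subst hc; simp at hd; simp [hd, hne]
        · by_cases hc' : c = a
          · subst hc'; simp [hd, hne']
          · simp [hc, hc', hd]
    · by_cases hc : c = a.conj
      · subst hc
        by_cases hd : d = b.conj
        · subst hd
          by_cases hba : b = a
          · subst hba; simp [hne, hne']
          · have h2 : b.conj ≠ a.conj := fun h => hba (by
              rw [← Mode.conj_conj b, h, Mode.conj_conj])
            simp [hb, h2]
        · by_cases hba : b = a
          · subst hba; simp [hd, hne']
          · have h2 : a.conj ≠ b.conj := fun h => hba (by
              rw [← Mode.conj_conj b, ← h, Mode.conj_conj])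
            simp [hb, hd, hba, h2]
      · by_cases hd : d = a.conj
        · subst hd
          by_cases hcb : c = b.conj
          · subst hcb; simp [hb, hc, Ne.symm hc]
          · simp [hb, hc, hcb]
        · simp [hb, hc, hd]
  simp only [key, Finset.sum_sub_distrib, Finset.sum_add_distrib, Finset.sum_ite_eq',
    Finset.sum_ite_irrel, Finset.sum_const_zero, Finset.mem_univ, if_true]
  ring

theorem resonance_iff_pairing (hodd : Odd N) {a b c d : Mode (N - 1)}
    (h : (N : ℤ) ∣ a.momentum + b.momentum + c.momentum + d.momentum) :
    a.freq (fpuFreq N) + b.freq (fpuFreq N) + c.freq (fpuFreq N) + d.freq (fpuFreq N) = 0 ↔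
      (b = a.conj ∧ d = c.conj) ∨ (c = a.conj ∧ d = b.conj) ∨ (d = a.conj ∧ c = b.conj) := by
  constructor
  · intro hs
    simp only [freq_fpuFreq] at hs
    simp only [← Mode.momentum_add_eq_zero_iff]
    exact opposite_of_resonance hodd a.abs_momentum_lt b.abs_momentum_lt c.abs_momentum_lt
      d.abs_momentum_lt a.momentum_ne_zero b.momentum_ne_zero c.momentum_ne_zero h (by linarith)
  · rintro (⟨rfl, rfl⟩ | ⟨rfl, rfl⟩ | ⟨rfl, rfl⟩) <;> simp only [Mode.freq_conj] <;> ring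

/-- The quartic part of the normal form. -/
def fpuNormalForm₄ (N : ℕ) (α β : ℝ) (I : Fin (N - 1) → ℝ) : ℝ :=
  1 / (4 * N) * ∑ k, (α ^ 2 + (β - α ^ 2) * sinFreq N k ^ 2) * I k ^ 2
    + (β - α ^ 2) / (2 * N) *
        ∑ l, ∑ m, if l ≠ m then sinFreq N l * sinFreq N m * I l * I m else 0

/-- The left side is the sum over pairings: β/8 collects three times β/24, while of the three
channels two carry exchange in the double sum and one in the overlap, the others having momentum 0.
The four choices of signs for (k, l) reduce by `exchangeSum_neg` to the channels k + l and k - l. -/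
theorem sum_exchange_eq (hN : N ≠ 0) (α β : ℝ) (I : Fin (N - 1) → ℝ) :
    (∑ a : Mode (N - 1), ∑ b : Mode (N - 1), a.amp * a.amp * (b.amp * b.amp) * I a.1 * I b.1 *
        (β * N / 8 + α ^ 2 * N ^ 2 / 4 * exchangeSum N (a.momentum + b.momentum)
          (a.freq (fpuFreq N) + b.freq (fpuFreq N))))
      - ∑ a : Mode (N - 1), a.amp * a.amp * (a.amp * a.amp) * I a.1 * I a.1 *
        (β * N / 8 + α ^ 2 * N ^ 2 / 8 * exchangeSum N (a.momentum + a.momentum)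
          (a.freq (fpuFreq N) + a.freq (fpuFreq N))) = fpuNormalForm₄ N α β I := by
  have hNR : (N : ℝ) ≠ 0 := by exact_mod_cast hN
  have hpp : ∀ k l : Fin (N - 1), exchangeSum N
      (Mode.momentum (N := N) (k, true) + Mode.momentum (N := N) (l, true))
      (Mode.freq (fpuFreq N) (k, true) + Mode.freq (fpuFreq N) (l, true)) =
      exchangeSum N (((k : ℕ) + 1) + ((l : ℕ) + 1)) (2 * sinFreq N k + 2 * sinFreq N l) := by
    intro k l; simp [Mode.momentum, Mode.freq, Mode.sign, fpuFreq]
  have hpm : ∀ k l : Fin (N - 1), exchangeSum N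
      (Mode.momentum (N := N) (k, true) + Mode.momentum (N := N) (l, false))
      (Mode.freq (fpuFreq N) (k, true) + Mode.freq (fpuFreq N) (l, false)) =
      exchangeSum N (((k : ℕ) + 1) - ((l : ℕ) + 1)) (2 * sinFreq N k - 2 * sinFreq N l) := by
    intro k l
    simp only [Mode.momentum, Mode.freq, Mode.sign, fpuFreq, if_true, Bool.false_eq_true, if_false]
    congr 1; ring
  have hmm : ∀ k l : Fin (N - 1), exchangeSum N
      (Mode.momentum (N := N) (k, false) + Mode.momentum (N := N) (l, false))
      (Mode.freq (fpuFreq N) (k, false) + Mode.freq (fpuFreq N) (l, false)) =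
      exchangeSum N (((k : ℕ) + 1) + ((l : ℕ) + 1)) (2 * sinFreq N k + 2 * sinFreq N l) := by
    intro k l
    rw [← hpp, ← exchangeSum_neg]
    simp only [Mode.momentum, Mode.freq, Mode.sign, fpuFreq, if_true, Bool.false_eq_true, if_false]
    congr 1 <;> ring
  have hmp : ∀ k l : Fin (N - 1), exchangeSum N
      (Mode.momentum (N := N) (k, false) + Mode.momentum (N := N) (l, true))
      (Mode.freq (fpuFreq N) (k, false) + Mode.freq (fpuFreq N) (l, true)) =
      exchangeSum N (((k : ℕ) + 1) - ((l : ℕ) + 1)) (2 * sinFreq N k - 2 * sinFreq N l) := by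
    intro k l
    rw [← hpm, ← exchangeSum_neg]
    simp only [Mode.momentum, Mode.freq, Mode.sign, fpuFreq, if_true, Bool.false_eq_true, if_false]
    congr 1 <;> ring
  simp only [Fintype.sum_prod_type, Fintype.sum_bool, hpp, hpm, hmp, hmm, Mode.amp_mul_self,
    ← Finset.sum_add_distrib]
  rw [fpuNormalForm₄]
  simp only [Finset.mul_sum, ← Finset.sum_add_distrib, ← Finset.sum_sub_distrib]
  refine Finset.sum_congr rfl fun k _ => ?_
  rw [← Finset.add_sum_erase _ _ (Finset.mem_univ k),
    ← Finset.add_sum_erase (Finset.univ) (fun l => (β - α ^ 2) / (2 * N) *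
      if k ≠ l then sinFreq N k * sinFreq N l * I k * I l else 0) (Finset.mem_univ k)]
  have hoff : ∀ l ∈ Finset.univ.erase k,
      (β - α ^ 2) / (2 * N) * (if k ≠ l then sinFreq N k * sinFreq N l * I k * I l else 0) =
      sinFreq N k / N * (sinFreq N l / N) * I k * I l * (β * N / 2 + α ^ 2 * N ^ 2 / 2 * (
        exchangeSum N (((k : ℕ) + 1) + ((l : ℕ) + 1)) (2 * sinFreq N k + 2 * sinFreq N l) +
        exchangeSum N (((k : ℕ) + 1) - ((l : ℕ) + 1)) (2 * sinFreq N k - 2 * sinFreq N l))) := by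
    intro l hl
    have hkl : k ≠ l := (Finset.ne_of_mem_erase hl).symm
    have h := exchangeSum_add_exchangeSum_sub hkl
    rw [if_pos hkl]
    generalize exchangeSum N (((k : ℕ) + 1) + ((l : ℕ) + 1)) (2 * sinFreq N k + 2 * sinFreq N l)
      + exchangeSum N (((k : ℕ) + 1) - ((l : ℕ) + 1)) (2 * sinFreq N k - 2 * sinFreq N l) = G at *
    field_simp
    linear_combination (-I k * I l * α ^ 2) * h
  rw [Finset.sum_congr rfl hoff]
  have hself := exchangeSum_self k
  have hzero : exchangeSum N (((k : ℕ) + 1 : ℤ) - ((k : ℕ) + 1)) (2 * sinFreq N k - 2 * sinFreq N k)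
      = 0 := exchangeSum_of_dvd (by simp) _
  rw [hzero]
  generalize exchangeSum N (((k : ℕ) + 1) + ((k : ℕ) + 1)) (2 * sinFreq N k + 2 * sinFreq N k) = G
    at *
  have hdiag : sinFreq N k / N * (sinFreq N k / N) * I k * I k *
      (β * N / 4 + α ^ 2 * N ^ 2 / 4 * G) =
      1 / (4 * N) * ((α ^ 2 + (β - α ^ 2) * sinFreq N k ^ 2) * I k ^ 2) := by
    field_simp
    linear_combination (α ^ 2 * I k ^ 2) * hself
  rw [← hdiag]
  simp only [ne_eq, not_true_eq_false, if_false, mul_zero, zero_add]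
  rw [add_sub_right_comm]
  refine congrArg₂ (· + ·) (by ring) (Finset.sum_congr rfl fun l _ => by ring)

/-- Either momentum is not conserved and the coefficient vanishes, or resonance means pairing. Only
products of actions survive. -/
theorem modeEval_resonant (hN : N ≠ 0) (hodd : Odd N) (α β : ℝ) (w : Phase (N - 1)) :
    modeEval w (quarticForm fun a b c d =>
        if a.freq (fpuFreq N) + b.freq (fpuFreq N) + c.freq (fpuFreq N) + d.freq (fpuFreq N) = 0
          then resonantCoeff N α β a b c d else 0) =
      (fpuNormalForm₄ N α β (action w) : ℂ) := by
  rw [modeEval_quarticForm]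
  have h1 : ∀ a b c d : Mode (N - 1), (if a.freq (fpuFreq N) + b.freq (fpuFreq N) +
      c.freq (fpuFreq N) + d.freq (fpuFreq N) = 0 then resonantCoeff N α β a b c d else 0) *
        (Mode.coord w a * Mode.coord w b * Mode.coord w c * Mode.coord w d) =
      if (b = a.conj ∧ d = c.conj) ∨ (c = a.conj ∧ d = b.conj) ∨ (d = a.conj ∧ c = b.conj) then
        resonantCoeff N α β a b c d *
          (Mode.coord w a * Mode.coord w b * Mode.coord w c * Mode.coord w d) else 0 := by
    intro a b c d
    by_cases h : (N : ℤ) ∣ a.momentum + b.momentum + c.momentum + d.momentum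
    · simp only [resonance_iff_pairing hodd h, ite_mul, zero_mul]
    · rw [resonantCoeff_of_not_dvd α β h]; simp
  simp only [h1]
  rw [sum_pairings, ← sum_exchange_eq hN, ← Mode.sum_conj]
  have hc := fun a : Mode (N - 1) => Mode.coord_mul_conj w a
  have hneg : ∀ a b : Mode (N - 1), exchangeSum N (-a.momentum + -b.momentum)
      (-a.freq (fpuFreq N) + -b.freq (fpuFreq N)) = exchangeSum N (a.momentum + b.momentum)
      (a.freq (fpuFreq N) + b.freq (fpuFreq N)) := fun a b => by
    rw [← exchangeSum_neg]; congr 1 <;> ring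
  push_cast
  congr 1
  · rw [← Mode.sum_conj]
    refine Finset.sum_congr rfl fun a _ => Finset.sum_congr rfl fun b _ => ?_
    simp only [Mode.conj_conj]
    rw [resonantCoeff_of_eq_zero α β (by simp only [Mode.momentum_conj]; ring),
      resonantCoeff_of_eq_zero α β (by simp only [Mode.momentum_conj]; ring),
      resonantCoeff_of_eq_zero α β (by simp only [Mode.momentum_conj]; ring)]
    have z1 : exchangeSum N (b.momentum + -b.momentum)
        (b.freq (fpuFreq N) + -b.freq (fpuFreq N)) = 0 := exchangeSum_of_dvd (by simp) _
    simp only [Mode.momentum_conj, Mode.freq_conj, Mode.amp_conj,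
      add_comm (-b.momentum), add_comm (-b.freq (fpuFreq N)), z1, hneg]
    push_cast
    linear_combination (((a.amp : ℂ) * a.amp * b.amp * b.amp) * (β * N / 8 + α ^ 2 * N ^ 2 / 4 *
      exchangeSum N (a.momentum + b.momentum) (a.freq (fpuFreq N) + b.freq (fpuFreq N)))) *
        (Mode.coord w b * Mode.coord w b.conj * hc a + (action w a.1 : ℂ) * hc b)
  · rw [← Mode.sum_conj]
    refine Finset.sum_congr rfl fun a _ => ?_
    simp only [Mode.conj_conj]
    rw [resonantCoeff_of_eq_zero α β (by simp only [Mode.momentum_conj]; ring),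
      resonantCoeff_of_eq_zero α β (by simp only [Mode.momentum_conj]; ring),
      resonantCoeff_of_eq_zero α β (by simp only [Mode.momentum_conj]; ring)]
    have z1 : exchangeSum N (a.momentum + -a.momentum)
        (a.freq (fpuFreq N) + -a.freq (fpuFreq N)) = 0 := exchangeSum_of_dvd (by simp) _
    have z2 : exchangeSum N (-a.momentum + a.momentum)
        (-a.freq (fpuFreq N) + a.freq (fpuFreq N)) = 0 := exchangeSum_of_dvd (by simp) _
    simp only [Mode.momentum_conj, Mode.freq_conj, Mode.amp_conj, z1, z2]
    push_cast
    linear_combination (((a.amp : ℂ) * a.amp * a.amp * a.amp) * (β * N / 8 + α ^ 2 * N ^ 2 / 8 *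
      exchangeSum N (a.momentum + a.momentum) (a.freq (fpuFreq N) + a.freq (fpuFreq N)))) *
        (Mode.coord w a * Mode.coord w a.conj * hc a + (action w a.1 : ℂ) * hc a)

end Resonant

/-! ### Normalization of the FPU Hamiltonian -/

section Main
variable {N : ℕ}

theorem IsSymplecticAut.symm {n : ℕ} {Ψ : Phase n ≃ₜ Phase n} (h : IsSymplecticAut Ψ) :
    IsSymplecticAut Ψ.symm where
  map_zero := by rw [Homeomorph.symm_apply_eq, h.map_zero]
  analytic := h.analytic_symm
  analytic_symm := h.analytic
  symplectic w a b := by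
    have hc : (fderiv ℝ Ψ (Ψ.symm w)).comp (fderiv ℝ Ψ.symm w) =
        ContinuousLinearMap.id ℝ (Phase n) := by
      rw [← fderiv_comp w (h.analytic _ (Set.mem_univ _)).differentiableAt
        (h.analytic_symm _ (Set.mem_univ _)).differentiableAt]
      have : (Ψ ∘ Ψ.symm : Phase n → Phase n) = id := by ext1 x; simp
      rw [this, fderiv_id]
    rw [← h.symplectic (Ψ.symm w), ← ContinuousLinearMap.comp_apply,
      ← ContinuousLinearMap.comp_apply, hc]
    rfl
  tangent := h.symm_tangent

theorem IsFPUPotential.sub_taylor_isBigO {α β : ℝ} {V : ℝ → ℝ} (hV : IsFPUPotential α β V) :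
    (fun r => V r - (r ^ 2 / 2 + α / 6 * r ^ 3 + β / 24 * r ^ 4)) =O[𝓝 0] fun r => r ^ 5 := by
  -- The expansion is taken one order further than needed, so that the little-o remainder and the
  -- fifth order term are both O(r⁵).
  have h := taylor_isLittleO_univ (x₀ := (0 : ℝ)) (n := 5) (f := V)
    (contDiff_infty.1 hV.smooth 5)
  have ht : ∀ r, taylorWithinEval V 5 Set.univ 0 r =
      r ^ 2 / 2 + α / 6 * r ^ 3 + β / 24 * r ^ 4 + iteratedDeriv 5 V 0 / 120 * r ^ 5 := by
    intro r
    simp only [taylorWithinEval_succ, taylor_within_zero_eval, iteratedDerivWithin_univ,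
      hV.coeff_zero, zero_add, hV.coeff_one, hV.coeff_two, hV.coeff_three, hV.coeff_four,
      sub_zero, Nat.factorial, smul_eq_mul]
    push_cast; ring
  simp only [ht, sub_zero] at h
  refine (h.isBigO.add ((isBigO_refl (fun r : ℝ => r ^ 5) (𝓝 0)).const_mul_left
    (iteratedDeriv 5 V 0 / 120))).congr_left fun r => ?_
  ring

/-- Q drops out of the differences, and the term linear in P vanishes with the total momentum of z.
Uniformity in Q and P is a consequence. -/
theorem fpuHamiltonian_equilibrium_add (V : ℝ → ℝ) (Q P : ℝ) {z : Phase N}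
    (hz : z ∈ reducedPhase N) :
    fpuHamiltonian N V (equilibrium N Q P + z) = N * P ^ 2 / 2 + fpuHamiltonian N V z := by
  have h2 : ∑ n, z.2 n = 0 := hz.2
  simp only [fpuHamiltonian, equilibrium, Prod.fst_add, Prod.snd_add, Pi.add_apply,
    add_sub_add_left_eq_sub, add_sq, Finset.sum_add_distrib, ← Finset.mul_sum, h2]
  simp
  ring

/-- In normal mode coordinates the Hamiltonian of the chain has the mode polynomials as its
Taylor expansion. -/
theorem fpuHamiltonian_modeMap_isBigO (hN : N ≠ 0) {α β : ℝ} {V : ℝ → ℝ}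
    (hV : IsFPUPotential α β V) :
    VanishesToOrder 5 fun w : Phase (N - 1) => (fpuHamiltonian N V (modeMap N w) : ℂ) -
      modeEval w (harmonicForm (fpuFreq N) + cubicForm (fun a b c => (fpuCubic N α a b c : ℂ)) +
        quarticForm fun a b c d => (fpuQuartic N β a b c d : ℂ)) := by
  have hlin : ∀ m : Fin N, (fun w : Phase (N - 1) =>
      (modeMap N w).1 (finRotate N m) - (modeMap N w).1 m) =O[𝓝 0] fun w => w := by
    intro m
    let T : Phase (N - 1) →ₗ[ℝ] ℝ :=
      ((LinearMap.proj (R := ℝ) (φ := fun _ => ℝ) (finRotate N m) - LinearMap.proj m) ∘ₗ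
        LinearMap.fst ℝ _ _) ∘ₗ modeMap N
    exact (LinearMap.toContinuousLinearMap T).isBigO_id _
  have hsum : (fun w : Phase (N - 1) => ∑ m : Fin N,
      (V ((modeMap N w).1 (finRotate N m) - (modeMap N w).1 m) -
        (((modeMap N w).1 (finRotate N m) - (modeMap N w).1 m) ^ 2 / 2
        + α / 6 * ((modeMap N w).1 (finRotate N m) - (modeMap N w).1 m) ^ 3
        + β / 24 * ((modeMap N w).1 (finRotate N m) - (modeMap N w).1 m) ^ 4)))
      =O[𝓝 0] fun w => ‖w‖ ^ 5 := by
    refine IsBigO.fun_sum fun m _ => ?_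
    exact (hV.sub_taylor_isBigO.comp_tendsto ((hlin m).trans_tendsto Filter.tendsto_id)).trans
      ((hlin m).norm_right.pow 5)
  have hC := (Complex.ofRealCLM.isBigO_comp _ (𝓝 0)).trans hsum
  refine hC.congr_left fun w => ?_
  have hq := quadratic_modeMap w
  simp only [map_add, modeEval_harmonicForm, modeEval_fpuCubic hN, modeEval_fpuQuartic hN]
  rw [← Complex.ofReal_add, ← Complex.ofReal_add, ← Complex.ofReal_sub, Complex.ofRealCLM_apply]
  congr 1
  simp only [fpuHamiltonian, fpuFreq, Finset.sum_sub_distrib, Finset.sum_add_distrib,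
    ← Finset.mul_sum, ← Finset.sum_div, mul_assoc]
  linear_combination -hq

theorem fpuNormalForm_eq (α β : ℝ) (I : Fin (N - 1) → ℝ) :
    fpuNormalForm N α β I = ∑ k, fpuFreq N k * I k + fpuNormalForm₄ N α β I := by
  simp only [fpuNormalForm, fpuNormalForm₄, fpuFreq, Finset.mul_sum]
  rw [add_assoc]; simp only [mul_assoc]

/-- A symplectic automorphism, depending only on `α` and `β`, that brings the chain to normal
form. -/
theorem exists_fpu_normalization (hN : N ≠ 0) (hodd : Odd N) (α β : ℝ) :
    ∃ Ψ : Phase (N - 1) ≃ₜ Phase (N - 1), IsSymplecticAut Ψ ∧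
      ∀ V : ℝ → ℝ, IsFPUPotential α β V →
        (fun w => fpuHamiltonian N V (modeMap N (Ψ w)) - fpuNormalForm N α β (action w))
          =O[𝓝 0] fun w => ‖w‖ ^ 5 := by
  obtain ⟨Ψ, hΨ, h⟩ := exists_normalization (fpuFreq N)
    (U := fun a b c => (fpuCubic N α a b c : ℂ))
    (T := fun a b c d => (fpuQuartic N β a b c d : ℂ)) (fpuCubic_symm α)
    (fun a b c => by rw [fpuCubic_conj, Complex.conj_ofReal])
    (fun a b c d => by rw [fpuQuartic_conj, Complex.conj_ofReal])
    (fun a b c h => by rw [fpuCubic_eq_zero hodd α a b c h, Complex.ofReal_zero])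
  refine ⟨Ψ, hΨ, fun V hV => ?_⟩
  have hO : Ψ =O[𝓝 0] fun w => w := by
    simpa [hΨ.map_zero] using hΨ.tangent.isBigO_sub
  have h2 := ((fpuHamiltonian_modeMap_isBigO hN hV).comp hO).add h
  refine ((isBigO_norm_left.2 h2).congr_left fun w => ?_).of_norm_left
  have hr := modeEval_resonant hN hodd α β w
  rw [map_add (modeEval w), hr, modeEval_harmonicForm, sub_add_sub_cancel, fpuNormalForm_eq,
    ← Complex.ofReal_add, ← Complex.ofReal_sub, Complex.norm_real]

theorem exists_isHomogeneous_fpuNormalForm₄ (α β : ℝ) : ∃ p : MvPolynomial (Fin (N - 1)) ℝ,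
    p.IsHomogeneous 2 ∧ ∀ I, eval I p = fpuNormalForm₄ N α β I := by
  refine ⟨C (1 / (4 * N) : ℝ) * ∑ k, C (α ^ 2 + (β - α ^ 2) * sinFreq N k ^ 2) * X k ^ 2
    + C ((β - α ^ 2) / (2 * N)) *
        ∑ l, ∑ m, if l ≠ m then C (sinFreq N l * sinFreq N m) * (X l * X m) else 0, ?_, ?_⟩
  · refine (IsHomogeneous.C_mul (IsHomogeneous.sum _ _ _ fun k _ =>
      IsHomogeneous.C_mul ((isHomogeneous_X ℝ k).pow 2) _) _).add
      (IsHomogeneous.C_mul (IsHomogeneous.sum _ _ _ fun l _ =>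
        IsHomogeneous.sum _ _ _ fun m _ => ?_) _)
    split_ifs
    · exact IsHomogeneous.C_mul ((isHomogeneous_X ℝ l).mul (isHomogeneous_X ℝ m)) _
    · exact isHomogeneous_zero _ _ _
  · intro I
    simp only [map_add, map_mul, eval_C, map_sum, map_pow, eval_X, apply_ite (eval I), map_zero,
      fpuNormalForm₄, mul_assoc]

theorem inBirkhoffNormalForm_of_isBigO {α β c : ℝ} {H : Phase (N - 1) → ℝ}
    (hH : (fun w => H w - (c + fpuNormalForm N α β (action w))) =O[𝓝 0] fun w => ‖w‖ ^ 5) :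
    InBirkhoffNormalForm 4 H := by
  obtain ⟨p, hp, hpe⟩ := exists_isHomogeneous_fpuNormalForm₄ (N := N) α β
  have hI : ∀ w : Phase (N - 1), action w = (1 / 2 : ℝ) • fun k => (w.1 k) ^ 2 + (w.2 k) ^ 2 := by
    intro w; ext k; simp [action]; ring
  have hsq : ∀ (t : ℝ) (J : Fin (N - 1) → ℝ), fpuNormalForm₄ N α β (t • J) =
      t ^ 2 * fpuNormalForm₄ N α β J := by
    intro t J
    simp only [fpuNormalForm₄, Pi.smul_apply, smul_eq_mul, mul_add, Finset.mul_sum, mul_ite,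
      mul_zero]
    refine congrArg₂ (· + ·) (Finset.sum_congr rfl fun k _ => by ring)
      (Finset.sum_congr rfl fun l _ => Finset.sum_congr rfl fun m _ => ?_)
    split_ifs
    · ring
    · rfl
  -- The bound holds at w = 0 itself, where its right side is 0.
  have h0 : H 0 = c := by
    obtain ⟨C, hC⟩ := hH.bound
    have := hC.self_of_nhds
    have ha : action (0 : Phase (N - 1)) = 0 := by ext k; simp [action]
    rw [ha] at this
    have hz : fpuNormalForm N α β 0 = 0 := by simp [fpuNormalForm]
    rw [hz] at this
    simpa [sub_eq_zero] using this
  -- The variables are x² + y² = 2I, so the linear part 2 sin · I loses its factor 2 and the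
  -- quadratic one acquires 1/4.
  refine ⟨fun j => if j = 1 then ∑ k, C (sinFreq N k) * X k else
    if j = 2 then C (1 / 4) * p else 0, fun j => ?_, ?_⟩
  · dsimp only
    split_ifs with h1 h2
    · subst h1
      exact IsHomogeneous.sum _ _ _ fun k _ => (isHomogeneous_X ℝ k).C_mul _
    · subst h2
      exact hp.C_mul _
    · exact isHomogeneous_zero _ _ _
  · refine hH.congr_left fun w => ?_
    rw [h0, show Finset.Icc 1 (4 / 2) = {1, 2} from rfl, Finset.sum_pair (by norm_num)]
    simp only [if_true, OfNat.ofNat_ne_one, if_false, map_sum, map_mul, eval_C, eval_X, hpe]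
    rw [fpuNormalForm_eq, hI, hsq]
    simp only [fpuFreq, Pi.smul_apply, smul_eq_mul]
    rw [show ∑ k, 2 * sinFreq N k * (1 / 2 * (w.1 k ^ 2 + w.2 k ^ 2)) =
      ∑ k, sinFreq N k * (w.1 k ^ 2 + w.2 k ^ 2) from
        Finset.sum_congr rfl fun k _ => by ring]
    ring

end Main

end

/-! ### The canonical chart. -/

theorem theorem1 (N : ℕ) (hN : 3 ≤ N) (hodd : Odd N) :
    ∃ L : reducedPhase N ≃L[ℝ] Phase (N - 1), ∀ α β : ℝ,
      ∃ Φ : OpenPartialHomeomorph (reducedPhase N) (Phase (N - 1)),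
        IsCanonicalChart Φ ∧
        HasFDerivAt Φ (L : reducedPhase N →L[ℝ] Phase (N - 1)) 0 ∧
        ∀ V : ℝ → ℝ, IsFPUPotential α β V →
          (∀ Q P : ℝ, InBirkhoffNormalForm 4
            (fun w => fpuHamiltonian N V (equilibrium N Q P + (Φ.symm w : Phase N)))) ∧
          ∃ C : ℝ, ∀ᶠ w in 𝓝 (0 : Phase (N - 1)), ∀ Q P : ℝ,
            |fpuHamiltonian N V (equilibrium N Q P + (Φ.symm w : Phase N))
              - (N * P ^ 2 / 2 + fpuNormalForm N α β (action w))| ≤ C * ‖w‖ ^ 5 := by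
  have hN0 : N ≠ 0 := by omega
  let M := modeEquiv hN0
  refine ⟨M.symm, fun α β => ?_⟩
  obtain ⟨Ψ, hΨ, hH⟩ := exists_fpu_normalization hN0 hodd α β
  -- The normalizing map goes from new to old coordinates, so the chart uses its inverse. As Ψ is
  -- tangent to the identity, the differential at 0 is `M.symm` for all α and β.
  let Φ := (M.symm.toHomeomorph.trans Ψ.symm).toOpenPartialHomeomorph
  have hΦ : ∀ z, Φ z = Ψ.symm (M.symm z) := fun z => rfl
  have hΦs : ∀ w, (Φ.symm w : Phase N) = modeMap N (Ψ w) := fun w => rfl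
  have hder : ∀ z, HasFDerivAt Φ ((fderiv ℝ Ψ.symm (M.symm z)).comp
      (M.symm : reducedPhase N →L[ℝ] Phase (N - 1))) z := fun z =>
    (hΨ.symm.analytic _ (Set.mem_univ _)).differentiableAt.hasFDerivAt.comp z M.symm.hasFDerivAt
  refine ⟨Φ, ?_, ?_, fun V hV => ?_⟩
  · refine ⟨Set.mem_univ _, ?_, ?_, ?_, ?_⟩
    · rw [hΦ, map_zero, hΨ.symm.map_zero]
    · intro z _
      exact (hΨ.symm.analytic _ (Set.mem_univ _)).comp
        ((M.symm : reducedPhase N →L[ℝ] Phase (N - 1)).analyticAt z)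
    · intro w _
      exact ((M : Phase (N - 1) →L[ℝ] reducedPhase N).analyticAt _).comp
        (hΨ.analytic w (Set.mem_univ _))
    · intro z _ a b
      rw [(hder z).fderiv]
      simp only [ContinuousLinearMap.comp_apply, hΨ.symm.symplectic]
      have hM : ∀ a : reducedPhase N, (a : Phase N) = modeMap N (M.symm a) := fun a => by
        rw [← coe_modeEquiv hN0]; exact congrArg _ (M.apply_symm_apply a).symm
      rw [hM a, hM b, symplecticForm_modeMap]
      rfl
  · have h0 := hder 0
    rw [map_zero, hΨ.symm.tangent.fderiv] at h0
    exact h0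
  · have hE : ∀ Q P w, fpuHamiltonian N V (equilibrium N Q P + (Φ.symm w : Phase N)) =
        N * P ^ 2 / 2 + fpuHamiltonian N V (modeMap N (Ψ w)) := fun Q P w => by
      rw [fpuHamiltonian_equilibrium_add V Q P (Φ.symm w).2, hΦs]
    simp only [hE]
    refine ⟨fun Q P => inBirkhoffNormalForm_of_isBigO (α := α) (β := β) (c := N * P ^ 2 / 2)
      ((hH V hV).congr_left fun w => (add_sub_add_left_eq_sub _ _ _).symm), ?_⟩
    obtain ⟨C, hC⟩ := (hH V hV).bound
    refine ⟨C, hC.mono fun w hw Q P => ?_⟩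
    rw [add_sub_add_left_eq_sub]
    simpa using hw
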